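/- **Setting.** Fix $k\ge 2$, $[k]=\{1,\dots,k\}$, and let $\mathbf U_k$ be the uniform distribution on $[k]$. A private-coin (non-interactive) protocol for $n$ users consists of randomisers $R_1,\dots,R_n$ from $[k]$ to a common measurable message space $\mathcal Y$ and a randomised analyser $A:\mathcal Y^n\to\{\text{accept},\text{reject}\}$; on data $x_1,\dots,x_n$ its output is $A(R_1(x_1),\dots,R_n(x_n))$, where all the randomness is independent. It is $\varepsilon$-LDP if $\Pr[R_i(x)\in S]\le e^{\varepsilon}\Pr[R_i(x')\in S]$ for all $i$, $x,x'\in[k]$ and measurable $S$. It solves $\alpha$-uniformity testing with $n$ samples if, on $n$ i.i.d. samples from $\mathbf p$, it accepts with probability at least $2/3$ when $\mathbf p=\mathbf U_k$, and rejects with probability at least $2/3$ whenever $d_{\mathrm{TV}}(\mathbf p,\mathbf U_k)>\alpha$. Put $$\rho(k,\varepsilon,\alpha)=\frac{k^{3/2}}{\alpha^2(e^\varepsilon-1)^2}+\frac{k^{3/2}}{\alpha^2e^\varepsilon}+\frac{\sqrt k}{\alpha^2}.$$ **Generalised Hadamard Response.** For $\varepsilon>0$ let $a=2^{\lfloor\log_2\min(e^\varepsilon,2k)\rfloor}$,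 $b=2^{\lceil\log_2(k/a+1)\rceil}$, $K=ab$, $s=b/2$, and let $\bar H_{a,b}$ be the $K\times K$ matrix made of $a\times a$ blocks of order $b$ whose diagonal blocks are Sylvester's Hadamard matrix $H_b$ and whose other blocks have all entries $-1$. Assign to the elements $x\in[k]$ distinct rows of $\bar H_{a,b}$ having exactly $s$ entries $+1$, and let $C_x\subseteq[K]$ be the set of positions of the $+1$ entries of the row of $x$. The randomiser $R:[k]\to[K]$ is given by $$\Pr[R(x)=y]=\frac{(e^\varepsilon-1)\mathbf 1[y\in C_x]+1}{s e^\varepsilon+K-s}.$$ Let $\mathbf q^*$ be the law of $R(X)$ for $X\sim\mathbf U_k$, and let $\gamma>0$ be given by $\gamma^2=\frac{2\alpha^2}{sk}\Bigl(\frac{e^\varepsilon-1}{e^\varepsilon+K/s-1}\Bigr)^2$. An $\ell_2$ identity tester for $(\mathbf q^*,\gamma)$ with $n$ samples is a randomised test that, given $n$ i.i.d. samples from an unknown distribution $\mathbf q$ on $[K]$, accepts with probability at least $2/3$ if $\mathbf q=\mathbf q^*$ and rejects with probability at least $2/3$ if $\|\mathbf q-\mathbf q^*\|_2>\gamma$.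 **Theorem.** 1. (Upper bound.) There is an absolute constant $C>0$ such that for all $k\ge2$ and $\varepsilon>0$: an assignment of rows as above exists; a message consists of $\lceil\log_2K\rceil\le\log_2k+4$ bits; and for every such assignment, every $\alpha\in(0,1]$ and every $n\ge C\rho(k,\varepsilon,\alpha)$, an $\ell_2$ identity tester for $(\mathbf q^*,\gamma)$ with $n$ samples exists, and the private-coin protocol in which all $n$ users apply $R$ and the analyser applies any such tester to the $n$ messages is $\varepsilon$-LDP and solves $\alpha$-uniformity testing. 2. (Optimality.) For every $\alpha_0<1/2$ there is a constant $c>0$ depending only on $\alpha_0$ such that for all $k\ge2$, $\varepsilon>0$ and $\alpha\in(0,\alpha_0]$, every private-coin $\varepsilon$-LDP protocol for $n$ users, with any message space, that solves $\alpha$-uniformity testing has $n\ge c\,\rho(k,\varepsilon,\alpha)$. 3. (Trace bound.) For all $k\ge2$, $\varepsilon>0$ and every $\varepsilon$-LDP randomiser $R'$ from $[k]$ to a countable discrete set $\mathcal Y$, the $\lfloor k/2\rfloor\times\lfloor k/2\rfloor$ matrix $$H(R')_{ij}=\sum_{y\in\mathcal Y}\frac{\bigl(\Pr[R'(2i)=y]-\Pr[R'(2i-1)=y]\bigr)\bigl(\Pr[R'(2j)=y]-\Pr[R'(2j-1)=y]\bigr)}{\sum_{x\in[k]}\Pr[R'(x)=y]}$$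 (terms with zero denominator being $0$) satisfies $\operatorname{Tr}H(R')\le 2e^\varepsilon$. -/

import Mathlib

open MeasureTheory ProbabilityTheory Real

universe u

namespace LDPTesting

noncomputable section

/-! ### Private-coin local protocols -/

/-- A (randomised) local randomiser with data domain `Fin k` and message space `Y`. -/
structure Randomiser (k : ℕ) (Y : Type u) [MeasurableSpace Y] where
  kernel : Kernel (Fin k) Y
  isMarkov : IsMarkovKernel kernel

/-- A randomised binary test on `n` observations in `Y` (`true` means accept). -/
structure RandomisedTest (n : ℕ) (Y : Type u) [MeasurableSpace Y] where
  kernel : Kernel (Fin n → Y) Bool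
  isMarkov : IsMarkovKernel kernel

/-- `ε`-local differential privacy of a randomiser (the dataset is a single data point, so that
any two inputs are adjacent). -/
def Randomiser.IsPrivate {k : ℕ} {Y : Type u} [MeasurableSpace Y] (R : Randomiser k Y)
    (ε : ℝ) : Prop :=
  ∀ (x x' : Fin k) (S : Set Y), MeasurableSet S →
    R.kernel x S ≤ ENNReal.ofReal (exp ε) * R.kernel x' S

/-- A non-interactive private-coin protocol for `n` users with binary output: user `i` applies
the randomiser `i` (with independent private randomness) to her data point, and the analyser
outputs accept or reject on the basis of the `n` messages. -/
structure Protocol (n k : ℕ) (Y : Type u) [MeasurableSpace Y] where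
  randomiser : Fin n → Randomiser k Y
  analyser : RandomisedTest n Y

variable {n k : ℕ} {Y : Type u} [MeasurableSpace Y]

/-- Every randomiser is `ε`-differentially private. -/
def Protocol.IsLDP (P : Protocol n k Y) (ε : ℝ) : Prop :=
  ∀ i, (P.randomiser i).IsPrivate ε

/-- The law of the output of the test on `n` i.i.d. observations with law `q`. -/
def RandomisedTest.outputIID (A : RandomisedTest n Y) (q : Measure Y) : Measure Bool :=
  (Measure.pi fun _ : Fin n => q).bind A.kernel

/-- The law of the output of the protocol on the dataset `x`. -/
def Protocol.output (P : Protocol n k Y) (x : Fin n → Fin k) : Measure Bool :=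
  (Measure.pi fun i => (P.randomiser i).kernel (x i)).bind P.analyser.kernel

/-- The law of the output of the protocol on a dataset of `n` i.i.d. samples from `p`. -/
def Protocol.outputIID (P : Protocol n k Y) (p : Measure (Fin k)) : Measure Bool :=
  (Measure.pi fun _ : Fin n => p).bind P.output

/-! ### Uniformity testing -/

/-- The uniform distribution on the domain. -/
def unif (k : ℕ) : Measure (Fin k) := uniformOn Set.univ

/-- Total variation distance of distributions on a finite set. -/
def tv (p q : Measure (Fin k)) : ℝ := (1 / 2) * ∑ x, |p.real {x} - q.real {x}|

/-- The `ℓ₂` distance of distributions on a finite set. -/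
def l2Dist [Fintype Y] (p q : Measure Y) : ℝ := √(∑ y, (p.real {y} - q.real {y}) ^ 2)

/-- The protocol, run on `n` i.i.d. samples, solves `α`-uniformity testing. -/
def Protocol.SolvesUniformityTesting (P : Protocol n k Y) (α : ℝ) : Prop :=
  (2 / 3 ≤ (P.outputIID (unif k)).real {true}) ∧
  ∀ p : Measure (Fin k), IsProbabilityMeasure p → α < tv p (unif k) →
    2 / 3 ≤ (P.outputIID p).real {false}

/-- The test distinguishes, from `n` i.i.d. samples of an arbitrary unknown distribution `q`,
between `q = qref` and `‖q - qref‖₂ > γ`. -/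
def RandomisedTest.IsL2IdentityTester [Fintype Y] (A : RandomisedTest n Y) (qref : Measure Y)
    (γ : ℝ) : Prop :=
  (2 / 3 ≤ (A.outputIID qref).real {true}) ∧
  ∀ q : Measure Y, IsProbabilityMeasure q → γ < l2Dist q qref →
    2 / 3 ≤ (A.outputIID q).real {false}

/-- The rate `k^{3/2} / (α² (e^ε - 1)²) + k^{3/2} / (α² e^ε) + k^{1/2} / α²`. -/
def rate (k : ℕ) (ε α : ℝ) : ℝ :=
  (k : ℝ) ^ (3 / 2 : ℝ) / (α ^ 2 * (exp ε - 1) ^ 2) + (k : ℝ) ^ (3 / 2 : ℝ) / (α ^ 2 * exp ε)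
    + √(k : ℝ) / α ^ 2

/-! ### Generalised Hadamard Response -/

/-- Sylvester's Hadamard matrix of order `2 ^ m`. -/
def sylvester : (m : ℕ) → Matrix (Fin (2 ^ m)) (Fin (2 ^ m)) ℤ
  | 0 => fun _ _ => 1
  | m + 1 =>
    let e : Fin (2 ^ m) ⊕ Fin (2 ^ m) ≃ Fin (2 ^ (m + 1)) :=
      finSumFinEquiv.trans (finCongr (by rw [pow_succ, mul_two]))
    Matrix.reindex e e
      (Matrix.fromBlocks (sylvester m) (sylvester m) (sylvester m) (-sylvester m))

/-- The reduced Hadamard matrix with `a × a` blocks of order `2 ^ m`: Sylvester's matrix in the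
diagonal blocks, and all entries `-1` outside of them. -/
def reducedHadamard (a m : ℕ) : Matrix (Fin a × Fin (2 ^ m)) (Fin a × Fin (2 ^ m)) ℤ :=
  fun r c => if r.1 = c.1 then sylvester m r.2 c.2 else -1

/-- The set of columns in which the row `r` of the reduced Hadamard matrix has entry `+1`. -/
def plusSet (a m : ℕ) (r : Fin a × Fin (2 ^ m)) : Finset (Fin a × Fin (2 ^ m)) :=
  {c | reducedHadamard a m r c = 1}

/-- The exponent `⌊log₂ min(e^ε, 2k)⌋`. -/
def logA (k : ℕ) (ε : ℝ) : ℕ := ⌊logb 2 (min (exp ε) (2 * k))⌋₊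

/-- The number of blocks, `a = 2^⌊log₂ min(e^ε, 2k)⌋`. -/
def blockCount (k : ℕ) (ε : ℝ) : ℕ := 2 ^ logA k ε

/-- The exponent `⌈log₂ (k / a + 1)⌉`. -/
def logB (k : ℕ) (ε : ℝ) : ℕ := ⌈logb 2 ((k : ℝ) / blockCount k ε + 1)⌉₊

/-- The order of the blocks, `b = 2^⌈log₂ (k / a + 1)⌉`. -/
def blockSize (k : ℕ) (ε : ℝ) : ℕ := 2 ^ logB k ε

/-- The subset size `s = b / 2`. -/
def subsetSize (k : ℕ) (ε : ℝ) : ℕ := blockSize k ε / 2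

/-- The message space, which has `K = a * b` elements. -/
abbrev Message (k : ℕ) (ε : ℝ) : Type := Fin (blockCount k ε) × Fin (2 ^ logB k ε)

/-- An assignment of distinct rows of the reduced Hadamard matrix, each with exactly `s` entries
equal to `+1`, to the elements of the domain. -/
structure RowAssignment (k : ℕ) (ε : ℝ) where
  row : Fin k → Message k ε
  injective : Function.Injective row
  card_plusSet : ∀ x, (plusSet (blockCount k ε) (logB k ε) (row x)).card = subsetSize k ε

instance (k : ℕ) (ε : ℝ) : Nonempty (Message k ε) :=
  ⟨(⟨0, by unfold blockCount; positivity⟩, ⟨0, by positivity⟩)⟩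

/-- The probability `((e^ε - 1) 1[y ∈ C] + 1) / (s e^ε + K - s)` of the message `y`, where
`s = |C|` and `K` is the size of the message space. -/
def responseProb {Z : Type} [Fintype Z] [DecidableEq Z] (ε : ℝ) (C : Finset Z) (y : Z) : ℝ :=
  ((exp ε - 1) * (if y ∈ C then 1 else 0) + 1) / (C.card * exp ε + Fintype.card Z - C.card)

theorem responseProb_nonneg {Z : Type} [Fintype Z] [DecidableEq Z] (ε : ℝ)
    (C : Finset Z) (y : Z) : 0 ≤ responseProb ε C y := by
  unfold responseProb
  have h1 : (C.card : ℝ) ≤ Fintype.card Z := by exact_mod_cast Finset.card_le_univ C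
  have h2 : 0 < exp ε := exp_pos ε
  apply div_nonneg
  · split_ifs <;> linarith
  · have : 0 ≤ (C.card : ℝ) * exp ε := by positivity
    linarith

theorem sum_responseProb {Z : Type} [Fintype Z] [DecidableEq Z] [Nonempty Z] (ε : ℝ)
    (C : Finset Z) : ∑ y, responseProb ε C y = 1 := by
  unfold responseProb
  have h1 : (C.card : ℝ) ≤ Fintype.card Z := by exact_mod_cast Finset.card_le_univ C
  have h2 : 0 < exp ε := exp_pos ε
  have h3 : (0 : ℝ) < Fintype.card Z := by exact_mod_cast Fintype.card_pos
  have h4 : (0 : ℝ) < C.card * exp ε + Fintype.card Z - C.card := by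
    rcases Nat.eq_zero_or_pos C.card with h | h
    · simp only [h]; simpa using h3
    · have : (0 : ℝ) < C.card * exp ε := by positivity
      linarith
  rw [← Finset.sum_div, Finset.sum_add_distrib, ← Finset.mul_sum]
  simp only [Finset.sum_ite_mem, Finset.univ_inter, Finset.sum_const, Finset.card_univ,
    nsmul_eq_mul, mul_one]
  rw [div_eq_one_iff_eq h4.ne']
  ring

/-- The law of the message on an input with associated subset `C`. -/
def responsePMF {Z : Type} [Fintype Z] [DecidableEq Z] [Nonempty Z] (ε : ℝ) (C : Finset Z) :
    PMF Z :=
  PMF.ofFintype (fun y => ENNReal.ofReal (responseProb ε C y)) (by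
    rw [← ENNReal.ofReal_sum_of_nonneg fun y _ => responseProb_nonneg ε C y, sum_responseProb,
      ENNReal.ofReal_one])

/-- The Generalised Hadamard Response randomiser: the subset `C_x` associated with the input `x`
is the set of the `+1` entries of the row assigned to `x`. -/
def ghrRandomiser {ε : ℝ} (r : RowAssignment k ε) : Randomiser k (Message k ε) where
  kernel := Kernel.ofFunOfCountable fun x =>
    (responsePMF ε (plusSet (blockCount k ε) (logB k ε) (r.row x))).toMeasure
  isMarkov := ⟨fun _ => PMF.toMeasure.isProbabilityMeasure _⟩

/-- The distribution of the message on an input with law `p`. -/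
def inducedLaw {ε : ℝ} (r : RowAssignment k ε) (p : Measure (Fin k)) : Measure (Message k ε) :=
  p.bind (ghrRandomiser r).kernel

/-- The distance parameter of the analyser:
`γ² = (2 α² / (s k)) ((e^ε - 1) / (e^ε + K / s - 1))²`, with `K = a * b`. -/
def l2Radius (k : ℕ) (ε α : ℝ) : ℝ :=
  √(2 * α ^ 2 / (subsetSize k ε * k) *
    ((exp ε - 1) /
      (exp ε + (blockCount k ε * blockSize k ε : ℝ) / subsetSize k ε - 1)) ^ 2)

/-- The protocol in which all users apply the Generalised Hadamard Response randomiser, and the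
analyser applies the test `A` to the messages. -/
def ghrProtocol {ε : ℝ} (r : RowAssignment k ε) (A : RandomisedTest n (Message k ε)) :
    Protocol n k (Message k ε) where
  randomiser := fun _ => ghrRandomiser r
  analyser := A

/-! ### The information matrix of a randomiser -/

/-- The difference of the probabilities of the message `y` on the two inputs of the `i`-th pair
`{2i - 1, 2i}` (in the domain `{1, …, k}`; the domain `Fin k` starts at `0`). -/
def pairDiff (R : Randomiser k Y) (y : Y) (i : Fin (k / 2)) : ℝ :=
  (R.kernel ⟨2 * i.1 + 1, by omega⟩).real {y} - (R.kernel ⟨2 * i.1, by omega⟩).real {y}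

/-- The matrix `H(R)`, for a discrete message space. -/
def infoMatrix (R : Randomiser k Y) : Matrix (Fin (k / 2)) (Fin (k / 2)) ℝ :=
  fun i j => ∑' y, pairDiff R y i * pairDiff R y j / ∑ x, (R.kernel x).real {y}

end

end LDPTesting

/-!
# Locally private uniformity testing with private coins

*Lower bound.* Relative to the law of its output on uniform data, a locally private randomiser is
described by densities, and the advantage of a protocol against a mixture of perturbations of the
uniform distribution is bounded by the second moment of the likelihood ratio
(`chiSquare_lower_bound`). This moment is an expectation over two independent perturbations `W`,
`W'` of `∏ (1 + I (W, W'))`, one factor per user, where `I` is the information form of the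
randomiser. The perturbations move mass within the pairs `{2i - 1, 2i}`, with a random sign for
each pair. The privacy constraint bounds the trace of the information forms restricted to these
directions, but it does not bound their operator norms, so independent signs do not give the
optimal rate. The signs are therefore chosen with correlations: after removing the few pairs that
carry too much information, the remaining pairs correspond to vectors of bounded length
(`exists_gram_vectors`), and the Gram–Schmidt walk produces random signs whose signed sum of these
vectors is subgaussian with an absolute constant (`exists_subgaussian_signing`). The exponential
moment of the inner product of two independent copies of that sum is then computed by replacing
one copy by a Gaussian vector (`sum_sum_exp_inner_le`). Since the removal of pairs depends only on
the trace, this gives the bound when `k` is large in terms of `1 / 2 - α₀`; for the remaining `k`,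
the perturbation towards a point mass suffices.

The Gram–Schmidt walk moves a point of the cube `[-1, 1]^ι` along the direction in which the
signed sum changes by the component of the vector of a pivot orthogonal to the vectors of the
other free coordinates, until a coordinate reaches `±1`. The potential `walkPotential` is affine
along this direction, hence preserved in the mean, and it does not increase when a coordinate is
frozen: if the coordinate is not the pivot, a shift of the argument of a centred moment generating
function (`signMGF_add_le`) is paid for by a loss of the projection of the test vector
(`residual_cross_le`).

*Upper bound.* The rows of Sylvester's matrix are orthogonal, and the rows in use are balanced, so
the subsets attached to the inputs have an incidence matrix that is bounded below in `ℓ₂`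
(`RowAssignment.le_sum_sq_indicator`). A distribution at total variation distance more than `α`
from uniform thus induces a law of messages at `ℓ₂` distance more than `γ` from `q*`
(`l2Radius_lt_l2Dist`). The tester splits the messages into two halves and thresholds the inner
product of the two centred empirical distributions; its variance is controlled by the `ℓ₂` norm of
`q*` (`exists_isL2IdentityTester`), which is of order `1 / √k` since no message has probability
more than `3 / k` (`inducedLaw_unif_real_le`).

*Trace bound.* In every term of the trace, the sum over the pairs of the squared differences is at
most the largest of the probabilities of the message times their sum, and privacy bounds the
largest by `e^ε` times any other (`trace_infoMatrix_le`).
-/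

namespace LDPTesting

/-! ### Two-point moment generating functions -/

/-- `cosh t + x sinh t`, the moment generating function of the law on `{-1, 1}` with mean `x`. -/
noncomputable def signMGF (x t : ℝ) : ℝ := cosh t + x * sinh t

theorem signMGF_neg (x t : ℝ) : signMGF x (-t) = signMGF (-x) t := by
  simp [signMGF]

theorem signMGF_pos {x : ℝ} (hx : |x| ≤ 1) (t : ℝ) : 0 < signMGF x t := by
  rw [abs_le] at hx
  have h1 := cosh_add_sinh t
  have h2 := cosh_sub_sinh t
  have h3 := exp_pos t
  have h4 := exp_pos (-t)
  have : signMGF x t = (1 + x) / 2 * exp t + (1 - x) / 2 * exp (-t) := by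
    rw [← h1, ← h2, signMGF]; ring
  rw [this]
  rcases le_total 0 x with h | h
  · have : 0 < (1 + x) / 2 * exp t := by positivity
    have : 0 ≤ (1 - x) / 2 * exp (-t) := mul_nonneg (by linarith) h4.le
    linarith
  · have : 0 < (1 - x) / 2 * exp (-t) := mul_pos (by linarith) h4
    have : 0 ≤ (1 + x) / 2 * exp t := mul_nonneg (by linarith) h3.le
    linarith

theorem sinh_le_mul_cosh {t : ℝ} (ht : 0 ≤ t) : sinh t ≤ t * cosh t := by
  have hd : ∀ s : ℝ, HasDerivAt (fun s => s * cosh s - sinh s) (s * sinh s) s := fun s => by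
    have := ((hasDerivAt_id' s).fun_mul (hasDerivAt_cosh s)).fun_sub (hasDerivAt_sinh s)
    exact this.congr_deriv (by ring)
  have hm : MonotoneOn (fun s => s * cosh s - sinh s) (Set.Ici 0) := by
    apply monotoneOn_of_deriv_nonneg (convex_Ici 0)
    · exact fun s _ => (hd s).continuousAt.continuousWithinAt
    · exact fun s _ => (hd s).differentiableAt.differentiableWithinAt
    · intro s hs
      rw [interior_Ici, Set.mem_Ioi] at hs
      rw [(hd s).deriv]
      exact mul_nonneg hs.le (sinh_nonneg_iff.2 hs.le)
  have := hm Set.self_mem_Ici ht ht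
  simp at this
  linarith

/-- The tilted mean `(sinh t + x cosh t) / (cosh t + x sinh t)` exceeds the mean `x` by at most
`t`: the variance of a sign is at most `1` under every tilt. -/
theorem one_sub_sq_mul_sinh_le {x t : ℝ} (ht : 0 ≤ t) (hx : |x| ≤ 1) :
    (1 - x ^ 2) * sinh t ≤ t * signMGF x t := by
  have hs : sinh t = 2 * sinh (t / 2) * cosh (t / 2) := by
    rw [← sinh_two_mul]; congr 1; ring
  have hc : cosh t = cosh (t / 2) ^ 2 + sinh (t / 2) ^ 2 := by
    rw [← cosh_two_mul]; congr 1; ring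
  have h1 := sinh_le_mul_cosh (t := t / 2) (by linarith)
  have h2 := cosh_sq (t / 2)
  set s := sinh (t / 2)
  set c := cosh (t / 2)
  have hc0 : 0 < c := cosh_pos _
  have hx2 : 0 ≤ 1 - x ^ 2 := by nlinarith [abs_le.1 hx, sq_abs x, abs_nonneg x]
  calc (1 - x ^ 2) * sinh t = (1 - x ^ 2) * (2 * s * c) := by rw [hs]
    _ ≤ (1 - x ^ 2) * (2 * (t / 2 * c) * c) := by gcongr
    _ = t * ((1 - x ^ 2) * c ^ 2) := by ring
    _ ≤ t * signMGF x t := by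
      apply mul_le_mul_of_nonneg_left _ ht
      rw [signMGF, hs, hc]
      nlinarith [sq_nonneg (s + x * c)]

/-- Hoeffding's lemma for a sign. -/
theorem signMGF_le {x : ℝ} (hx : |x| ≤ 1) (t : ℝ) :
    signMGF x t ≤ exp (x * t + t ^ 2 / 2) := by
  wlog ht : 0 ≤ t generalizing x t
  · have := this (x := -x) (by rwa [abs_neg]) (-t) (by linarith)
    rw [signMGF_neg, neg_neg] at this
    simpa using this
  have hd : ∀ s : ℝ, HasDerivAt (fun s => signMGF x s * exp (-(x * s + s ^ 2 / 2)))
      (((1 - x ^ 2) * sinh s - s * signMGF x s) * exp (-(x * s + s ^ 2 / 2))) s := fun s => by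
    have h1 : HasDerivAt (fun s => signMGF x s) (sinh s + x * cosh s) s :=
      (hasDerivAt_cosh s).add ((hasDerivAt_sinh s).const_mul x)
    have h2 : HasDerivAt (fun s : ℝ => -(x * s + s ^ 2 / 2)) (-(x + s)) s := by
      have := (((hasDerivAt_id' s).const_mul x).fun_add
        (((hasDerivAt_id' s).fun_pow 2).div_const 2)).fun_neg
      exact this.congr_deriv (by ring)
    exact (h1.fun_mul h2.exp).congr_deriv (by simp only [signMGF]; ring)
  have hm : AntitoneOn (fun s => signMGF x s * exp (-(x * s + s ^ 2 / 2))) (Set.Ici 0) := by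
    apply antitoneOn_of_deriv_nonpos (convex_Ici 0)
    · exact fun s _ => (hd s).continuousAt.continuousWithinAt
    · exact fun s _ => (hd s).differentiableAt.differentiableWithinAt
    · intro s hs
      rw [interior_Ici, Set.mem_Ioi] at hs
      rw [(hd s).deriv]
      exact mul_nonpos_of_nonpos_of_nonneg
        (sub_nonpos.2 (one_sub_sq_mul_sinh_le hs.le hx)) (exp_pos _).le
  have h := hm Set.self_mem_Ici ht ht
  simp only [exp_neg] at h
  rw [← div_eq_mul_inv, div_le_iff₀ (exp_pos _)] at h
  simpa [signMGF] using h

/-- A change of the argument of the centred moment generating function, at the price of a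
cross term that is positive only if the change is opposed to the argument. -/
theorem signMGF_add_le {x : ℝ} (hx : |x| ≤ 1) (l m g : ℝ) (hg : 0 ≤ g) (hlm : -(l * m) ≤ g) :
    signMGF x (l + m) * exp (-(x * (l + m)) - (l + m) ^ 2 / 2) ≤
      signMGF x l * exp (-(x * l) - l ^ 2 / 2 + g) := by
  set y := (sinh l + x * cosh l) / signMGF x l with hy
  have hW := signMGF_pos hx l
  have hyW : y * signMGF x l = sinh l + x * cosh l := by rw [hy]; field_simp
  have hcs := cosh_sq l
  have hx2 : 0 ≤ 1 - x ^ 2 := by nlinarith [abs_le.1 hx, sq_abs x, abs_nonneg x]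
  have hsplit : signMGF x (l + m) = signMGF x l * signMGF y m := by
    have : signMGF x l * signMGF y m
        = signMGF x l * cosh m + (y * signMGF x l) * sinh m := by simp only [signMGF]; ring
    rw [this, hyW]
    simp only [signMGF, cosh_add, sinh_add]; ring
  have hy1 : |y| ≤ 1 := by
    rw [hy, abs_div, abs_of_pos hW, div_le_one hW]
    apply abs_le_of_sq_le_sq _ hW.le
    simp only [signMGF]
    nlinarith
  -- the increment `y - x` of the tilted mean lies between `0` and `l`
  have hyx : (y - x) * signMGF x l = (1 - x ^ 2) * sinh l := by
    rw [sub_mul, hyW]; simp only [signMGF]; ring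
  have hcross : (y - x - l) * m ≤ g := by
    rcases le_total 0 l with h | h
    · have h1 : 0 ≤ y - x := by
        have : 0 ≤ (y - x) * signMGF x l := by
          rw [hyx]; exact mul_nonneg hx2 (sinh_nonneg_iff.2 h)
        exact nonneg_of_mul_nonneg_left this hW
      have h2 : y - x ≤ l := by
        have := one_sub_sq_mul_sinh_le h hx
        rw [← hyx] at this
        exact le_of_mul_le_mul_right this hW
      rcases le_total 0 m with hm | hm <;> nlinarith
    · have h1 : y - x ≤ 0 := by
        have : (y - x) * signMGF x l ≤ 0 := by
          rw [hyx]; exact mul_nonpos_of_nonneg_of_nonpos hx2 (sinh_nonpos_iff.2 h)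
        exact nonpos_of_mul_nonpos_left this hW
      have h2 : l ≤ y - x := by
        have := one_sub_sq_mul_sinh_le (x := -x) (t := -l) (by linarith) (by rwa [abs_neg])
        rw [signMGF_neg, neg_neg, neg_sq, sinh_neg] at this
        have h3 : l * signMGF x l ≤ (y - x) * signMGF x l := by rw [hyx]; linarith
        exact le_of_mul_le_mul_right h3 hW
      rcases le_total 0 m with hm | hm <;> nlinarith
  rw [hsplit, mul_assoc]
  apply mul_le_mul_of_nonneg_left _ hW.le
  calc signMGF y m * exp (-(x * (l + m)) - (l + m) ^ 2 / 2)
      ≤ exp (y * m + m ^ 2 / 2) * exp (-(x * (l + m)) - (l + m) ^ 2 / 2) := by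
        gcongr; exact signMGF_le hy1 m
    _ = exp (-(x * l) - l ^ 2 / 2 + (y - x - l) * m) := by rw [← exp_add]; congr 1; ring
    _ ≤ _ := by gcongr

/-! ### Projections of a vector onto nested subspaces -/

section Projection

variable {E : Type*} [NormedAddCommGroup E] [InnerProductSpace ℝ E] [FiniteDimensional ℝ E]

open scoped RealInnerProductSpace

theorem inner_sq_le_of_mem_of_orthogonal {U' U : Submodule ℝ E} (h : U' ≤ U) {q : E} (hq : q ∈ U)
    (hq' : ∀ u ∈ U', ⟪q, u⟫ = 0) (v : E) :
    ⟪q, v⟫ ^ 2 ≤ ‖q‖ ^ 2 * (‖U.starProjection v‖ ^ 2 - ‖U'.starProjection v‖ ^ 2) := by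
  set p := U.starProjection v
  set p' := U'.starProjection v
  have hp : p ∈ U := U.starProjection_apply_mem v
  have hp' : p' ∈ U' := U'.starProjection_apply_mem v
  have h1 : ⟪q, v⟫ = ⟪q, p - p'⟫ := by
    have h2 : ⟪v - p, q⟫ = 0 := U.starProjection_inner_eq_zero v q hq
    rw [inner_sub_left, sub_eq_zero] at h2
    rw [inner_sub_right, hq' p' hp', sub_zero, real_inner_comm, h2, real_inner_comm]
  have h3 : ⟪p', p - p'⟫ = 0 := by
    have h4 : ⟪v - p, p'⟫ = 0 := U.starProjection_inner_eq_zero v p' (h hp')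
    have h5 : ⟪v - p', p'⟫ = 0 := U'.starProjection_inner_eq_zero v p' hp'
    have : p - p' = (v - p') - (v - p) := by abel
    rw [this, real_inner_comm, inner_sub_left, h4, h5, sub_zero]
  have h6 : ‖p‖ ^ 2 = ‖p'‖ ^ 2 + ‖p - p'‖ ^ 2 := by
    have := norm_add_sq_real p' (p - p')
    rw [h3] at this
    simpa using this
  rw [h1, h6, add_sub_cancel_left, ← mul_pow]
  exact sq_le_sq' (by linarith [neg_le_of_abs_le (abs_real_inner_le_norm q (p - p'))])
    (real_inner_le_norm _ _)

theorem norm_starProjection_mono {U' U : Submodule ℝ E} (h : U' ≤ U) (v : E) :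
    ‖U'.starProjection v‖ ^ 2 ≤ ‖U.starProjection v‖ ^ 2 := by
  have h1 := Submodule.starProjection_comp_starProjection_of_le h
  have h2 : U'.starProjection v = U'.starProjection (U.starProjection v) := by
    exact (DFunLike.congr_fun h1 v).symm
  rw [h2]
  gcongr
  exact U'.norm_starProjection_apply_le _

theorem norm_sub_starProjection_le (V : Submodule ℝ E) (b : E) :
    ‖b - V.starProjection b‖ ≤ ‖b‖ := by
  have h1 : ⟪b - V.starProjection b, V.starProjection b⟫ = 0 :=
    V.starProjection_inner_eq_zero b _ (V.starProjection_apply_mem b)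
  have h2 := norm_add_sq_real (b - V.starProjection b) (V.starProjection b)
  rw [h1, sub_add_cancel] at h2
  apply le_of_sq_le_sq _ (norm_nonneg b)
  nlinarith [sq_nonneg ‖V.starProjection b‖]

/-- Shrinking the subspace `V` to `V'` changes the residual of `b` from `r` to `r + s`; if the two
parts of the residual pull in opposite directions against `v`, then the projection of `v` loses
at least twice the cross term. The lost direction is `‖s‖² r - ‖r‖² s`. -/
theorem residual_cross_le {V' V : Submodule ℝ E} (h : V' ≤ V) {b : E} (hb : ‖b‖ ≤ 1) (v : E) :
    -(⟪b - V.starProjection b, v⟫ *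
        (⟪b - V'.starProjection b, v⟫ - ⟪b - V.starProjection b, v⟫)) ≤
      (‖(V ⊔ ℝ ∙ b).starProjection v‖ ^ 2 - ‖(V' ⊔ ℝ ∙ b).starProjection v‖ ^ 2) / 2 := by
  set r := b - V.starProjection b with hr
  set s := V.starProjection b - V'.starProjection b with hs
  have hrs : b - V'.starProjection b = r + s := by rw [hr, hs]; abel
  rw [hrs, inner_add_left, add_sub_cancel_left]
  have hle : V' ⊔ ℝ ∙ b ≤ V ⊔ ℝ ∙ b := sup_le_sup_right h _
  have hsV : s ∈ V := V.sub_mem (V.starProjection_apply_mem b) (h (V'.starProjection_apply_mem b))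
  have hrV : ∀ u ∈ V, ⟪r, u⟫ = 0 := fun u hu => V.starProjection_inner_eq_zero b u hu
  have hrs0 : ⟪r, s⟫ = 0 := hrV s hsV
  have hsV' : ∀ u ∈ V', ⟪s, u⟫ = 0 := fun u hu => by
    have h1 : ⟪r + s, u⟫ = 0 := by
      rw [← hrs]; exact V'.starProjection_inner_eq_zero b u hu
    rwa [inner_add_left, hrV u (h hu), zero_add] at h1
  have hgap := sub_nonneg.2 (norm_starProjection_mono hle v)
  rcases le_or_gt 0 (⟪r, v⟫ * ⟪s, v⟫) with h0 | h0
  · linarith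
  have hr0 : 0 < ‖r‖ := by
    rw [norm_pos_iff]; rintro h1; simp [h1] at h0
  have hs0 : 0 < ‖s‖ := by
    rw [norm_pos_iff]; rintro h1; simp [h1] at h0
  set q := ‖s‖ ^ 2 • r - ‖r‖ ^ 2 • s with hq
  have hbU : b ∈ V ⊔ ℝ ∙ b := Submodule.mem_sup_right (Submodule.mem_span_singleton_self b)
  have hqU : q ∈ V ⊔ ℝ ∙ b := by
    refine Submodule.sub_mem _ (Submodule.smul_mem _ _ (Submodule.sub_mem _ hbU ?_))
      (Submodule.smul_mem _ _ (Submodule.mem_sup_left hsV))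
    exact Submodule.mem_sup_left (V.starProjection_apply_mem b)
  have hrr : ⟪r, r⟫ = ‖r‖ ^ 2 := real_inner_self_eq_norm_sq r
  have hss : ⟪s, s⟫ = ‖s‖ ^ 2 := real_inner_self_eq_norm_sq s
  have hqV' : ∀ u ∈ V', ⟪q, u⟫ = 0 := fun u hu => by
    rw [hq, inner_sub_left, inner_smul_left, inner_smul_left, hrV u (h hu), hsV' u hu]; simp
  have hqb : ⟪q, b⟫ = 0 := by
    have h1 : b = (r + s) + V'.starProjection b := by rw [← hrs]; abel
    rw [h1, inner_add_right, hqV' _ (V'.starProjection_apply_mem b), hq, inner_sub_left,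
      inner_smul_left, inner_smul_left, inner_add_right, inner_add_right, hrr, hss, hrs0,
      real_inner_comm, hrs0]
    simp; ring
  have hqU' : ∀ u ∈ V' ⊔ ℝ ∙ b, ⟪q, u⟫ = 0 := fun u hu => by
    obtain ⟨y, hy, z, hz, rfl⟩ := Submodule.mem_sup.1 hu
    obtain ⟨c, rfl⟩ := Submodule.mem_span_singleton.1 hz
    rw [inner_add_right, hqV' y hy, inner_smul_right, hqb]; simp
  have hkey := inner_sq_le_of_mem_of_orthogonal hle hqU hqU' v
  have hqv : ⟪q, v⟫ = ‖s‖ ^ 2 * ⟪r, v⟫ - ‖r‖ ^ 2 * ⟪s, v⟫ := by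
    rw [hq, inner_sub_left, inner_smul_left, inner_smul_left]; simp
  have hsum : ‖r‖ ^ 2 + ‖s‖ ^ 2 ≤ 1 := by
    have h1 := norm_sub_starProjection_le V' b
    rw [hrs] at h1
    have h2 := norm_add_sq_real r s
    rw [hrs0] at h2
    have h3 : ‖r + s‖ ^ 2 ≤ 1 := by
      have : ‖r + s‖ ≤ 1 := h1.trans hb
      exact pow_le_one₀ (norm_nonneg _) this
    linarith
  have hqn : ‖q‖ ^ 2 ≤ ‖r‖ ^ 2 * ‖s‖ ^ 2 := by
    have h1 : ‖q‖ ^ 2 = ‖s‖ ^ 2 * ‖r‖ ^ 2 * (‖r‖ ^ 2 + ‖s‖ ^ 2) := by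
      rw [hq, norm_sub_sq_real, norm_smul, norm_smul, inner_smul_left, inner_smul_right, hrs0]
      simp; ring
    rw [h1]
    have : 0 ≤ ‖s‖ ^ 2 * ‖r‖ ^ 2 := by positivity
    nlinarith
  set gap := ‖(V ⊔ ℝ ∙ b).starProjection v‖ ^ 2 - ‖(V' ⊔ ℝ ∙ b).starProjection v‖ ^ 2
  have hfin : (‖r‖ ^ 2 * ‖s‖ ^ 2) * (4 * -(⟪r, v⟫ * ⟪s, v⟫)) ≤ (‖r‖ ^ 2 * ‖s‖ ^ 2) * gap := by
    have h1 : ‖q‖ ^ 2 * gap ≤ (‖r‖ ^ 2 * ‖s‖ ^ 2) * gap := by gcongr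
    rw [hqv] at hkey
    nlinarith [sq_nonneg (‖s‖ ^ 2 * ⟪r, v⟫ + ‖r‖ ^ 2 * ⟪s, v⟫)]
  have := le_of_mul_le_mul_left hfin (by positivity)
  linarith

end Projection

/-! ### The Gram–Schmidt walk -/

section Walk

variable {E : Type*} [NormedAddCommGroup E] [InnerProductSpace ℝ E] {ι : Type*}

open scoped RealInnerProductSpace

theorem span_image_erase_sup [DecidableEq ι] {b : ι → E} {A : Finset ι} {p : ι} (hp : p ∈ A) :
    Submodule.span ℝ (b '' (A.erase p)) ⊔ ℝ ∙ b p = Submodule.span ℝ (b '' A) := by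
  rw [← Submodule.span_union, ← Set.image_singleton, ← Set.image_union]
  congr 2
  ext i
  by_cases h : i = p <;> simp [h, hp]

/-- From an interior point of the cube, a line leaves the cube in both directions. -/
theorem exists_exit_times {x u : ι → ℝ} {S : Finset ι} {p : ι} (hu : u p = 1)
    (hS : ∀ i ∉ S, u i = 0) (hx1 : ∀ i, |x i| ≤ 1) (hx : ∀ i ∈ S, |x i| < 1) :
    ∃ d : ℝ, 0 < d ∧ (∀ i, |(x + d • u) i| ≤ 1) ∧ ∃ i ∈ S, |(x + d • u) i| = 1 := by
  set D : Set ℝ := {d | ∀ i, |(x + d • u) i| ≤ 1} with hD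
  have hcont : ∀ i, Continuous fun d : ℝ => |(x + d • u) i| := fun i => by
    simp only [Pi.add_apply, Pi.smul_apply, smul_eq_mul]; fun_prop
  have hcl : IsClosed D := by
    rw [hD, Set.ofPred_forall]
    exact isClosed_iInter fun i => isClosed_le (hcont i) continuous_const
  have hbd : D ⊆ Set.Icc (-2) 2 := fun d hd => by
    have h1 := hd p
    have h2 := hx1 p
    simp only [Pi.add_apply, Pi.smul_apply, smul_eq_mul, hu, mul_one] at h1
    rw [abs_le] at h1 h2
    constructor <;> linarith
  have hcomp : IsCompact D := isCompact_Icc.of_isClosed_subset hcl hbd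
  have h0 : (0 : ℝ) ∈ D := fun i => by simpa using hx1 i
  have hmax : ∀ d ∈ D, 0 ≤ d → (∀ i ∈ S, |(x + d • u) i| < 1) → ∃ e ∈ D, d < e := by
    intro d hd hd0 hlt
    have hev : ∀ᶠ e in nhds d, ∀ i ∈ S, |(x + e • u) i| < 1 := by
      rw [Filter.eventually_all_finset]
      exact fun i hi => (hcont i).continuousAt.eventually_lt continuousAt_const (hlt i hi)
    obtain ⟨e, he, hde⟩ := ((hev.filter_mono nhdsWithin_le_nhds).and
      (self_mem_nhdsWithin : Set.Ioi d ∈ nhdsWithin d (Set.Ioi d))).exists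
    refine ⟨e, fun i => ?_, hde⟩
    by_cases hi : i ∈ S
    · exact (he i hi).le
    · simpa [hS i hi] using hx1 i
  obtain ⟨d, hd, hdmax⟩ := hcomp.exists_isGreatest ⟨0, h0⟩
  have hd0 : 0 ≤ d := hdmax h0
  have hpos : 0 < d := by
    obtain ⟨e, he, he0⟩ := hmax 0 h0 le_rfl (fun i hi => by simpa using hx i hi)
    exact he0.trans_le (hdmax he)
  refine ⟨d, hpos, hd, ?_⟩
  by_contra! hne
  obtain ⟨e, he, hde⟩ := hmax d hd hd0 fun i hi => lt_of_le_of_ne (hd i) (hne i hi)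
  exact absurd (hdmax he) (not_le.2 hde)

variable [Fintype ι]

section Potential

variable [FiniteDimensional ℝ E]

/-- The inner product with `v` of the residual of the pivot vector `b p` modulo the span of the
alive vectors. -/
noncomputable def residualInner (b : ι → E) (A : Finset ι) (p : ι) (v : E) : ℝ :=
  ⟪b p - (Submodule.span ℝ (b '' A)).starProjection (b p), v⟫

/-- The potential of the Gram–Schmidt walk at the fractional point `x` with pivot `p` and further
alive coordinates `A`: the bound on the moment generating function at `v` of the final sum. -/
noncomputable def walkPotential (b : ι → E) (A : Finset ι) (p : ι) (x : ι → ℝ) (v : E) : ℝ :=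
  exp (⟪v, ∑ i, x i • b i⟫ +
      ‖(Submodule.span ℝ (b '' A) ⊔ ℝ ∙ b p).starProjection v‖ ^ 2 / 2) *
    (signMGF (x p) (residualInner b A p v) *
      exp (-(x p * residualInner b A p v) - residualInner b A p v ^ 2 / 2))

theorem walkPotential_le (b : ι → E) (A : Finset ι) (p : ι) {x : ι → ℝ} (hx : |x p| ≤ 1) (v : E) :
    walkPotential b A p x v ≤ exp (⟪v, ∑ i, x i • b i⟫ +
      ‖(Submodule.span ℝ (b '' A) ⊔ ℝ ∙ b p).starProjection v‖ ^ 2 / 2) := by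
  unfold walkPotential
  apply mul_le_of_le_one_right (exp_pos _).le
  set l := residualInner b A p v
  calc signMGF (x p) l * exp (-(x p * l) - l ^ 2 / 2)
      ≤ exp (x p * l + l ^ 2 / 2) * exp (-(x p * l) - l ^ 2 / 2) := by
        gcongr; exact signMGF_le hx l
    _ = 1 := by rw [← exp_add]; simp

/-- Once the pivot is frozen, the potential pays for the span of the other alive vectors. -/
theorem le_walkPotential_of_frozen_pivot {b : ι → E} (hb : ∀ i, ‖b i‖ ≤ 1) (A : Finset ι) (p : ι)
    {x : ι → ℝ} (hx : |x p| = 1) (v : E) :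
    exp (⟪v, ∑ i, x i • b i⟫ + ‖(Submodule.span ℝ (b '' A)).starProjection v‖ ^ 2 / 2) ≤
      walkPotential b A p x v := by
  unfold walkPotential
  set V := Submodule.span ℝ (b '' A)
  set l := residualInner b A p v with hl
  have h1 : signMGF (x p) l * exp (-(x p * l) - l ^ 2 / 2) = exp (-l ^ 2 / 2) := by
    rw [signMGF]
    rcases (abs_eq zero_le_one).1 hx with h | h
    · rw [h, one_mul, one_mul, cosh_add_sinh, ← exp_add]; congr 1; ring
    · rw [h, neg_one_mul, neg_one_mul, ← sub_eq_add_neg, cosh_sub_sinh, ← exp_add]; congr 1; ring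
  rw [h1, ← exp_add]
  apply exp_le_exp.2
  have hle : V ≤ V ⊔ ℝ ∙ b p := le_sup_left
  have hmem : b p - V.starProjection (b p) ∈ V ⊔ ℝ ∙ b p :=
    Submodule.sub_mem _ (Submodule.mem_sup_right (Submodule.mem_span_singleton_self _))
      (hle (V.starProjection_apply_mem _))
  have hk := inner_sq_le_of_mem_of_orthogonal hle hmem
    (fun u hu => V.starProjection_inner_eq_zero (b p) u hu) v
  have hr : ‖b p - V.starProjection (b p)‖ ^ 2 ≤ 1 :=
    pow_le_one₀ (norm_nonneg _) ((norm_sub_starProjection_le V _).trans (hb p))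
  have hg := sub_nonneg.2 (norm_starProjection_mono hle v)
  have : l ^ 2 ≤ ‖(V ⊔ ℝ ∙ b p).starProjection v‖ ^ 2 - ‖V.starProjection v‖ ^ 2 := by
    calc l ^ 2 ≤ _ := hk
      _ ≤ _ := mul_le_of_le_one_left hg hr
  linarith

/-- Freezing a coordinate other than the pivot does not increase the potential. -/
theorem walkPotential_erase_le [DecidableEq ι] {b : ι → E} (hb : ∀ i, ‖b i‖ ≤ 1)
    (A : Finset ι) (p i : ι) {x : ι → ℝ} (hx : |x p| ≤ 1) (v : E) :
    walkPotential b (A.erase i) p x v ≤ walkPotential b A p x v := by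
  have hle : Submodule.span ℝ (b '' (A.erase i)) ≤ Submodule.span ℝ (b '' A) := by
    apply Submodule.span_mono
    apply Set.image_mono
    exact_mod_cast A.erase_subset i
  have hcross := residual_cross_le hle (hb p) v
  have hgap := sub_nonneg.2 (norm_starProjection_mono
    (sup_le_sup_right hle (ℝ ∙ b p)) v)
  have hkey := signMGF_add_le hx (residualInner b A p v)
    (residualInner b (A.erase i) p v - residualInner b A p v) _
    (by linarith : (0 : ℝ) ≤ (‖(Submodule.span ℝ (b '' A) ⊔ ℝ ∙ b p).starProjection v‖ ^ 2 -
      ‖(Submodule.span ℝ (b '' (A.erase i)) ⊔ ℝ ∙ b p).starProjection v‖ ^ 2) / 2) hcross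
  rw [add_sub_cancel] at hkey
  unfold walkPotential
  refine (mul_le_mul_of_nonneg_left hkey (exp_pos _).le).trans (le_of_eq ?_)
  rw [mul_left_comm, mul_left_comm (exp _) (signMGF _ _), ← exp_add, ← exp_add]
  congr 2
  ring

/-- Along the direction `u`, which moves the sum by the residual of the pivot vector, the potential
is an affine function: the walk is a martingale in the potential. -/
theorem walkPotential_add_smul {b : ι → E} {A : Finset ι} {p : ι} {u : ι → ℝ} (hu : u p = 1)
    (hr : ∑ i, u i • b i = b p - (Submodule.span ℝ (b '' A)).starProjection (b p)) (x : ι → ℝ)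
    (d : ℝ) (v : E) :
    walkPotential b A p (x + d • u) v = walkPotential b A p x v + d * (exp (⟪v, ∑ i, x i • b i⟫ +
      ‖(Submodule.span ℝ (b '' A) ⊔ ℝ ∙ b p).starProjection v‖ ^ 2 / 2) *
      (sinh (residualInner b A p v) *
        exp (-(x p * residualInner b A p v) - residualInner b A p v ^ 2 / 2))) := by
  have h1 : ⟪v, ∑ i, (x + d • u) i • b i⟫ = ⟪v, ∑ i, x i • b i⟫ + d * residualInner b A p v := by
    simp only [Pi.add_apply, Pi.smul_apply, add_smul, Finset.sum_add_distrib, smul_assoc,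
      ← Finset.smul_sum, hr, inner_add_right, inner_smul_right, residualInner]
    rw [real_inner_comm v]
  unfold walkPotential
  rw [h1]
  set l := residualInner b A p v
  have h2 : (x + d • u) p = x p + d := by simp [hu]
  rw [h2]
  set a := ⟪v, ∑ i, x i • b i⟫
  set g := ‖(Submodule.span ℝ (b '' A) ⊔ ℝ ∙ b p).starProjection v‖ ^ 2 / 2
  have h3 : exp (a + d * l + g) * (signMGF (x p + d) l * exp (-((x p + d) * l) - l ^ 2 / 2)) =
      signMGF (x p + d) l * (exp (a + g) * exp (-(x p * l) - l ^ 2 / 2)) := by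
    rw [mul_left_comm, ← exp_add, ← exp_add]; congr 2; ring
  rw [h3]
  simp only [signMGF]; ring

end Potential

/-- The sign encoded by a Boolean. -/
def boolSign (c : Bool) : ℝ := if c then 1 else -1

variable [DecidableEq ι]

/-- There is a law `μ` on sign vectors `σ` for which the moment generating function of
`∑ i, σ i • b i` is at most `Φ`. -/
def HasSignLaw (b : ι → E) (Φ : E → ℝ) : Prop :=
  ∃ μ : (ι → Bool) → ℝ, (∀ σ, 0 ≤ μ σ) ∧ ∑ σ, μ σ = 1 ∧
    ∀ v, ∑ σ, μ σ * exp ⟪v, ∑ i, boolSign (σ i) • b i⟫ ≤ Φ v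

theorem HasSignLaw.mono {b : ι → E} {Φ Ψ : E → ℝ} (h : HasSignLaw b Φ) (hle : ∀ v, Φ v ≤ Ψ v) :
    HasSignLaw b Ψ := by
  obtain ⟨μ, h1, h2, h3⟩ := h
  exact ⟨μ, h1, h2, fun v => (h3 v).trans (hle v)⟩

theorem HasSignLaw.mix {b : ι → E} {Φ Ψ : E → ℝ} (h : HasSignLaw b Φ) (h' : HasSignLaw b Ψ)
    {p q : ℝ} (hp : 0 ≤ p) (hq : 0 ≤ q) (hpq : p + q = 1) :
    HasSignLaw b fun v => p * Φ v + q * Ψ v := by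
  obtain ⟨μ, h1, h2, h3⟩ := h
  obtain ⟨μ', h1', h2', h3'⟩ := h'
  refine ⟨fun σ => p * μ σ + q * μ' σ, fun σ => ?_, ?_, fun v => ?_⟩
  · have := h1 σ; have := h1' σ; positivity
  · rw [Finset.sum_add_distrib, ← Finset.mul_sum, ← Finset.mul_sum, h2, h2', mul_one, mul_one, hpq]
  · have : ∀ σ, (p * μ σ + q * μ' σ) * exp ⟪v, ∑ i, boolSign (σ i) • b i⟫ =
        p * (μ σ * exp ⟪v, ∑ i, boolSign (σ i) • b i⟫) +
          q * (μ' σ * exp ⟪v, ∑ i, boolSign (σ i) • b i⟫) := fun σ => by ring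
    simp_rw [this, Finset.sum_add_distrib, ← Finset.mul_sum]
    gcongr
    · exact h3 v
    · exact h3' v

theorem hasSignLaw_of_forall_abs_eq_one (b : ι → E) {x : ι → ℝ} (hx : ∀ i, |x i| = 1) :
    HasSignLaw b fun v => exp ⟪v, ∑ i, x i • b i⟫ := by
  have hs : ∀ i, boolSign (decide (x i = 1)) = x i := fun i => by
    rcases (abs_eq zero_le_one).1 (hx i) with h | h
    · simp [boolSign, h]
    · norm_num [boolSign, h]
  refine ⟨Pi.single (fun i => decide (x i = 1)) 1, fun σ => ?_, ?_, fun v => ?_⟩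
  · by_cases h : σ = fun i => decide (x i = 1)
    · subst h; simp
    · simp [Pi.single_eq_of_ne h]
  · simp
  · rw [Finset.sum_eq_single fun i => decide (x i = 1)]
    · simp [hs]
    · intro σ _ h; simp [Pi.single_eq_of_ne h]
    · simp

/-- The walk started at the fractional point `x`, with pivot `p` and further alive
coordinates `A`, ends at a random sign vector controlled by the potential. -/
theorem hasSignLaw_walkPotential [FiniteDimensional ℝ E] {b : ι → E} (hb : ∀ i, ‖b i‖ ≤ 1)
    (A : Finset ι) (p : ι) (hp : p ∉ A) (x : ι → ℝ) (hx : ∀ i, |x i| ≤ 1)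
    (hfr : ∀ i ∉ A, i ≠ p → |x i| = 1) :
    HasSignLaw b (walkPotential b A p x) := by
  induction hN : A.card using Nat.strong_induction_on generalizing A p x with
  | _ N ih =>
  -- a point at which some alive coordinate is frozen is a walk with fewer alive coordinates
  have hbdry : ∀ y : ι → ℝ, (∀ i, |y i| ≤ 1) → (∀ i ∉ A, i ≠ p → |y i| = 1) →
      (∃ i ∈ insert p A, |y i| = 1) → HasSignLaw b (walkPotential b A p y) := by
    rintro y hy hfy ⟨i, hi, hi1⟩
    rcases Finset.mem_insert.1 hi with rfl | hiA
    · rcases A.eq_empty_or_nonempty with rfl | ⟨q, hq⟩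
      · refine (hasSignLaw_of_forall_abs_eq_one b (x := y) fun j => ?_).mono fun v =>
          le_trans ?_ (le_walkPotential_of_frozen_pivot hb ∅ i hi1 v)
        · by_cases h : j = i
          · rw [h, hi1]
          · exact hfy j (by simp) h
        · apply exp_le_exp.2
          have : 0 ≤ ‖(Submodule.span ℝ (b '' ((∅ : Finset ι) : Set ι))).starProjection v‖ ^ 2 :=
            by positivity
          linarith
      · refine (ih (A.erase q).card (by rw [← hN]; exact Finset.card_erase_lt_of_mem hq) (A.erase q)
          q (by simp) y hy (fun j hj hjq => ?_) rfl).mono fun v =>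
            le_trans ((walkPotential_le b (A.erase q) q (hy q) v).trans (le_of_eq ?_))
              (le_walkPotential_of_frozen_pivot hb A i hi1 v)
        · by_cases h : j = i
          · rw [h, hi1]
          · exact hfy j (fun hjA => hj (Finset.mem_erase.2 ⟨hjq, hjA⟩)) h
        · simp only [span_image_erase_sup hq]
    · refine (ih (A.erase i).card (by rw [← hN]; exact Finset.card_erase_lt_of_mem hiA) (A.erase i)
          p (fun h => hp (Finset.mem_of_mem_erase h)) y hy (fun j hj hjp => ?_) rfl).mono fun v =>
            walkPotential_erase_le hb A p i (hy p) v
      by_cases h : j = i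
      · rw [h, hi1]
      · exact hfy j (fun hjA => hj (Finset.mem_erase.2 ⟨h, hjA⟩)) hjp
  by_cases hint : ∃ i ∈ insert p A, |x i| = 1
  · exact hbdry x hx hfr hint
  push Not at hint
  have hlt : ∀ i ∈ insert p A, |x i| < 1 := fun i hi => lt_of_le_of_ne (hx i) (hint i hi)
  obtain ⟨u, hup, huS, hur⟩ : ∃ u : ι → ℝ, u p = 1 ∧ (∀ i ∉ insert p A, u i = 0) ∧
      ∑ i, u i • b i = b p - (Submodule.span ℝ (b '' A)).starProjection (b p) := by
    obtain ⟨c', hc'⟩ := (Submodule.mem_span_image_finset_iff_exists_fun ℝ).1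
      ((Submodule.span ℝ (b '' A)).starProjection_apply_mem (b p))
    obtain ⟨c, hc⟩ : ∃ c : ι → ℝ, ∑ i ∈ A, c i • b i =
        (Submodule.span ℝ (b '' A)).starProjection (b p) := by
      refine ⟨fun i => if h : i ∈ A then c' ⟨i, h⟩ else 0, ?_⟩
      rw [← hc', ← Finset.sum_coe_sort]
      simp
    refine ⟨fun i => if i = p then 1 else if i ∈ A then -c i else 0, by simp, fun i hi => ?_, ?_⟩
    · rw [Finset.mem_insert, not_or] at hi
      simp [hi.1, hi.2]
    · have h1 : ∀ i, (if i = p then (1 : ℝ) else if i ∈ A then -c i else 0) • b i =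
          (if i = p then b i else 0) - (if i ∈ A then c i • b i else 0) := fun i => by
        by_cases h : i = p
        · simp [h, hp]
        · by_cases h' : i ∈ A <;> simp [h, h']
      simp_rw [h1, Finset.sum_sub_distrib]
      rw [← hc]
      simp
  have hadd : ∀ d : ℝ, (∀ i, |(x + d • u) i| ≤ 1) → (∃ i ∈ insert p A, |(x + d • u) i| = 1) →
      HasSignLaw b (walkPotential b A p (x + d • u)) := fun d h1 h2 =>
    hbdry _ h1 (fun i hi hip => by
      have : i ∉ insert p A := by simp [hi, hip]
      simpa [huS i this] using hfr i hi hip) h2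
  obtain ⟨d, hd, hd1, hd2⟩ := exists_exit_times hup huS hx hlt
  obtain ⟨e, he, he1, he2⟩ : ∃ e : ℝ, 0 < e ∧ (∀ i, |(x + (-e) • u) i| ≤ 1) ∧
      ∃ i ∈ insert p A, |(x + (-e) • u) i| = 1 := by
    -- the backward exit time is the forward exit time of the reflected line
    obtain ⟨e, he, he1, he2⟩ := exists_exit_times (x := -x) (u := u)
      hup huS (fun i => by simpa using hx i)
      (fun i hi => by simpa using hlt i hi)
    have habs : ∀ i, |(x + (-e) • u) i| = |(-x + e • u) i| := fun i => by
      rw [← abs_neg]; congr 1; simp [add_comm]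
    exact ⟨e, he, fun i => by rw [habs]; exact he1 i, by simpa only [habs] using he2⟩
  refine ((hadd d hd1 hd2).mix (hadd (-e) he1 he2) (p := e / (d + e)) (q := d / (d + e))
    (by positivity) (by positivity) (by field_simp; ring)).mono fun v => le_of_eq ?_
  rw [walkPotential_add_smul hup hur, walkPotential_add_smul hup hur]
  field_simp
  ring

/-- Vectors of norm at most `1` can be signed at random such that the signed sum is
`1`-subgaussian in every direction. -/
theorem exists_subgaussian_signing [FiniteDimensional ℝ E] {b : ι → E} (hb : ∀ i, ‖b i‖ ≤ 1) :
    HasSignLaw b fun v => exp (‖v‖ ^ 2 / 2) := by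
  rcases isEmpty_or_nonempty ι with h | ⟨⟨p⟩⟩
  · refine (hasSignLaw_of_forall_abs_eq_one b (x := 0) fun i => isEmptyElim i).mono fun v => ?_
    apply exp_le_exp.2
    simp only [Finset.univ_eq_empty, Finset.sum_empty, inner_zero_right]
    positivity
  · refine (hasSignLaw_walkPotential hb (Finset.univ.erase p) p (by simp) 0 (by simp)
      (by simp +contextual)).mono fun v => (walkPotential_le b _ p (by simp) v).trans ?_
    apply exp_le_exp.2
    have := Submodule.norm_starProjection_apply_le
      (Submodule.span ℝ (b '' (Finset.univ.erase p : Finset ι)) ⊔ ℝ ∙ b p) v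
    simp only [Pi.zero_apply, zero_smul, Finset.sum_const_zero, inner_zero_right, zero_add]
    gcongr

end Walk

/-! ### Decoupling by Gaussian linearisation -/

section Gaussian

open scoped RealInnerProductSpace

theorem integral_exp_mul_gaussianReal (a : ℝ) :
    ∫ g, exp (a * g) ∂gaussianReal 0 1 = exp (a ^ 2 / 2) := by
  have := mgf_gaussianReal (p := gaussianReal 0 1) (X := id) (μ := 0) (v := 1)
    (by simp) a
  simpa [mgf] using this

theorem integrable_exp_half_mul_sq_gaussianReal {t : ℝ} (ht : t < 1) :
    Integrable (fun g => exp (t * g ^ 2 / 2)) (gaussianReal 0 1) ∧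
      ∫ g, exp (t * g ^ 2 / 2) ∂gaussianReal 0 1 = (√(1 - t))⁻¹ := by
  have hpdf : ∀ g : ℝ, gaussianPDFReal 0 1 g * exp (t * g ^ 2 / 2) =
      (√(2 * π))⁻¹ * exp (-((1 - t) / 2) * g ^ 2) := fun g => by
    rw [gaussianPDFReal_def]
    simp only [NNReal.coe_one, mul_one, sub_zero]
    rw [mul_assoc, ← exp_add]; congr 2; ring
  constructor
  · rw [gaussianReal_of_var_ne_zero 0 one_ne_zero, gaussianPDF_def,
      integrable_withDensity_iff_integrable_smul' (by fun_prop) (by simp)]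
    have : Integrable (fun g : ℝ => (√(2 * π))⁻¹ * exp (-((1 - t) / 2) * g ^ 2)) :=
      (integrable_exp_neg_mul_sq (by linarith)).const_mul _
    refine this.congr (Filter.Eventually.of_forall fun g => ?_)
    simp only [smul_eq_mul, ENNReal.toReal_ofReal (gaussianPDFReal_nonneg 0 1 g)]
    exact (hpdf g).symm
  · rw [integral_gaussianReal_eq_integral_smul one_ne_zero]
    simp only [smul_eq_mul, hpdf]
    rw [integral_const_mul, integral_gaussian, ← sqrt_inv, ← sqrt_inv, ← sqrt_mul (by positivity)]
    congr 1
    have : 1 - t ≠ 0 := by linarith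
    field_simp

/-- If a finitely supported random vector `y` is `1`-subgaussian in every direction, then the
inner product of two independent copies has small exponential moments: the first copy is
integrated out by subgaussianity, and the resulting square of the norm of the second one is
linearised by a Gaussian vector. -/
theorem sum_sum_exp_inner_le {S κ : Type*} [Fintype S] [Fintype κ] (μ : S → ℝ)
    (hμ : ∀ s, 0 ≤ μ s) (y : S → EuclideanSpace ℝ κ)
    (hy : ∀ v, ∑ s, μ s * exp ⟪v, y s⟫ ≤ exp (‖v‖ ^ 2 / 2)) {τ : ℝ} (hτ : τ ^ 2 < 1) :
    ∑ s, ∑ s', μ s * μ s' * exp (τ * ⟪y s, y s'⟫) ≤ (√(1 - τ ^ 2))⁻¹ ^ Fintype.card κ := by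
  set γ : Measure (κ → ℝ) := Measure.pi fun _ => gaussianReal 0 1
  have hlin : ∀ s', Integrable (fun g : κ → ℝ => ∏ j, exp (τ * y s' j * g j)) γ ∧
      ∫ g, ∏ j, exp (τ * y s' j * g j) ∂γ = exp (τ ^ 2 * ‖y s'‖ ^ 2 / 2) := fun s' => by
    constructor
    · exact Integrable.fintype_prod (f := fun j t => exp (τ * y s' j * t))
        fun j => integrable_exp_mul_gaussianReal _
    · rw [integral_fintype_prod_eq_prod (fun j t => exp (τ * y s' j * t))]
      simp only [integral_exp_mul_gaussianReal, ← exp_sum]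
      rw [EuclideanSpace.real_norm_sq_eq, Finset.mul_sum, Finset.sum_div]
      simp only [mul_pow]
  have hsq : Integrable (fun g : κ → ℝ => ∏ j, exp (τ ^ 2 * g j ^ 2 / 2)) γ ∧
      ∫ g, ∏ j, exp (τ ^ 2 * g j ^ 2 / 2) ∂γ = (√(1 - τ ^ 2))⁻¹ ^ Fintype.card κ := by
    constructor
    · exact Integrable.fintype_prod (f := fun _ t => exp (τ ^ 2 * t ^ 2 / 2))
        fun j => (integrable_exp_half_mul_sq_gaussianReal hτ).1
    · rw [integral_fintype_prod_eq_prod (fun _ t => exp (τ ^ 2 * t ^ 2 / 2))]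
      simp [(integrable_exp_half_mul_sq_gaussianReal hτ).2]
  calc ∑ s, ∑ s', μ s * μ s' * exp (τ * ⟪y s, y s'⟫)
      = ∑ s', μ s' * ∑ s, μ s * exp ⟪τ • y s', y s⟫ := by
        rw [Finset.sum_comm]
        refine Finset.sum_congr rfl fun s' _ => ?_
        rw [Finset.mul_sum]
        refine Finset.sum_congr rfl fun s _ => ?_
        rw [real_inner_smul_left, real_inner_comm]; ring
    _ ≤ ∑ s', μ s' * exp (τ ^ 2 * ‖y s'‖ ^ 2 / 2) := by
        refine Finset.sum_le_sum fun s' _ => mul_le_mul_of_nonneg_left ?_ (hμ s')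
        refine (hy _).trans (le_of_eq ?_)
        rw [norm_smul, mul_pow, norm_eq_abs, sq_abs]
    _ = ∫ g, ∑ s', μ s' * ∏ j, exp (τ * y s' j * g j) ∂γ := by
        rw [integral_finsetSum _ fun s' _ => (hlin s').1.const_mul _]
        simp only [integral_const_mul, (hlin _).2]
    _ ≤ ∫ g, ∏ j, exp (τ ^ 2 * g j ^ 2 / 2) ∂γ := by
        refine integral_mono (integrable_finsetSum _ fun s' _ => (hlin s').1.const_mul _) hsq.1
          fun g => ?_
        have h1 := hy (τ • WithLp.toLp 2 g)
        have h2 : ∀ s', ⟪τ • (WithLp.toLp 2 g : EuclideanSpace ℝ κ), y s'⟫ =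
            ∑ j, τ * y s' j * g j := fun s' => by
          rw [real_inner_smul_left, PiLp.inner_apply, Finset.mul_sum]
          refine Finset.sum_congr rfl fun j _ => ?_
          simp; ring
        have h3 : ‖τ • (WithLp.toLp 2 g : EuclideanSpace ℝ κ)‖ ^ 2 / 2 =
            ∑ j, τ ^ 2 * g j ^ 2 / 2 := by
          rw [norm_smul, mul_pow, EuclideanSpace.real_norm_sq_eq, norm_eq_abs, sq_abs,
            Finset.mul_sum, Finset.sum_div]
        simp only [h2, h3, exp_sum] at h1
        exact h1
    _ = _ := hsq.2

end Gaussian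

/-! ### Product measures and the output of a protocol -/

section Product

variable {ι : Type*} [Fintype ι] {Y : Type*} [MeasurableSpace Y]

theorem lintegral_pi_prod (μ : ι → Measure Y) [∀ i, IsProbabilityMeasure (μ i)]
    {f : ι → Y → ENNReal} (hf : ∀ i, Measurable (f i)) :
    ∫⁻ y, ∏ i, f i (y i) ∂Measure.pi μ = ∏ i, ∫⁻ y, f i y ∂μ i := by
  rw [lintegral_prod_eq_prod_lintegral_of_indepFun Finset.univ (fun i (y : ι → Y) => f i (y i))
    (iIndepFun_pi fun i => (hf i).aemeasurable) fun i => (hf i).comp (measurable_pi_apply i)]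
  exact Finset.prod_congr rfl fun i _ =>
    (measurePreserving_eval μ i).lintegral_comp (hf i)

theorem pi_withDensity (μ : ι → Measure Y) [∀ i, IsProbabilityMeasure (μ i)]
    {f : ι → Y → ENNReal} (hf : ∀ i, Measurable (f i))
    [∀ i, IsProbabilityMeasure ((μ i).withDensity (f i))] :
    Measure.pi (fun i => (μ i).withDensity (f i)) =
      (Measure.pi μ).withDensity fun y => ∏ i, f i (y i) := by
  refine Measure.pi_eq fun s hs => ?_
  rw [withDensity_apply _ (MeasurableSet.univ_pi hs),
    ← lintegral_indicator (MeasurableSet.univ_pi hs)]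
  have h1 : ∀ y : ι → Y, (Set.univ.pi s).indicator (fun y => ∏ i, f i (y i)) y =
      ∏ i, (s i).indicator (f i) (y i) := fun y => by
    by_cases h : y ∈ Set.univ.pi s
    · rw [Set.indicator_of_mem h]
      exact Finset.prod_congr rfl fun i _ => (Set.indicator_of_mem (h i trivial) _).symm
    · rw [Set.indicator_of_notMem h]
      simp only [Set.mem_pi, Set.mem_univ, true_imp_iff, not_forall] at h
      obtain ⟨i, hi⟩ := h
      exact (Finset.prod_eq_zero (Finset.mem_univ i) (Set.indicator_of_notMem hi _)).symm
  simp_rw [h1]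
  rw [lintegral_pi_prod μ fun i => (hf i).indicator (hs i)]
  refine Finset.prod_congr rfl fun i _ => ?_
  rw [lintegral_indicator (hs i), withDensity_apply _ (hs i)]

end Product

section Protocols

variable {n k : ℕ} {Y : Type u} [MeasurableSpace Y]

instance (R : Randomiser k Y) : IsMarkovKernel R.kernel := R.isMarkov

instance (A : RandomisedTest n Y) : IsMarkovKernel A.kernel := A.isMarkov

theorem Measure.bind_fin_apply (p : Measure (Fin k)) (κ : Kernel (Fin k) Y) {S : Set Y}
    (hS : MeasurableSet S) : p.bind κ S = ∑ x, κ x S * p {x} := by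
  rw [Measure.bind_apply hS κ.measurable.aemeasurable, lintegral_fintype]

/-- Independent data sent through independent randomisers give independent messages. -/
theorem pi_bind_pi (p : Measure (Fin k)) [IsProbabilityMeasure p] (κ : Fin n → Kernel (Fin k) Y)
    [∀ i, IsMarkovKernel (κ i)] :
    (Measure.pi fun _ : Fin n => p).bind (fun x => Measure.pi fun i => κ i (x i)) =
      Measure.pi fun i => p.bind (κ i) := by
  symm
  refine Measure.pi_eq fun s hs => ?_
  rw [Measure.bind_apply (MeasurableSet.univ_pi hs) (Measurable.of_discrete.aemeasurable)]
  simp only [Measure.pi_pi]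
  rw [lintegral_pi_prod (fun _ : Fin n => p) (f := fun i x => κ i x (s i))
    fun i => Measurable.of_discrete]
  exact Finset.prod_congr rfl fun i _ =>
    (Measure.bind_apply (hs i) (κ i).measurable.aemeasurable).symm

theorem Protocol.outputIID_eq (P : Protocol n k Y) (p : Measure (Fin k)) [IsProbabilityMeasure p] :
    P.outputIID p =
      (Measure.pi fun i => p.bind (P.randomiser i).kernel).bind P.analyser.kernel := by
  rw [← pi_bind_pi p fun i => (P.randomiser i).kernel, Measure.bind_bind
    Measurable.of_discrete.aemeasurable P.analyser.kernel.measurable.aemeasurable]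
  rfl

/-- The probability that a test accepts, as a function of the messages. -/
noncomputable def RandomisedTest.acceptProb (A : RandomisedTest n Y) (y : Fin n → Y) : ℝ :=
  (A.kernel y).real {true}

theorem RandomisedTest.acceptProb_nonneg (A : RandomisedTest n Y) (y : Fin n → Y) :
    0 ≤ A.acceptProb y := measureReal_nonneg

theorem RandomisedTest.acceptProb_le_one (A : RandomisedTest n Y) (y : Fin n → Y) :
    A.acceptProb y ≤ 1 := measureReal_le_one

theorem RandomisedTest.measurable_acceptProb (A : RandomisedTest n Y) :
    Measurable A.acceptProb :=
  (A.kernel.measurable_coe (measurableSet_singleton true)).ennreal_toReal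

theorem RandomisedTest.bind_real_true (A : RandomisedTest n Y) (m : Measure (Fin n → Y)) :
    (m.bind A.kernel).real {true} = ∫ y, A.acceptProb y ∂m := by
  rw [Measure.real, Measure.bind_apply (measurableSet_singleton true)
    A.kernel.measurable.aemeasurable]
  exact (integral_toReal (A.kernel.measurable_coe (measurableSet_singleton true)).aemeasurable
    (Filter.Eventually.of_forall fun y => measure_lt_top _ _)).symm

theorem real_false_eq (m : Measure Bool) [IsProbabilityMeasure m] :
    m.real {false} = 1 - m.real {true} := by
  rw [← probReal_compl_eq_one_sub (measurableSet_singleton true)]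
  congr 1
  ext b; cases b <;> simp

/-! ### Densities of a locally private randomiser -/

instance (k : ℕ) [NeZero k] : IsProbabilityMeasure (unif k) :=
  isProbabilityMeasure_uniformOn Set.finite_univ ⟨0, trivial⟩

theorem unif_singleton (k : ℕ) (x : Fin k) : unif k {x} = (k : ENNReal)⁻¹ := by
  rw [unif, uniformOn_univ]
  simp

/-- Densities of a locally private randomiser with respect to `k` times the law of its output on
uniform data, normalised so that they sum to `1` and satisfy the privacy constraint everywhere. -/
theorem Randomiser.exists_density [NeZero k] (R : Randomiser k Y) {ε : ℝ} (hε : 0 ≤ ε)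
    (hR : R.IsPrivate ε) :
    ∃ f : Fin k → Y → ℝ, (∀ x, Measurable (f x)) ∧ (∀ x y, 0 ≤ f x y) ∧
      (∀ y, ∑ x, f x y = 1) ∧ (∀ x x' y, f x y ≤ exp ε * f x' y) ∧
      ∀ x, R.kernel x = ((unif k).bind R.kernel).withDensity
        fun y => ENNReal.ofReal (k * f x y) := by
  have hk0 : (k : ENNReal) ≠ 0 := by exact_mod_cast NeZero.ne k
  have hkt : (k : ENNReal) ≠ ⊤ := ENNReal.natCast_ne_top k
  have hkR : (0 : ℝ) < k := by exact_mod_cast NeZero.pos k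
  set q := (unif k).bind R.kernel with hq
  have hsum : ∀ S, MeasurableSet S → ∑ x, R.kernel x S = k * q S := fun S hS => by
    rw [hq, Measure.bind_fin_apply _ _ hS]
    simp only [unif_singleton]
    rw [← Finset.sum_mul, mul_comm, mul_assoc, ENNReal.inv_mul_cancel hk0 hkt, mul_one]
  have hac : ∀ x, R.kernel x ≪ q := fun x =>
    Measure.AbsolutelyContinuous.mk fun S hS h0 => by
      have h1 := hsum S hS
      rw [h0, mul_zero, Finset.sum_eq_zero_iff] at h1
      exact h1 x (Finset.mem_univ x)
  set g : Fin k → Y → ENNReal := fun x => (R.kernel x).rnDeriv q with hg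
  have hgm : ∀ x, Measurable (g x) := fun x => Measure.measurable_rnDeriv _ _
  have hgd : ∀ x, q.withDensity (g x) = R.kernel x := fun x =>
    Measure.withDensity_rnDeriv_eq _ _ (hac x)
  have hgd' : ∀ x S, MeasurableSet S → ∫⁻ y in S, g x y ∂q = R.kernel x S := fun x S hS => by
    rw [← withDensity_apply _ hS, hgd]
  have h1 : ∀ᵐ y ∂q, ∑ x, g x y = k := by
    refine ae_eq_of_forall_setLIntegral_eq_of_sigmaFinite
      (Finset.measurable_fun_sum _ fun x _ => hgm x) measurable_const fun S hS _ => ?_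
    rw [lintegral_finsetSum _ fun x _ => hgm x]
    simp only [hgd' _ S hS, hsum S hS, lintegral_const, Measure.restrict_apply_univ]
  have h2 : ∀ᵐ y ∂q, ∀ x x', g x y ≤ ENNReal.ofReal (exp ε) * g x' y := by
    rw [ae_all_iff]; intro x
    rw [ae_all_iff]; intro x'
    refine ae_le_of_forall_setLIntegral_le_of_sigmaFinite (hgm x) fun S hS _ => ?_
    rw [lintegral_const_mul _ (hgm x'), hgd' x S hS, hgd' x' S hS]
    exact hR x x' S hS
  set N : Set Y := {y | ∑ x, g x y = k ∧ ∀ x x', g x y ≤ ENNReal.ofReal (exp ε) * g x' y} with hN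
  have hNm : MeasurableSet N := by
    refine MeasurableSet.inter ?_ ?_
    · exact measurableSet_eq_fun (Finset.measurable_fun_sum _ fun x _ => hgm x) measurable_const
    · have : {y | ∀ x x', g x y ≤ ENNReal.ofReal (exp ε) * g x' y} =
          ⋂ x, ⋂ x', {y | g x y ≤ ENNReal.ofReal (exp ε) * g x' y} := by ext; simp
      change MeasurableSet {y | ∀ x x', g x y ≤ ENNReal.ofReal (exp ε) * g x' y}
      rw [this]
      exact MeasurableSet.iInter fun x => MeasurableSet.iInter fun x' =>
        measurableSet_le (hgm x) ((hgm x').const_mul _)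
  have hNae : ∀ᵐ y ∂q, y ∈ N := by filter_upwards [h1, h2] with y a b using ⟨a, b⟩
  have hfin : ∀ y ∈ N, ∀ x, g x y ≠ ⊤ := fun y hy x => by
    have h3 : g x y ≤ k := by
      rw [← hy.1]; exact Finset.single_le_sum (f := fun x => g x y) (by simp) (Finset.mem_univ x)
    exact ne_top_of_le_ne_top hkt h3
  classical
  refine ⟨fun x y => if y ∈ N then (g x y).toReal / k else 1 / k, fun x => ?_, fun x y => ?_,
    fun y => ?_, fun x x' y => ?_, fun x => ?_⟩
  · exact Measurable.ite hNm ((hgm x).ennreal_toReal.div_const _) measurable_const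
  · dsimp only; split_ifs <;> positivity
  · dsimp only
    split_ifs with h
    · rw [← Finset.sum_div, ← ENNReal.toReal_sum fun x _ => hfin y h x, h.1]
      simp [hkR.ne']
    · simp [hkR.ne']
  · dsimp only
    split_ifs with h
    · rw [← mul_div_assoc]
      gcongr
      have := ENNReal.toReal_mono (ENNReal.mul_ne_top ENNReal.ofReal_ne_top (hfin y h x'))
        (h.2 x x')
      rwa [ENNReal.toReal_mul, ENNReal.toReal_ofReal (exp_pos ε).le] at this
    · exact le_mul_of_one_le_left (by positivity) (one_le_exp hε)
  · conv_lhs => rw [← hgd x]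
    refine withDensity_congr_ae ?_
    filter_upwards [hNae] with y hy
    rw [if_pos hy, mul_div_cancel₀ _ hkR.ne', ENNReal.ofReal_toReal (hfin y hy x)]

/-! ### The chi-square bound for mixtures -/

/-- The perturbation of the uniform law with probabilities `(1 + W x) / k`. -/
noncomputable def perturbed (W : Fin k → ℝ) : Measure (Fin k) :=
  Measure.sum fun x => ENNReal.ofReal ((1 + W x) / k) • Measure.dirac x

theorem perturbed_singleton (W : Fin k → ℝ) (x : Fin k) :
    perturbed W {x} = ENNReal.ofReal ((1 + W x) / k) := by
  rw [perturbed, Measure.sum_apply _ (measurableSet_singleton x), tsum_fintype,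
    Finset.sum_eq_single x]
  · simp
  · intro y _ hy
    simp [hy]
  · simp

theorem isProbabilityMeasure_perturbed [NeZero k] {W : Fin k → ℝ} (h0 : ∑ x, W x = 0)
    (h1 : ∀ x, -1 ≤ W x) : IsProbabilityMeasure (perturbed W) := by
  have hkR : (0 : ℝ) < k := by exact_mod_cast NeZero.pos k
  constructor
  rw [perturbed, Measure.sum_apply _ MeasurableSet.univ, tsum_fintype]
  simp only [Measure.smul_apply, measure_univ, smul_eq_mul, mul_one]
  rw [← ENNReal.ofReal_sum_of_nonneg fun x _ => div_nonneg (by linarith [h1 x]) hkR.le,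
    ← Finset.sum_div, Finset.sum_add_distrib, h0]
  simp [hkR.ne']

theorem tv_perturbed [NeZero k] {W : Fin k → ℝ} (h1 : ∀ x, -1 ≤ W x) :
    tv (perturbed W) (unif k) = (∑ x, |W x|) / (2 * k) := by
  have hkR : (0 : ℝ) < k := by exact_mod_cast NeZero.pos k
  have h2 : ∀ x, |(perturbed W).real {x} - (unif k).real {x}| = |W x| / k := fun x => by
    rw [Measure.real, Measure.real, perturbed_singleton, unif_singleton,
      ENNReal.toReal_ofReal (div_nonneg (by linarith [h1 x]) hkR.le)]
    rw [ENNReal.toReal_inv, ENNReal.toReal_natCast, ← one_div, ← sub_div, add_sub_cancel_left,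
      abs_div, abs_of_pos hkR]
  simp only [tv, h2]
  rw [← Finset.sum_div]
  field_simp

/-- Normalised densities of a randomiser with respect to the law of its output on uniform data. -/
structure IsDensity [NeZero k] (R : Randomiser k Y) (f : Fin k → Y → ℝ) : Prop where
  measurable : ∀ x, Measurable (f x)
  nonneg : ∀ x y, 0 ≤ f x y
  sum_eq_one : ∀ y, ∑ x, f x y = 1
  kernel_eq : ∀ x, R.kernel x = ((unif k).bind R.kernel).withDensity
    fun y => ENNReal.ofReal (k * f x y)

namespace IsDensity

variable [NeZero k] {R : Randomiser k Y} {f : Fin k → Y → ℝ}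

theorem le_one (hf : IsDensity R f) (x : Fin k) (y : Y) : f x y ≤ 1 := by
  rw [← hf.sum_eq_one y]
  exact Finset.single_le_sum (f := fun x => f x y) (fun x _ => hf.nonneg x y) (Finset.mem_univ x)

theorem measurable_sum (hf : IsDensity R f) (W : Fin k → ℝ) :
    Measurable fun y => ∑ x, W x * f x y :=
  Finset.measurable_fun_sum _ fun x _ => (hf.measurable x).const_mul _

theorem abs_sum_le (hf : IsDensity R f) (W : Fin k → ℝ) (y : Y) :
    |∑ x, W x * f x y| ≤ ∑ x, |W x| := by
  refine (Finset.abs_sum_le_sum_abs _ _).trans (Finset.sum_le_sum fun x _ => ?_)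
  rw [abs_mul, abs_of_nonneg (hf.nonneg x y)]
  exact mul_le_of_le_one_right (abs_nonneg _) (hf.le_one x y)

theorem integrable_sum (hf : IsDensity R f) (W : Fin k → ℝ) :
    Integrable (fun y => ∑ x, W x * f x y) ((unif k).bind R.kernel) :=
  Integrable.of_bound (hf.measurable_sum W).aestronglyMeasurable _
    (Filter.Eventually.of_forall fun y => hf.abs_sum_le W y)

theorem integrable_sum_mul_sum (hf : IsDensity R f) (W W' : Fin k → ℝ) :
    Integrable (fun y => (∑ x, W x * f x y) * ∑ x, W' x * f x y) ((unif k).bind R.kernel) := by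
  refine Integrable.of_bound
    ((hf.measurable_sum W).mul (hf.measurable_sum W')).aestronglyMeasurable
    ((∑ x, |W x|) * ∑ x, |W' x|) (Filter.Eventually.of_forall fun y => ?_)
  rw [norm_mul]
  exact mul_le_mul (hf.abs_sum_le W y) (hf.abs_sum_le W' y) (norm_nonneg _)
    (Finset.sum_nonneg fun x _ => abs_nonneg _)

theorem integral_eq (hf : IsDensity R f) (x : Fin k) :
    ∫ y, f x y ∂(unif k).bind R.kernel = 1 / k := by
  have hkR : (0 : ℝ) < k := by exact_mod_cast NeZero.pos k
  have h1 : R.kernel x Set.univ = 1 := measure_univ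
  rw [hf.kernel_eq x, withDensity_apply _ MeasurableSet.univ, Measure.restrict_univ] at h1
  have h2 : ∫ y, k * f x y ∂(unif k).bind R.kernel = 1 := by
    rw [integral_eq_lintegral_of_nonneg_ae
      (Filter.Eventually.of_forall fun y => mul_nonneg hkR.le (hf.nonneg x y))
      ((hf.measurable x).const_mul _).aestronglyMeasurable, h1, ENNReal.toReal_one]
  rw [integral_const_mul] at h2
  field_simp
  linarith

theorem integral_sum_eq_zero (hf : IsDensity R f) {W : Fin k → ℝ} (h0 : ∑ x, W x = 0) :
    ∫ y, ∑ x, W x * f x y ∂(unif k).bind R.kernel = 0 := by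
  have hint : ∀ x, Integrable (f x) ((unif k).bind R.kernel) := fun x =>
    Integrable.of_bound (hf.measurable x).aestronglyMeasurable 1
      (Filter.Eventually.of_forall fun y => by
        rw [norm_eq_abs, abs_of_nonneg (hf.nonneg x y)]; exact hf.le_one x y)
  rw [integral_finsetSum _ fun x _ => (hint x).const_mul _]
  simp only [integral_const_mul, hf.integral_eq, ← Finset.sum_mul, h0, zero_mul]

theorem sum_one_add (hf : IsDensity R f) (W : Fin k → ℝ) (y : Y) :
    ∑ x, (1 + W x) * f x y = 1 + ∑ x, W x * f x y := by
  simp only [add_mul, one_mul, Finset.sum_add_distrib, hf.sum_eq_one]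

theorem perturbed_bind (hf : IsDensity R f) {W : Fin k → ℝ} (h1 : ∀ x, -1 ≤ W x) :
    (perturbed W).bind R.kernel = ((unif k).bind R.kernel).withDensity
      fun y => ENNReal.ofReal (1 + ∑ x, W x * f x y) := by
  have hkR : (0 : ℝ) < k := by exact_mod_cast NeZero.pos k
  have hW : ∀ x, 0 ≤ 1 + W x := fun x => by linarith [h1 x]
  ext S hS
  rw [Measure.bind_fin_apply _ _ hS, withDensity_apply _ hS]
  have h2 : ∀ y, ENNReal.ofReal (1 + ∑ x, W x * f x y) =
      ∑ x, ENNReal.ofReal (k * f x y) * ENNReal.ofReal ((1 + W x) / k) := fun y => by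
    rw [← hf.sum_one_add, ENNReal.ofReal_sum_of_nonneg fun x _ => mul_nonneg (hW x) (hf.nonneg x y)]
    refine Finset.sum_congr rfl fun x _ => ?_
    rw [← ENNReal.ofReal_mul (mul_nonneg hkR.le (hf.nonneg x y))]
    congr 1; field_simp
  simp only [h2]
  have hm : ∀ x, Measurable fun y => ENNReal.ofReal (k * f x y) := fun x =>
    ((hf.measurable x).const_mul _).ennreal_ofReal
  rw [lintegral_finsetSum _ fun x _ => (hm x).mul_const _]
  refine Finset.sum_congr rfl fun x _ => ?_
  rw [perturbed_singleton, lintegral_mul_const _ (hm x)]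
  conv_lhs => rw [hf.kernel_eq x, withDensity_apply _ hS]

end IsDensity

/-- If a protocol distinguishes the uniform law from every perturbation in a finite family, then
the chi-square divergence of each mixture of the family from the uniform law, which is computed
from pairs of perturbations, is bounded below. -/
theorem chiSquare_lower_bound [NeZero k] {P : Protocol n k Y} {α : ℝ}
    (hP : P.SolvesUniformityTesting α) {f : Fin n → Fin k → Y → ℝ}
    (hf : ∀ i, IsDensity (P.randomiser i) (f i)) {S : Type*} [Fintype S] {μ : S → ℝ}
    (hμ : ∀ s, 0 ≤ μ s) (hμ1 : ∑ s, μ s = 1) {W : S → Fin k → ℝ} (hW0 : ∀ s, ∑ x, W s x = 0)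
    (hW1 : ∀ s x, -1 ≤ W s x) (hWα : ∀ s, 2 * k * α < ∑ x, |W s x|) :
    10 / 9 ≤ ∑ s, ∑ s', μ s * μ s' * ∏ i, (1 + ∫ y, (∑ x, W s x * f i x y) *
      (∑ x, W s' x * f i x y) ∂(unif k).bind (P.randomiser i).kernel) := by
  have hkR : (0 : ℝ) < k := by exact_mod_cast NeZero.pos k
  set q : Fin n → Measure Y := fun i => (unif k).bind (P.randomiser i).kernel with hq
  set Q := Measure.pi q with hQ
  set L : S → Fin n → Y → ℝ := fun s i y => 1 + ∑ x, W s x * f i x y with hL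
  have hL0 : ∀ s i y, 0 ≤ L s i y := fun s i y => by
    rw [hL]; dsimp only; rw [← (hf i).sum_one_add]
    exact Finset.sum_nonneg fun x _ => mul_nonneg (by linarith [hW1 s x]) ((hf i).nonneg x y)
  have hLm : ∀ s i, Measurable (L s i) := fun s i => ((hf i).measurable_sum (W s)).const_add 1
  have hLi : ∀ s i, Integrable (L s i) (q i) := fun s i =>
    (integrable_const 1).add ((hf i).integrable_sum (W s))
  have hLL : ∀ s s' i, Integrable (fun y => L s i y * L s' i y) (q i) ∧
      ∫ y, L s i y * L s' i y ∂q i =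
        1 + ∫ y, (∑ x, W s x * f i x y) * (∑ x, W s' x * f i x y) ∂q i := fun s s' i => by
    have h1 : ∀ y, L s i y * L s' i y = (L s i y + ∑ x, W s' x * f i x y) +
        (∑ x, W s x * f i x y) * (∑ x, W s' x * f i x y) := fun y => by simp only [hL]; ring
    simp only [h1]
    have h2 : Integrable (fun y => L s i y + ∑ x, W s' x * f i x y) (q i) :=
      (hLi s i).add ((hf i).integrable_sum (W s'))
    have h3 := (hf i).integrable_sum_mul_sum (W s) (W s')
    refine ⟨h2.add h3, ?_⟩
    rw [integral_add h2 h3, integral_add (hLi s i) ((hf i).integrable_sum (W s')),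
      (hf i).integral_sum_eq_zero (hW0 s'), integral_add (integrable_const 1)
      ((hf i).integrable_sum (W s)), (hf i).integral_sum_eq_zero (hW0 s)]
    simp
  set Λ : S → (Fin n → Y) → ℝ := fun s y => ∏ i, L s i (y i) with hΛ
  have hΛi : ∀ s, Integrable (Λ s) Q := fun s => Integrable.fintype_prod_dep fun i => hLi s i
  have hΛ1 : ∀ s, ∫ y, Λ s y ∂Q = 1 := fun s => by
    rw [hΛ, hQ]; dsimp only
    rw [integral_fintype_prod_eq_prod]
    refine Finset.prod_eq_one fun i _ => ?_
    rw [integral_add (integrable_const 1) ((hf i).integrable_sum (W s)),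
      (hf i).integral_sum_eq_zero (hW0 s)]
    simp
  have hΛΛ : ∀ s s', Integrable (fun y => Λ s y * Λ s' y) Q ∧ ∫ y, Λ s y * Λ s' y ∂Q =
      ∏ i, (1 + ∫ y, (∑ x, W s x * f i x y) * (∑ x, W s' x * f i x y) ∂q i) := fun s s' => by
    simp only [hΛ, ← Finset.prod_mul_distrib]
    refine ⟨Integrable.fintype_prod_dep (f := fun i t => L s i t * L s' i t)
      fun i => (hLL s s' i).1, ?_⟩
    rw [hQ, integral_fintype_prod_eq_prod (fun i t => L s i t * L s' i t)]
    exact Finset.prod_congr rfl fun i _ => (hLL s s' i).2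
  set a := P.analyser.acceptProb with ha
  have ham : Measurable a := P.analyser.measurable_acceptProb
  have ha0 : ∀ y, 0 ≤ a y := P.analyser.acceptProb_nonneg
  have ha1 : ∀ y, a y ≤ 1 := P.analyser.acceptProb_le_one
  have haΛ : ∀ s, Integrable (fun y => a y * Λ s y) Q := fun s =>
    (hΛi s).bdd_mul ham.aestronglyMeasurable (c := 1)
      (Filter.Eventually.of_forall fun y => by
        rw [norm_eq_abs, abs_of_nonneg (ha0 y)]; exact ha1 y)
  have hai : Integrable a Q := Integrable.of_bound ham.aestronglyMeasurable 1
    (Filter.Eventually.of_forall fun y => by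
      rw [norm_eq_abs, abs_of_nonneg (ha0 y)]; exact ha1 y)
  -- the tester accepts uniform data, and rejects perturbed data
  have hacc : 2 / 3 ≤ ∫ y, a y ∂Q := by
    have := hP.1
    rwa [P.outputIID_eq, P.analyser.bind_real_true] at this
  have hrej : ∀ s, ∫ y, a y * Λ s y ∂Q ≤ 1 / 3 := fun s => by
    have := isProbabilityMeasure_perturbed (hW0 s) (hW1 s)
    have h1 := hP.2 (perturbed (W s)) inferInstance (by
      rw [tv_perturbed (hW1 s), lt_div_iff₀ (by positivity)]
      linarith [hWα s])
    rw [P.outputIID_eq] at h1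
    rw [real_false_eq, P.analyser.bind_real_true] at h1
    have h2 : ∀ i, (perturbed (W s)).bind (P.randomiser i).kernel =
        (q i).withDensity fun y => ENNReal.ofReal (L s i y) := fun i =>
      (hf i).perturbed_bind (hW1 s)
    have : ∀ i, IsProbabilityMeasure ((q i).withDensity fun y => ENNReal.ofReal (L s i y)) :=
      fun i => by rw [← h2]; infer_instance
    simp only [h2] at h1
    rw [pi_withDensity q fun i => (hLm s i).ennreal_ofReal,
      integral_withDensity_eq_integral_toReal_smul] at h1
    · have h3 : ∀ y : Fin n → Y, (∏ i, ENNReal.ofReal (L s i (y i))).toReal • a y =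
          a y * Λ s y := fun y => by
        rw [ENNReal.toReal_prod, smul_eq_mul, mul_comm, hΛ]
        congr 1
        exact Finset.prod_congr rfl fun i _ => ENNReal.toReal_ofReal (hL0 s i (y i))
      have h4 := integral_congr_ae (μ := Q) (Filter.Eventually.of_forall h3)
      linarith [h1.trans_eq (congrArg (1 - ·) h4)]
    · exact Finset.measurable_fun_prod _ fun i _ =>
        ((hLm s i).comp (measurable_pi_apply i)).ennreal_ofReal
    · exact Filter.Eventually.of_forall fun y => ENNReal.prod_lt_top fun i _ =>
        ENNReal.ofReal_lt_top
  -- Cauchy–Schwarz in the form `0 ≤ (M - 1 + (4/3) (a - 1/2))²`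
  set M : (Fin n → Y) → ℝ := fun y => ∑ s, μ s * Λ s y with hM
  have hMi : Integrable M Q := integrable_finsetSum _ fun s _ => (hΛi s).const_mul _
  have hM1 : ∫ y, M y ∂Q = 1 := by
    rw [hM, integral_finsetSum _ fun s _ => (hΛi s).const_mul _]
    simp only [integral_const_mul, hΛ1, mul_one, hμ1]
  have haM : Integrable (fun y => a y * M y) Q ∧ ∫ y, a y * M y ∂Q ≤ 1 / 3 := by
    have h1 : ∀ y, a y * M y = ∑ s, μ s * (a y * Λ s y) := fun y => by
      rw [hM, Finset.mul_sum]; exact Finset.sum_congr rfl fun s _ => by ring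
    simp only [h1]
    refine ⟨integrable_finsetSum _ fun s _ => (haΛ s).const_mul _, ?_⟩
    rw [integral_finsetSum _ fun s _ => (haΛ s).const_mul _]
    simp only [integral_const_mul]
    calc ∑ s, μ s * ∫ y, a y * Λ s y ∂Q ≤ ∑ s, μ s * (1 / 3) :=
          Finset.sum_le_sum fun s _ => mul_le_mul_of_nonneg_left (hrej s) (hμ s)
      _ = 1 / 3 := by rw [← Finset.sum_mul, hμ1, one_mul]
  have hMM : Integrable (fun y => M y ^ 2) Q ∧ ∫ y, M y ^ 2 ∂Q = ∑ s, ∑ s', μ s * μ s' *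
      ∏ i, (1 + ∫ y, (∑ x, W s x * f i x y) * (∑ x, W s' x * f i x y) ∂q i) := by
    have h1 : ∀ y, M y ^ 2 = ∑ s, ∑ s', μ s * μ s' * (Λ s y * Λ s' y) := fun y => by
      rw [sq, hM, Finset.sum_mul_sum]
      exact Finset.sum_congr rfl fun s _ => Finset.sum_congr rfl fun s' _ => by ring
    simp only [h1]
    have h2 : ∀ s s', Integrable (fun y => μ s * μ s' * (Λ s y * Λ s' y)) Q := fun s s' =>
      (hΛΛ s s').1.const_mul _
    refine ⟨integrable_finsetSum _ fun s _ => integrable_finsetSum _ fun s' _ => h2 s s', ?_⟩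
    rw [integral_finsetSum _ fun s _ => integrable_finsetSum _ fun s' _ => h2 s s']
    refine Finset.sum_congr rfl fun s _ => ?_
    rw [integral_finsetSum _ fun s' _ => h2 s s']
    simp only [integral_const_mul, (hΛΛ s _).2]
  rw [← hMM.2]
  have hpt : ∀ y, 0 ≤ M y ^ 2 - 10 / 3 * M y + 8 / 3 * (a y * M y) - 8 / 3 * a y +
      (1 + 4 / 3 + 4 / 9) := fun y => by
    nlinarith [sq_nonneg (M y - 1 + 4 / 3 * (a y - 1 / 2)),
      mul_nonneg (ha0 y) (sub_nonneg.2 (ha1 y))]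
  have hint := integral_nonneg (μ := Q) (f := fun y => M y ^ 2 - 10 / 3 * M y +
    8 / 3 * (a y * M y) - 8 / 3 * a y + (1 + 4 / 3 + 4 / 9)) hpt
  have i1 : Integrable (fun y => M y ^ 2 - 10 / 3 * M y) Q := hMM.1.sub (hMi.const_mul _)
  have i2 : Integrable (fun y => M y ^ 2 - 10 / 3 * M y + 8 / 3 * (a y * M y)) Q :=
    i1.add (haM.1.const_mul _)
  have i3 : Integrable (fun y => M y ^ 2 - 10 / 3 * M y + 8 / 3 * (a y * M y) - 8 / 3 * a y) Q :=
    i2.sub (hai.const_mul _)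
  rw [integral_add i3 (integrable_const _), integral_sub i2 (hai.const_mul _),
    integral_add i1 (haM.1.const_mul _), integral_sub hMM.1 (hMi.const_mul _)] at hint
  simp only [integral_const_mul, hM1, integral_const, probReal_univ, one_smul] at hint
  linarith [haM.2]

/-! ### Information of a locally private randomiser -/

/-- The element `2i` (for `false`) or `2i + 1` (for `true`) of the domain. -/
def pairIndex (p : Fin (k / 2) × Bool) : Fin k :=
  ⟨2 * p.1.1 + if p.2 then 1 else 0, by have := p.1.2; split_ifs <;> omega⟩

theorem pairIndex_injective : Function.Injective (pairIndex (k := k)) := by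
  rintro ⟨i, c⟩ ⟨j, d⟩ h
  simp only [pairIndex, Fin.mk.injEq] at h
  cases c <;> cases d <;> simp at h ⊢ <;> omega

theorem sum_pairIndex_le {g : Fin k → ℝ} (hg : ∀ x, 0 ≤ g x) :
    ∑ i, (g (pairIndex (i, true)) + g (pairIndex (i, false))) ≤ ∑ x, g x := by
  have h1 : ∑ i, (g (pairIndex (i, true)) + g (pairIndex (i, false))) =
      ∑ p : Fin (k / 2) × Bool, g (pairIndex p) := by
    rw [Fintype.sum_prod_type]; simp
  rw [h1]
  refine (Finset.sum_map Finset.univ ⟨pairIndex, pairIndex_injective⟩ g).symm.trans_le ?_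
  exact Finset.sum_le_sum_of_subset_of_nonneg (Finset.subset_univ _) fun x _ _ => hg x

/-- The privacy factor `min ((e^ε - 1)², e^ε, k)`, up to which a private message is informative. -/
noncomputable def privacyFactor (k : ℕ) (ε : ℝ) : ℝ := min ((exp ε - 1) ^ 2) (min (exp ε) k)

theorem privacyFactor_pos [NeZero k] {ε : ℝ} (hε : 0 < ε) : 0 < privacyFactor k ε := by
  have h1 : 0 < exp ε - 1 := by linarith [one_lt_exp_iff.2 hε]
  have h2 : (0 : ℝ) < k := by exact_mod_cast NeZero.pos k
  exact lt_min (by positivity) (lt_min (exp_pos ε) h2)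

theorem rate_le [NeZero k] {ε α : ℝ} (hε : 0 < ε) (hα : 0 < α) :
    rate k ε α ≤ 3 * (k : ℝ) ^ (3 / 2 : ℝ) / (α ^ 2 * privacyFactor k ε) := by
  have hk : (0 : ℝ) < k := by exact_mod_cast NeZero.pos k
  have hT := privacyFactor_pos (k := k) hε
  have h1 : 0 < exp ε - 1 := by linarith [one_lt_exp_iff.2 hε]
  have h2 : √(k : ℝ) / α ^ 2 = (k : ℝ) ^ (3 / 2 : ℝ) / (α ^ 2 * k) := by
    have : (k : ℝ) ^ (3 / 2 : ℝ) = √k * k := by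
      rw [sqrt_eq_rpow, ← rpow_add_one hk.ne']; norm_num
    rw [this]; field_simp
  have h3 : ∀ t, privacyFactor k ε ≤ t → (k : ℝ) ^ (3 / 2 : ℝ) / (α ^ 2 * t) ≤
      (k : ℝ) ^ (3 / 2 : ℝ) / (α ^ 2 * privacyFactor k ε) := fun t ht => by gcongr
  have a1 := h3 ((exp ε - 1) ^ 2) (min_le_left _ _)
  have a2 := h3 (exp ε) ((min_le_right _ _).trans (min_le_left _ _))
  have a3 := h3 k ((min_le_right _ _).trans (min_le_right _ _))
  rw [rate, h2, mul_div_assoc]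
  linarith

theorem abs_sub_le_of_private {ε : ℝ} {g : Fin k → ℝ} (hg0 : ∀ x, 0 ≤ g x)
    (hg : ∀ x x', g x ≤ exp ε * g x') (x x' : Fin k) : |g x - g x'| ≤ (exp ε - 1) * g x' := by
  have h1 := hg x x'
  have h2 := hg x' x
  have h3 := hg0 x
  have h4 := hg0 x'
  rw [abs_le]
  constructor
  · rcases le_total (g x) (g x') with h | h <;> nlinarith [hg x x]
  · linarith

/-- The squared differences over the pairs are bounded by the maximum times the total mass. -/
theorem sum_sq_pairIndex_le_mul {g : Fin k → ℝ} (hg0 : ∀ x, 0 ≤ g x) {M : ℝ} (hM0 : 0 ≤ M)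
    (hM : ∀ x, g x ≤ M) :
    ∑ i, (g (pairIndex (i, true)) - g (pairIndex (i, false))) ^ 2 ≤ M * ∑ x, g x := by
  have h1 : ∀ x, g x ^ 2 ≤ M * g x := fun x => by nlinarith [hg0 x, hM x]
  calc ∑ i, (g (pairIndex (i, true)) - g (pairIndex (i, false))) ^ 2
      ≤ ∑ i, M * (g (pairIndex (i, true)) + g (pairIndex (i, false))) := by
        refine Finset.sum_le_sum fun i _ => ?_
        nlinarith [h1 (pairIndex (i, true)), h1 (pairIndex (i, false)),
          mul_nonneg (hg0 (pairIndex (i, true))) (hg0 (pairIndex (i, false)))]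
    _ = M * ∑ i, (g (pairIndex (i, true)) + g (pairIndex (i, false))) := by rw [Finset.mul_sum]
    _ ≤ M * ∑ x, g x := by gcongr; exact sum_pairIndex_le hg0

section Pointwise

variable {ε : ℝ} {g : Fin k → ℝ} (hg0 : ∀ x, 0 ≤ g x) (hg1 : ∑ x, g x = 1)
  (hg : ∀ x x', g x ≤ exp ε * g x')

include hg0 hg1 hg

theorem sum_sq_pairIndex_le [NeZero k] :
    ∑ i, (g (pairIndex (i, true)) - g (pairIndex (i, false))) ^ 2 ≤ privacyFactor k ε / k := by
  have hk : (0 : ℝ) < k := by exact_mod_cast NeZero.pos k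
  rw [le_div_iff₀ hk]
  refine le_min ?_ (le_min ?_ ?_)
  · obtain ⟨x₀, hx₀⟩ := Finite.exists_min g
    have hmin : k * g x₀ ≤ 1 := by
      rw [← hg1]
      have := Finset.card_nsmul_le_sum Finset.univ g (g x₀) fun x _ => hx₀ x
      simpa using this
    have hsq : ∀ x x', (g x - g x') ^ 2 ≤ ((exp ε - 1) * g x₀) ^ 2 := fun x x' => by
      have a1 : g x ≤ exp ε * g x₀ := hg x x₀
      have a2 : g x' ≤ exp ε * g x₀ := hg x' x₀
      apply sq_le_sq'
      · linarith [hx₀ x]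
      · linarith [hx₀ x']
    have hhalf : ((k / 2 : ℕ) : ℝ) ≤ k := by exact_mod_cast Nat.div_le_self k 2
    calc (∑ i, (g (pairIndex (i, true)) - g (pairIndex (i, false))) ^ 2) * k
        ≤ (∑ _i : Fin (k / 2), ((exp ε - 1) * g x₀) ^ 2) * k := by
          exact mul_le_mul_of_nonneg_right (Finset.sum_le_sum fun i _ => hsq _ _) hk.le
      _ = (k / 2 : ℕ) * ((exp ε - 1) * g x₀) ^ 2 * k := by simp
      _ ≤ k * ((exp ε - 1) * g x₀) ^ 2 * k := by gcongr
      _ = (exp ε - 1) ^ 2 * (k * g x₀) ^ 2 := by ring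
      _ ≤ (exp ε - 1) ^ 2 * 1 := by
          gcongr
          exact pow_le_one₀ (mul_nonneg hk.le (hg0 x₀)) hmin
      _ = (exp ε - 1) ^ 2 := mul_one _
  · rw [← le_div_iff₀ hk]
    refine (sum_sq_pairIndex_le_mul hg0 (M := exp ε / k) (by positivity) fun x => ?_).trans_eq
      (by rw [hg1, mul_one])
    rw [le_div_iff₀ hk]
    have := Finset.sum_le_sum fun x' (_ : x' ∈ Finset.univ) => hg x x'
    rw [← Finset.mul_sum, hg1] at this
    simp at this
    linarith
  · have : ∀ x, g x ≤ 1 := fun x => by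
      rw [← hg1]; exact Finset.single_le_sum (fun x _ => hg0 x) (Finset.mem_univ x)
    exact mul_le_of_le_one_left hk.le
      ((sum_sq_pairIndex_le_mul hg0 zero_le_one this).trans_eq (by rw [hg1, mul_one]))

theorem abs_mul_sub_one_le [NeZero k] (x : Fin k) :
    |k * g x - 1| ≤ exp ε - 1 ∧ |k * g x - 1| ≤ k := by
  have hk : (1 : ℝ) ≤ k := by exact_mod_cast NeZero.pos k
  constructor
  · have h1 : k * g x - 1 = ∑ x', (g x - g x') := by
      rw [Finset.sum_sub_distrib, hg1]; simp
    rw [h1]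
    refine (Finset.abs_sum_le_sum_abs _ _).trans ?_
    calc ∑ x', |g x - g x'| ≤ ∑ x', (exp ε - 1) * g x' :=
          Finset.sum_le_sum fun x' _ => abs_sub_le_of_private hg0 hg x x'
      _ = exp ε - 1 := by rw [← Finset.mul_sum, hg1, mul_one]
  · have h2 : g x ≤ 1 := by
      rw [← hg1]; exact Finset.single_le_sum (fun x _ => hg0 x) (Finset.mem_univ x)
    rw [abs_le]
    constructor <;> nlinarith [hg0 x]

end Pointwise

/-! ### The paired perturbations -/

/-- The perturbation which adds `δ σ_i` to the element `2i + 1` and subtracts it from `2i`, for all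
pairs `i` in `G`. -/
noncomputable def pairPerturbation (G : Finset (Fin (k / 2))) (δ : ℝ) (σ : G → Bool) :
    Fin k → ℝ :=
  Function.extend (fun p : G × Bool => pairIndex (p.1.1, p.2))
    (fun p => δ * boolSign (σ p.1) * boolSign p.2) 0

theorem boolSign_true : boolSign true = 1 := rfl

theorem boolSign_false : boolSign false = -1 := rfl

theorem abs_boolSign (c : Bool) : |boolSign c| = 1 := by cases c <;> simp [boolSign]

section PairPerturbation

variable (G : Finset (Fin (k / 2))) (δ : ℝ) (σ : G → Bool)

theorem pairIndex_subtype_injective :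
    Function.Injective fun p : G × Bool => pairIndex (p.1.1, p.2) := by
  rintro ⟨i, c⟩ ⟨j, d⟩ h
  have := pairIndex_injective h
  simp only [Prod.mk.injEq] at this ⊢
  exact ⟨Subtype.ext this.1, this.2⟩

theorem sum_pairPerturbation_mul (h : Fin k → ℝ) :
    ∑ x, pairPerturbation G δ σ x * h x =
      δ * ∑ i, boolSign (σ i) * (h (pairIndex (i.1, true)) - h (pairIndex (i.1, false))) := by
  have hinj := pairIndex_subtype_injective G
  rw [← Fintype.sum_of_injective _ hinj (fun p => δ * boolSign (σ p.1) * boolSign p.2 *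
    h (pairIndex (p.1.1, p.2)))]
  · rw [Fintype.sum_prod_type, Finset.mul_sum]
    refine Finset.sum_congr rfl fun i _ => ?_
    simp only [Fintype.sum_bool, boolSign_true, boolSign_false]; ring
  · intro x hx
    rw [pairPerturbation, Function.extend_apply' _ _ _ fun ⟨p, hp⟩ => hx ⟨p, hp⟩]
    simp
  · intro p
    rw [pairPerturbation, hinj.extend_apply]

theorem sum_pairPerturbation : ∑ x, pairPerturbation G δ σ x = 0 := by
  simpa using sum_pairPerturbation_mul G δ σ fun _ => 1

variable {δ} (hδ : 0 ≤ δ)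

include hδ

theorem abs_pairPerturbation_le (x : Fin k) : |pairPerturbation G δ σ x| ≤ δ := by
  have hinj := pairIndex_subtype_injective G
  by_cases hx : ∃ p : G × Bool, pairIndex (p.1.1, p.2) = x
  · obtain ⟨p, rfl⟩ := hx
    rw [pairPerturbation, hinj.extend_apply]
    simp [abs_mul, abs_boolSign, abs_of_nonneg hδ]
  · rw [pairPerturbation, Function.extend_apply' _ _ _ hx]
    simpa using hδ

theorem sum_abs_pairPerturbation :
    ∑ x, |pairPerturbation G δ σ x| = 2 * G.card * δ := by
  have hinj := pairIndex_subtype_injective G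
  rw [← Fintype.sum_of_injective _ hinj (fun _ => δ)]
  · rw [Finset.sum_const, Finset.card_univ, Fintype.card_prod, Fintype.card_coe, Fintype.card_bool,
      nsmul_eq_mul]
    push_cast; ring
  · intro x hx
    rw [pairPerturbation, Function.extend_apply' _ _ _ fun ⟨p, hp⟩ => hx ⟨p, hp⟩]
    simp
  · intro p
    rw [pairPerturbation, hinj.extend_apply]
    simp [abs_mul, abs_boolSign, abs_of_nonneg hδ]

end PairPerturbation

open scoped ComplexOrder MatrixOrder Matrix.Norms.L2Operator in
theorem exists_gram_vectors {ι : Type*} [Fintype ι] [DecidableEq ι] {A : Matrix ι ι ℝ}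
    (hA : A.PosSemidef) : ∃ b : ι → EuclideanSpace ℝ ι, ∀ i j, inner ℝ (b i) (b j) = A i j := by
  obtain ⟨B, hB⟩ := CStarAlgebra.nonneg_iff_eq_star_mul_self.mp hA.nonneg
  refine ⟨fun i => WithLp.toLp 2 fun l => B l i, fun i j => ?_⟩
  rw [hB, Matrix.mul_apply, PiLp.inner_apply]
  refine Finset.sum_congr rfl fun l _ => ?_
  simp [Matrix.star_apply, mul_comm]

/-! ### The lower bound on the number of users -/

/-- The difference of the normalised densities on the two inputs of the pair `i`. -/
def densityDiff (f : Fin k → Y → ℝ) (i : Fin (k / 2)) (y : Y) : ℝ :=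
  f (pairIndex (i, true)) y - f (pairIndex (i, false)) y

namespace IsDensity

variable [NeZero k] {R : Randomiser k Y} {f : Fin k → Y → ℝ}

theorem measurable_densityDiff (hf : IsDensity R f) (i : Fin (k / 2)) :
    Measurable (densityDiff f i) := (hf.measurable _).sub (hf.measurable _)

theorem integrable_densityDiff_mul (hf : IsDensity R f) (i j : Fin (k / 2)) :
    Integrable (fun y => densityDiff f i y * densityDiff f j y) ((unif k).bind R.kernel) := by
  have hb : ∀ i y, |densityDiff f i y| ≤ 1 := fun i y => by
    rw [densityDiff, abs_le]
    constructor <;> linarith [hf.nonneg (pairIndex (i, true)) y, hf.le_one (pairIndex (i, true)) y,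
      hf.nonneg (pairIndex (i, false)) y, hf.le_one (pairIndex (i, false)) y]
  refine Integrable.of_bound
    ((hf.measurable_densityDiff i).mul (hf.measurable_densityDiff j)).aestronglyMeasurable 1
    (Filter.Eventually.of_forall fun y => ?_)
  rw [norm_mul]
  exact mul_le_one₀ (hb i y) (norm_nonneg _) (hb j y)

/-- The total information on the pairs is bounded by the privacy factor. -/
theorem sum_integral_densityDiff_le (hf : IsDensity R f) {ε : ℝ}
    (hε : ∀ x x' y, f x y ≤ exp ε * f x' y) :
    ∑ i, ∫ y, densityDiff f i y * densityDiff f i y ∂(unif k).bind R.kernel ≤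
      privacyFactor k ε / k := by
  rw [← integral_finsetSum _ fun i _ => hf.integrable_densityDiff_mul i i]
  calc ∫ y, ∑ i, densityDiff f i y * densityDiff f i y ∂(unif k).bind R.kernel
      ≤ ∫ _y, privacyFactor k ε / k ∂(unif k).bind R.kernel := by
        refine integral_mono (integrable_finsetSum _ fun i _ => hf.integrable_densityDiff_mul i i)
          (integrable_const _) fun y => ?_
        simp only [← sq]
        exact sum_sq_pairIndex_le (hf.nonneg · y) (hf.sum_eq_one y) (hε · · y)
    _ = _ := by simp

theorem abs_integral_mul_le_one (hf : IsDensity R f) {W W' : Fin k → ℝ} (hW : ∀ x, |W x| ≤ 1)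
    (hW' : ∀ x, |W' x| ≤ 1) :
    |∫ y, (∑ x, W x * f x y) * (∑ x, W' x * f x y) ∂(unif k).bind R.kernel| ≤ 1 := by
  have hb : ∀ V : Fin k → ℝ, (∀ x, |V x| ≤ 1) → ∀ y, |∑ x, V x * f x y| ≤ 1 := fun V hV y => by
    refine (Finset.abs_sum_le_sum_abs _ _).trans ?_
    rw [← hf.sum_eq_one y]
    refine Finset.sum_le_sum fun x _ => ?_
    rw [abs_mul, abs_of_nonneg (hf.nonneg x y)]
    exact mul_le_of_le_one_left (hf.nonneg x y) (hV x)
  have := norm_integral_le_of_norm_le_const (μ := (unif k).bind R.kernel) (C := 1)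
    (f := fun y => (∑ x, W x * f x y) * (∑ x, W' x * f x y))
    (Filter.Eventually.of_forall fun y => by
      rw [norm_mul]
      exact mul_le_one₀ (hb W hW y) (norm_nonneg _) (hb W' hW' y))
  simpa using this

end IsDensity

theorem inv_sqrt_pow_lt {κ : ℝ} {m : ℕ} (hκ : 1 ≤ κ) (hm : m ≤ κ / 2) :
    (√(1 - 1 / (100 * κ)))⁻¹ ^ m < 10 / 9 := by
  have hκ0 : 0 < κ := by linarith
  set t : ℝ := 1 / (100 * κ) with ht
  have ht0 : 0 < t := by positivity
  have ht1 : t ≤ 1 / 100 := by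
    apply one_div_le_one_div_of_le <;> linarith
  have h1 : 1 - t ≤ √(1 - t) := by
    apply le_sqrt_of_sq_le; nlinarith
  have h2 : 1 - m * t ≤ √(1 - t) ^ m := by
    have h3 := one_add_mul_le_pow (a := -t) (by linarith) m
    have h4 : (1 + -t) ^ m ≤ √(1 - t) ^ m :=
      pow_le_pow_left₀ (by linarith) (by linarith) _
    linarith
  have h3 : m * t ≤ 1 / 200 := by
    calc m * t ≤ κ / 2 * t := by gcongr
      _ = 1 / 200 := by rw [ht]; field_simp; norm_num
  have h4 : (√(1 - t) ^ m)⁻¹ ≤ (199 / 200)⁻¹ := by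
    apply inv_anti₀ (by norm_num); linarith
  rw [inv_pow]
  norm_num at h4
  linarith

/-- The information matrix of all users on the pairs of inputs. -/
noncomputable def pairInfo [NeZero k] (P : Protocol n k Y) (f : Fin n → Fin k → Y → ℝ) :
    Matrix (Fin (k / 2)) (Fin (k / 2)) ℝ := fun i j =>
  ∑ u, ∫ y, densityDiff (f u) i y * densityDiff (f u) j y ∂(unif k).bind (P.randomiser u).kernel

section Pair

variable [NeZero k] {P : Protocol n k Y} {f : Fin n → Fin k → Y → ℝ}
  (hf : ∀ u, IsDensity (P.randomiser u) (f u))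

include hf

theorem sum_integral_pairPerturbation (G : Finset (Fin (k / 2))) (δ : ℝ) (σ σ' : G → Bool) :
    ∑ u, ∫ y, (∑ x, pairPerturbation G δ σ x * f u x y) *
        (∑ x, pairPerturbation G δ σ' x * f u x y) ∂(unif k).bind (P.randomiser u).kernel =
      δ ^ 2 * ∑ i, ∑ j, boolSign (σ i) * boolSign (σ' j) * pairInfo P f i.1 j.1 := by
  have h1 : ∀ u, ∫ y, (∑ x, pairPerturbation G δ σ x * f u x y) *
      (∑ x, pairPerturbation G δ σ' x * f u x y) ∂(unif k).bind (P.randomiser u).kernel =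
      δ ^ 2 * ∑ i : G, ∑ j : G, boolSign (σ i) * boolSign (σ' j) *
        ∫ y, densityDiff (f u) i.1 y * densityDiff (f u) j.1 y
          ∂(unif k).bind (P.randomiser u).kernel := fun u => by
    have h2 : ∀ y, (∑ x, pairPerturbation G δ σ x * f u x y) *
        (∑ x, pairPerturbation G δ σ' x * f u x y) =
        δ ^ 2 * ∑ i : G, ∑ j : G, boolSign (σ i) * boolSign (σ' j) *
          (densityDiff (f u) i.1 y * densityDiff (f u) j.1 y) := fun y => by
      rw [sum_pairPerturbation_mul G δ σ fun x => f u x y,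
        sum_pairPerturbation_mul G δ σ' fun x => f u x y, mul_mul_mul_comm, ← sq,
        Finset.sum_mul_sum]
      congr 1
      exact Finset.sum_congr rfl fun i _ => Finset.sum_congr rfl fun j _ => by
        simp only [densityDiff]; ring
    have h3 : ∀ i j : G, Integrable (fun y => boolSign (σ i) * boolSign (σ' j) *
        (densityDiff (f u) i.1 y * densityDiff (f u) j.1 y))
        ((unif k).bind (P.randomiser u).kernel) := fun i j =>
      ((hf u).integrable_densityDiff_mul i.1 j.1).const_mul _
    simp only [h2]
    rw [integral_const_mul,
      integral_finsetSum _ fun i _ => integrable_finsetSum _ fun j _ => h3 i j]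
    congr 1
    refine Finset.sum_congr rfl fun i _ => ?_
    rw [integral_finsetSum _ fun j _ => h3 i j]
    simp only [integral_const_mul]
  simp only [h1, ← Finset.mul_sum]
  rw [Finset.sum_comm]
  congr 1
  refine Finset.sum_congr rfl fun i _ => ?_
  rw [Finset.sum_comm]
  refine Finset.sum_congr rfl fun j _ => ?_
  rw [← Finset.mul_sum, pairInfo]

theorem posSemidef_pairInfo (G : Finset (Fin (k / 2))) :
    Matrix.PosSemidef (Matrix.of fun i j : G => pairInfo P f i.1 j.1) := by
  refine Matrix.PosSemidef.of_dotProduct_mulVec_nonneg ?_ fun x => ?_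
  · ext i j
    simp only [Matrix.conjTranspose_apply, Matrix.of_apply, star_trivial, pairInfo]
    simp only [mul_comm]
  · have h3 : ∀ u (i j : G), Integrable (fun y => x i * x j *
        (densityDiff (f u) i.1 y * densityDiff (f u) j.1 y))
        ((unif k).bind (P.randomiser u).kernel) := fun u i j =>
      ((hf u).integrable_densityDiff_mul i.1 j.1).const_mul _
    have h1 : star x ⬝ᵥ (Matrix.of fun i j : G => pairInfo P f i.1 j.1).mulVec x =
        ∑ u, ∫ y, (∑ i : G, x i * densityDiff (f u) i.1 y) ^ 2
          ∂(unif k).bind (P.randomiser u).kernel := by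
      have h2 : ∀ u, ∫ y, (∑ i : G, x i * densityDiff (f u) i.1 y) ^ 2
          ∂(unif k).bind (P.randomiser u).kernel = ∑ i : G, ∑ j : G, x i * x j *
          ∫ y, densityDiff (f u) i.1 y * densityDiff (f u) j.1 y
            ∂(unif k).bind (P.randomiser u).kernel := fun u => by
        have h4 : ∀ y, (∑ i : G, x i * densityDiff (f u) i.1 y) ^ 2 = ∑ i : G, ∑ j : G, x i * x j *
            (densityDiff (f u) i.1 y * densityDiff (f u) j.1 y) := fun y => by
          rw [sq, Finset.sum_mul_sum]
          exact Finset.sum_congr rfl fun i _ => Finset.sum_congr rfl fun j _ => by ring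
        simp only [h4]
        rw [integral_finsetSum _ fun i _ => integrable_finsetSum _ fun j _ => h3 u i j]
        refine Finset.sum_congr rfl fun i _ => ?_
        rw [integral_finsetSum _ fun j _ => h3 u i j]
        simp only [integral_const_mul]
      simp only [h2]
      rw [Finset.sum_comm]
      simp only [dotProduct, Matrix.mulVec, Matrix.of_apply, star_trivial, Finset.mul_sum, pairInfo,
        Finset.sum_mul]
      refine Finset.sum_congr rfl fun i _ => ?_
      rw [Finset.sum_comm]
      exact Finset.sum_congr rfl fun j _ => Finset.sum_congr rfl fun u _ => by ring
    rw [h1]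
    exact Finset.sum_nonneg fun u _ => integral_nonneg fun y => sq_nonneg _

/-- If the users carry at most `ξ²` of information on each pair of a family `G` that suffices to
move the uniform law by more than `α`, then `δ² ξ²` cannot be small: signs produced by the
Gram–Schmidt walk for the vectors with Gram matrix `pairInfo` fool the tester. -/
theorem pair_lower_bound {α : ℝ} (hP : P.SolvesUniformityTesting α) (G : Finset (Fin (k / 2)))
    {ξ δ : ℝ} (hξ : 0 < ξ) (hG : ∀ i ∈ G, pairInfo P f i i ≤ ξ ^ 2) (hδ0 : 0 ≤ δ) (hδ1 : δ ≤ 1)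
    (hα : k * α < G.card * δ) (hτ : (δ ^ 2 * ξ ^ 2) ^ 2 < 1) :
    10 / 9 ≤ (√(1 - (δ ^ 2 * ξ ^ 2) ^ 2))⁻¹ ^ G.card := by
  obtain ⟨b, hb⟩ := exists_gram_vectors (posSemidef_pairInfo hf G)
  simp only [Matrix.of_apply] at hb
  have hnorm : ∀ i, ‖ξ⁻¹ • b i‖ ≤ 1 := fun i => by
    have h1 : ‖b i‖ ^ 2 ≤ ξ ^ 2 := by
      rw [← real_inner_self_eq_norm_sq, hb]; exact hG i.1 i.2
    have h2 : ‖b i‖ ≤ ξ := le_of_sq_le_sq h1 hξ.le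
    rw [norm_smul, norm_inv, norm_eq_abs, abs_of_pos hξ, inv_mul_le_iff₀ hξ, mul_one]
    exact h2
  obtain ⟨μ, hμ0, hμ1, hμ⟩ := exists_subgaussian_signing hnorm
  have hchi := chiSquare_lower_bound hP hf hμ0 hμ1 (W := fun σ => pairPerturbation G δ σ)
    (fun σ => sum_pairPerturbation G δ σ)
    (fun σ x => by
      have := abs_pairPerturbation_le G σ hδ0 x
      linarith [neg_le_of_abs_le this])
    (fun σ => by rw [sum_abs_pairPerturbation G σ hδ0]; linarith)
  refine hchi.trans (le_trans ?_ ((sum_sum_exp_inner_le μ hμ0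
    (fun σ => ∑ i, boolSign (σ i) • ξ⁻¹ • b i) hμ hτ).trans_eq (by rw [Fintype.card_coe])))
  refine Finset.sum_le_sum fun σ _ => Finset.sum_le_sum fun σ' _ =>
    mul_le_mul_of_nonneg_left ?_ (mul_nonneg (hμ0 σ) (hμ0 σ'))
  have hinner : δ ^ 2 * ξ ^ 2 * inner ℝ (∑ i, boolSign (σ i) • ξ⁻¹ • b i)
      (∑ i, boolSign (σ' i) • ξ⁻¹ • b i) =
      δ ^ 2 * ∑ i, ∑ j, boolSign (σ i) * boolSign (σ' j) * pairInfo P f i.1 j.1 := by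
    rw [mul_assoc, sum_inner, Finset.mul_sum]
    congr 1
    refine Finset.sum_congr rfl fun i _ => ?_
    rw [inner_sum, Finset.mul_sum]
    refine Finset.sum_congr rfl fun j _ => ?_
    rw [real_inner_smul_left, real_inner_smul_left, real_inner_smul_right, real_inner_smul_right,
      hb]
    field_simp
  rw [hinner, ← sum_integral_pairPerturbation hf, exp_sum]
  refine Finset.prod_le_prod (fun u _ => ?_) fun u _ => ?_
  · have := (hf u).abs_integral_mul_le_one (W := pairPerturbation G δ σ)
      (W' := pairPerturbation G δ σ') (fun x => (abs_pairPerturbation_le G σ hδ0 x).trans hδ1)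
      (fun x => (abs_pairPerturbation_le G σ' hδ0 x).trans hδ1)
    linarith [neg_le_of_abs_le this]
  · rw [add_comm]; exact add_one_le_exp _

/-- The bound for a large domain. The pairs with more than the average information, scaled
by `1 / η`, are discarded. -/
theorem large_domain_lower_bound {ε α α₀ η : ℝ} (hP : P.SolvesUniformityTesting α)
    (hfε : ∀ u x x' y, f u x y ≤ exp ε * f u x' y) (hε : 0 < ε) (hα : 0 < α) (hαα : α ≤ α₀)
    (hη : 0 < η) (hηα : α₀ + 2 * η = 1 / 2) (hk : 1 < 2 * η * k) :
    α₀ ^ 2 * η / 30 * rate k ε α ≤ n := by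
  have hk0 : (0 : ℝ) < k := by exact_mod_cast NeZero.pos k
  have hT := privacyFactor_pos (k := k) hε
  have hα₀ : 0 < α₀ := hα.trans_le hαα
  by_contra! hn
  have hs : 0 < √(k : ℝ) := sqrt_pos.2 hk0
  have hss : √(k : ℝ) ^ 2 = k := sq_sqrt hk0.le
  have hk32 : (k : ℝ) ^ (3 / 2 : ℝ) = √k * k := by
    rw [sqrt_eq_rpow, ← rpow_add_one hk0.ne']; norm_num
  have hnT : n * privacyFactor k ε < α₀ ^ 2 * η / 10 * (√k * k) / α ^ 2 := by
    have h1 := hn.trans_le (mul_le_mul_of_nonneg_left (rate_le (k := k) hε hα)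
      (by positivity : 0 ≤ α₀ ^ 2 * η / 30))
    rw [hk32] at h1
    calc n * privacyFactor k ε
        < α₀ ^ 2 * η / 30 * (3 * (√k * k) / (α ^ 2 * privacyFactor k ε)) * privacyFactor k ε := by
          gcongr
      _ = _ := by field_simp; norm_num
  -- the threshold is chosen to make `(α / α₀)² ξ² = 1 / (10 √k)`
  set ξ := √(α₀ ^ 2 / (10 * √k * α ^ 2)) with hξ
  have hξ0 : 0 < ξ := sqrt_pos.2 (by positivity)
  have hξ2 : ξ ^ 2 = α₀ ^ 2 / (10 * √k * α ^ 2) := sq_sqrt (by positivity)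
  set G : Finset (Fin (k / 2)) := {i | pairInfo P f i i ≤ ξ ^ 2} with hGdef
  have hdiag : ∀ i, 0 ≤ pairInfo P f i i := fun i =>
    Finset.sum_nonneg fun u _ => integral_nonneg fun y => mul_self_nonneg _
  have htrace : ∑ i, pairInfo P f i i ≤ n * (privacyFactor k ε / k) := by
    simp only [pairInfo]
    rw [Finset.sum_comm]
    refine (Finset.sum_le_sum fun u _ => (hf u).sum_integral_densityDiff_le (hfε u)).trans ?_
    simp
  have hbad : (Gᶜ.card : ℝ) * ξ ^ 2 ≤ n * (privacyFactor k ε / k) := by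
    refine le_trans ?_ htrace
    calc (Gᶜ.card : ℝ) * ξ ^ 2 = ∑ i ∈ Gᶜ, ξ ^ 2 := by simp
      _ ≤ ∑ i ∈ Gᶜ, pairInfo P f i i := by
          refine Finset.sum_le_sum fun i hi => ?_
          simp only [hGdef, Finset.mem_compl, Finset.mem_filter, Finset.mem_univ, true_and,
            not_le] at hi
          exact hi.le
      _ ≤ ∑ i, pairInfo P f i i :=
          Finset.sum_le_sum_of_subset_of_nonneg (Finset.subset_univ _) fun i _ _ => hdiag i
  have hbad2 : (Gᶜ.card : ℝ) ≤ η * k := by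
    have h1 : n * (privacyFactor k ε / k) ≤ η * k * ξ ^ 2 := by
      rw [hξ2, ← mul_div_assoc, div_le_iff₀ hk0]
      refine hnT.le.trans (le_of_eq ?_)
      field_simp
      rw [hss]
    exact le_of_mul_le_mul_right (hbad.trans h1) (by positivity)
  have hcard : (G.card : ℝ) + Gᶜ.card = (k / 2 : ℕ) := by
    rw [← Nat.cast_add, Finset.card_add_card_compl, Fintype.card_fin]
  have hhalf : (k : ℝ) - 1 ≤ 2 * (k / 2 : ℕ) := by
    have : k ≤ 2 * (k / 2) + 1 := by omega
    have : (k : ℝ) ≤ 2 * (k / 2 : ℕ) + 1 := by exact_mod_cast this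
    linarith
  have hhalf' : 2 * ((k / 2 : ℕ) : ℝ) ≤ k := by exact_mod_cast Nat.mul_div_le k 2
  have hτ : ((α / α₀) ^ 2 * ξ ^ 2) ^ 2 = 1 / (100 * k) := by
    have h1 : (α / α₀) ^ 2 * ξ ^ 2 = 1 / (10 * √k) := by rw [hξ2]; field_simp
    rw [h1, div_pow, mul_pow, hss]; norm_num
  have hk1 : (1 : ℝ) ≤ k := by exact_mod_cast NeZero.pos k
  have hτ1 : (1 : ℝ) / (100 * k) ≤ 1 / 100 := by
    apply one_div_le_one_div_of_le <;> linarith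
  have hmain := pair_lower_bound hf hP G hξ0 (fun i hi => by simpa [hGdef] using hi)
    (δ := α / α₀) (by positivity) (by rwa [div_le_one hα₀]) (by
      rw [← mul_div_assoc, lt_div_iff₀ hα₀]
      have h1 : k * α₀ = k / 2 - 2 * (η * k) := by
        rw [show α₀ = 1 / 2 - 2 * η by linarith]; ring
      calc k * α * α₀ = k * α₀ * α := by ring
        _ < G.card * α := mul_lt_mul_of_pos_right (by linarith) hα) (by rw [hτ]; linarith)
  rw [hτ] at hmain
  have h4 : (0 : ℝ) ≤ Gᶜ.card := Nat.cast_nonneg _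
  exact absurd hmain (not_le.2 (inv_sqrt_pow_lt hk1 (by linarith)))

/-- The bound for a small domain, from the perturbation towards a point mass. -/
theorem small_domain_lower_bound {ε α α₀ : ℝ} (hP : P.SolvesUniformityTesting α)
    (hfε : ∀ u x x' y, f u x y ≤ exp ε * f u x' y) (hε : 0 < ε) (hα : 0 < α) (hαα : α ≤ α₀)
    (hα₀ : α₀ < 1 / 2) (hk : 2 ≤ k) :
    α₀ ^ 2 / (30 * k ^ 4) * rate k ε α ≤ n := by
  have hk0 : (2 : ℝ) ≤ k := by exact_mod_cast hk
  have hT := privacyFactor_pos (k := k) hε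
  have hα₀' : 0 < α₀ := hα.trans_le hαα
  set δ := α / α₀ with hδ
  have hδ0 : 0 < δ := by positivity
  have hδ1 : δ ≤ 1 := by rwa [hδ, div_le_one hα₀']
  set W : Fin k → ℝ := fun x => δ * ((if x = 0 then (k : ℝ) else 0) - 1) with hW
  have hWf : ∀ u y, ∑ x, W x * f u x y = δ * (k * f u 0 y - 1) := fun u y => by
    simp only [hW, mul_assoc, ← Finset.mul_sum, sub_mul, Finset.sum_sub_distrib, one_mul,
      (hf u).sum_eq_one]
    simp
  have hm2 : ∀ u y, (k * f u 0 y - 1) ^ 2 ≤ k ^ 2 * privacyFactor k ε := fun u y => by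
    obtain ⟨h1, h2⟩ := abs_mul_sub_one_le ((hf u).nonneg · y) ((hf u).sum_eq_one y)
      (hfε u · · y) 0
    have h1' := pow_le_pow_left₀ (abs_nonneg _) h1 2
    have h2' := pow_le_pow_left₀ (abs_nonneg _) h2 2
    rw [sq_abs] at h1' h2'
    have hk2 : (1 : ℝ) ≤ k ^ 2 := one_le_pow₀ (by linarith)
    rw [← div_le_iff₀' (by positivity)]
    refine le_min ?_ (le_min ?_ ?_)
    · rw [div_le_iff₀' (by positivity)]
      exact h1'.trans (le_mul_of_one_le_left (sq_nonneg _) hk2)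
    · rw [div_le_iff₀' (by positivity)]
      exact h2'.trans (le_mul_of_one_le_right (by positivity) (one_le_exp hε.le))
    · rw [div_le_iff₀' (by positivity)]
      exact h2'.trans (le_mul_of_one_le_right (by positivity) (by linarith))
  have hchi := chiSquare_lower_bound hP hf (S := Unit) (μ := fun _ => 1) (by simp) (by simp)
    (W := fun _ => W)
    (fun _ => by
      simp only [hW, ← Finset.mul_sum, Finset.sum_sub_distrib]; simp)
    (fun _ x => by
      simp only [hW]
      split_ifs
      · nlinarith
      · linarith)
    (fun _ => by
      have h1 : ∀ x, |W x| = δ * ((if x = 0 then (k : ℝ) - 2 else 0) + 1) := fun x => by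
        simp only [hW, abs_mul, abs_of_pos hδ0]
        congr 1
        split_ifs
        · rw [abs_of_nonneg (by linarith)]; ring
        · simp
      simp only [h1, ← Finset.mul_sum, Finset.sum_add_distrib]
      simp only [Finset.sum_ite_eq', Finset.mem_univ, if_true, Finset.sum_const, Finset.card_univ,
        Fintype.card_fin, nsmul_eq_mul, mul_one]
      rw [hδ, div_mul_eq_mul_div, lt_div_iff₀ hα₀']
      have h2 : 0 < (k : ℝ) - 1 - k * α₀ := by nlinarith
      nlinarith [mul_pos hα h2])
  have hprod : ∏ u, (1 + ∫ y, (∑ x, W x * f u x y) * (∑ x, W x * f u x y)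
      ∂(unif k).bind (P.randomiser u).kernel) ≤
      exp (n * (δ ^ 2 * (k ^ 2 * privacyFactor k ε))) := by
    calc _ ≤ ∏ _u : Fin n, exp (δ ^ 2 * (k ^ 2 * privacyFactor k ε)) := by
          refine Finset.prod_le_prod (fun u _ => ?_) fun u _ => ?_
          · exact add_nonneg zero_le_one (integral_nonneg fun y => mul_self_nonneg _)
          · rw [add_comm]
            refine le_trans (add_le_add_left ?_ 1) (add_one_le_exp _)
            have := integral_mono ((hf u).integrable_sum_mul_sum W W)
              (integrable_const (δ ^ 2 * (k ^ 2 * privacyFactor k ε))) fun y => by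
                dsimp only
                rw [hWf, ← sq, mul_pow]
                exact mul_le_mul_of_nonneg_left (hm2 u y) (sq_nonneg δ)
            simpa using this
      _ = _ := by simp [← exp_nat_mul]
  simp only [Finset.univ_unique, Finset.sum_singleton, mul_one, one_mul] at hchi
  have hexp := hchi.trans hprod
  have hlow : 1 / 10 ≤ n * (δ ^ 2 * (k ^ 2 * privacyFactor k ε)) := by
    by_contra! h
    have h1 := exp_lt_exp.2 h
    have h2 : exp (1 / 10) ≤ 10 / 9 := by
      have h3 := add_one_le_exp (-(1 / 10) : ℝ)
      rw [exp_neg] at h3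
      have h4 := inv_anti₀ (by norm_num) h3
      rw [inv_inv] at h4
      refine h4.trans (by norm_num)
    linarith
  have hk32 : (k : ℝ) ^ (3 / 2 : ℝ) ≤ (k : ℝ) ^ 2 := by
    rw [← rpow_natCast]
    exact rpow_le_rpow_of_exponent_le (by linarith) (by norm_num)
  calc α₀ ^ 2 / (30 * k ^ 4) * rate k ε α
      ≤ α₀ ^ 2 / (30 * k ^ 4) * (3 * (k : ℝ) ^ 2 / (α ^ 2 * privacyFactor k ε)) := by
        gcongr
        refine (rate_le (k := k) hε hα).trans ?_
        gcongr
    _ = 1 / 10 / (δ ^ 2 * (k ^ 2 * privacyFactor k ε)) := by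
        rw [hδ]; field_simp; norm_num
    _ ≤ n := by
        rw [div_le_iff₀ (by positivity)]; exact hlow

end Pair

theorem rate_nonneg (k : ℕ) (ε α : ℝ) : 0 ≤ rate k ε α := by
  unfold rate; positivity

theorem exists_lower_bound (α₀ : ℝ) (hα₀ : α₀ < 1 / 2) : ∃ c : ℝ, 0 < c ∧
    ∀ (k : ℕ) (ε α : ℝ) (n : ℕ) (Y : Type u) [MeasurableSpace Y]
      (P : Protocol n k Y), 2 ≤ k → 0 < ε → 0 < α → α ≤ α₀ →
      P.IsLDP ε → P.SolvesUniformityTesting α → c * rate k ε α ≤ n := by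
  rcases le_or_gt α₀ 0 with h0 | h0
  · exact ⟨1, one_pos, fun k ε α n Y _ P _ _ hα hαα => by linarith⟩
  set η := (1 / 2 - α₀) / 2 with hη
  have hη0 : 0 < η := by rw [hη]; linarith
  refine ⟨min (α₀ ^ 2 * η / 30) (α₀ ^ 2 / (30 * (1 / (2 * η)) ^ 4)), by positivity, ?_⟩
  intro k ε α n Y _ P hk hε hα hαα hLDP hP
  have : NeZero k := ⟨by omega⟩
  choose f hfm hf0 hf1 hfε hfk using fun u =>
    (P.randomiser u).exists_density hε.le (hLDP u)
  have hf : ∀ u, IsDensity (P.randomiser u) (f u) := fun u => ⟨hfm u, hf0 u, hf1 u, hfk u⟩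
  have hr := rate_nonneg k ε α
  rcases lt_or_ge 1 (2 * η * k) with h | h
  · exact (mul_le_mul_of_nonneg_right (min_le_left _ _) hr).trans
      (large_domain_lower_bound hf hP hfε hε hα hαα hη0 (by rw [hη]; ring) h)
  · refine (mul_le_mul_of_nonneg_right (min_le_right _ _) hr).trans
      (le_trans (mul_le_mul_of_nonneg_right ?_ hr)
        (small_domain_lower_bound hf hP hfε hε hα hαα hα₀ hk))
    have hk0 : (0 : ℝ) < k := by exact_mod_cast NeZero.pos k
    have : (k : ℝ) ≤ 1 / (2 * η) := by rw [le_div_iff₀ (by positivity)]; linarith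
    gcongr

/-! ### The trace bound -/

theorem hasSum_real_singleton [Countable Y] [MeasurableSingletonClass Y] (m : Measure Y)
    [IsProbabilityMeasure m] : HasSum (fun y => m.real {y}) 1 := by
  have h1 : ∑' y, m {y} = 1 := by
    have := Measure.tsum_indicator_apply_singleton m Set.univ MeasurableSet.univ
    simpa using this
  have h2 : Summable fun y => m.real {y} := ENNReal.summable_toReal (by rw [h1]; simp)
  have h3 : ∑' y, m.real {y} = 1 := by
    simp only [Measure.real]
    rw [← ENNReal.tsum_toReal_eq fun y => measure_ne_top m {y}, h1, ENNReal.toReal_one]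
  rw [← h3]
  exact h2.hasSum

theorem trace_infoMatrix_le [Countable Y] [MeasurableSingletonClass Y] {R : Randomiser k Y} {ε : ℝ}
    (hk : 2 ≤ k) (hR : R.IsPrivate ε) : (infoMatrix R).trace ≤ exp ε := by
  have : NeZero k := ⟨by omega⟩
  set a : Fin k → Y → ℝ := fun x y => (R.kernel x).real {y} with ha
  have ha0 : ∀ x y, 0 ≤ a x y := fun x y => measureReal_nonneg
  have hap : ∀ x y, a x y ≤ exp ε * a 0 y := fun x y => by
    have h1 := ENNReal.toReal_mono (ENNReal.mul_ne_top ENNReal.ofReal_ne_top (measure_ne_top _ _))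
      (hR x 0 {y} (measurableSet_singleton y))
    rwa [ENNReal.toReal_mul, ENNReal.toReal_ofReal (exp_pos ε).le] at h1
  have hsum : HasSum (fun y => exp ε * a 0 y) (exp ε) := by
    simpa using (hasSum_real_singleton (R.kernel 0)).mul_left (exp ε)
  have hle : ∀ y, ∑ i, pairDiff R y i * pairDiff R y i / ∑ x, a x y ≤ exp ε * a 0 y := fun y => by
    rw [← Finset.sum_div]
    refine div_le_of_le_mul₀ (Finset.sum_nonneg fun x _ => ha0 x y)
      (mul_nonneg (exp_pos ε).le (ha0 0 y)) ?_
    simp only [← sq]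
    exact sum_sq_pairIndex_le_mul (ha0 · y) (mul_nonneg (exp_pos ε).le (ha0 0 y)) (hap · y)
  have hterm : ∀ i y, 0 ≤ pairDiff R y i * pairDiff R y i / ∑ x, a x y := fun i y =>
    div_nonneg (mul_self_nonneg _) (Finset.sum_nonneg fun x _ => ha0 x y)
  have hs : ∀ i, Summable fun y => pairDiff R y i * pairDiff R y i / ∑ x, a x y := fun i =>
    Summable.of_nonneg_of_le (hterm i) (fun y => (Finset.single_le_sum
      (f := fun i => pairDiff R y i * pairDiff R y i / ∑ x, a x y) (fun i _ => hterm i y)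
      (Finset.mem_univ i)).trans (hle y)) hsum.summable
  calc (infoMatrix R).trace = ∑ i, ∑' y, pairDiff R y i * pairDiff R y i / ∑ x, a x y := rfl
    _ = ∑' y, ∑ i, pairDiff R y i * pairDiff R y i / ∑ x, a x y :=
        (Summable.tsum_finsetSum fun i _ => hs i).symm
    _ ≤ ∑' y, exp ε * a 0 y :=
        Summable.tsum_le_tsum hle (summable_sum fun i _ => hs i) hsum.summable
    _ = exp ε := hsum.tsum_eq

end Protocols

/-! ### The `ℓ₂` identity tester -/

section Tester

variable {n m : ℕ} {Y : Type u} [MeasurableSpace Y]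

/-- The randomised test which accepts on a given set of observations. -/
noncomputable def RandomisedTest.ofSet (S : Set (Fin n → Y)) (hS : MeasurableSet S) :
    RandomisedTest n Y where
  kernel := Kernel.deterministic (fun y => @decide (y ∈ S) (Classical.dec _))
    (measurable_to_bool (by
      have : (fun y => @decide (y ∈ S) (Classical.dec _)) ⁻¹' {true} = S := by ext; simp
      rw [this]; exact hS))
  isMarkov := inferInstance

instance (A : RandomisedTest n Y) (q : Measure Y) [IsProbabilityMeasure q] :
    IsProbabilityMeasure (A.outputIID q) := by
  unfold RandomisedTest.outputIID; infer_instance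

theorem RandomisedTest.ofSet_outputIID (S : Set (Fin n → Y)) (hS : MeasurableSet S) (q : Measure Y)
    [IsProbabilityMeasure q] :
    ((RandomisedTest.ofSet S hS).outputIID q).real {true} =
      (Measure.pi fun _ : Fin n => q).real S := by
  have h1 : ∀ y, (RandomisedTest.ofSet S hS).acceptProb y = S.indicator 1 y := fun y => by
    rw [RandomisedTest.acceptProb, RandomisedTest.ofSet, Kernel.deterministic_apply]
    by_cases h : y ∈ S <;> simp [h, Measure.real]
  rw [RandomisedTest.outputIID, RandomisedTest.bind_real_true]
  simp only [h1]
  exact integral_indicator_one hS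

theorem iIndepFun_eval (q : Measure Y) [IsProbabilityMeasure q] :
    iIndepFun (fun (i : Fin n) (y : Fin n → Y) => y i) (Measure.pi fun _ : Fin n => q) :=
  iIndepFun_pi (X := fun _ y => y) fun _ => aemeasurable_id

variable [Fintype Y] [MeasurableSingletonClass Y]

theorem integral_pi_eval (q : Measure Y) [IsProbabilityMeasure q] (f : Y → ℝ) (i : Fin n) :
    ∫ y, f (y i) ∂(Measure.pi fun _ : Fin n => q) = ∫ y, f y ∂q := by
  have h := integral_map (μ := Measure.pi fun _ : Fin n => q)
    (measurable_pi_apply i).aemeasurable (measurable_of_finite f).aestronglyMeasurable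
  have h' : (Measure.pi fun _ : Fin n => q).map (fun y => y i) = q :=
    (measurePreserving_eval (fun _ : Fin n => q) i).map_eq
  rw [h'] at h
  exact h.symm

/-- The second moments of sums over a family of distinct observations. -/
theorem integral_sum_mul_sum (q : Measure Y) [IsProbabilityMeasure q] {e : Fin m → Fin n}
    (he : Function.Injective e) (f g : Y → ℝ) :
    ∫ y, (∑ i, f (y (e i))) * (∑ i, g (y (e i))) ∂(Measure.pi fun _ : Fin n => q) =
      m ^ 2 * ((∫ y, f y ∂q) * ∫ y, g y ∂q) +
        m * (∫ y, f y * g y ∂q - (∫ y, f y ∂q) * ∫ y, g y ∂q) := by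
  have h1 : ∀ i j, ∫ y, f (y (e i)) * g (y (e j)) ∂(Measure.pi fun _ : Fin n => q) =
      (∫ y, f y ∂q) * (∫ y, g y ∂q) +
        if i = j then ∫ y, f y * g y ∂q - (∫ y, f y ∂q) * ∫ y, g y ∂q else 0 := fun i j => by
    split_ifs with h
    · subst h
      rw [integral_pi_eval q (fun y => f y * g y)]; ring
    · have hind : IndepFun (fun y : Fin n → Y => f (y (e i))) (fun y => g (y (e j)))
          (Measure.pi fun _ : Fin n => q) :=
        ((iIndepFun_eval q).indepFun (he.ne h)).comp (φ := f) (ψ := g)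
          (measurable_of_finite f) (measurable_of_finite g)
      rw [hind.integral_fun_mul_eq_mul_integral (Integrable.of_finite).aestronglyMeasurable
        (Integrable.of_finite).aestronglyMeasurable,
        integral_pi_eval q f, integral_pi_eval q g, add_zero]
  simp only [Finset.sum_mul_sum]
  rw [integral_finsetSum _ fun i _ => Integrable.of_finite]
  simp only [integral_finsetSum _ fun i _ => Integrable.of_finite, h1, Finset.sum_add_distrib]
  simp
  ring

/-- Sums over disjoint families of observations are independent. -/
theorem integral_mul_of_disjoint (q : Measure Y) [IsProbabilityMeasure q] {e e' : Fin m → Fin n}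
    (hd : ∀ i j, e i ≠ e' j) (F G : (Fin m → Y) → ℝ) :
    ∫ y, F (fun i => y (e i)) * G (fun i => y (e' i)) ∂(Measure.pi fun _ : Fin n => q) =
      (∫ y, F (fun i => y (e i)) ∂(Measure.pi fun _ : Fin n => q)) *
        ∫ y, G (fun i => y (e' i)) ∂(Measure.pi fun _ : Fin n => q) := by
  have hdis : Disjoint (Finset.univ.image e) (Finset.univ.image e') := by
    rw [Finset.disjoint_left]
    intro a ha hb
    obtain ⟨i, -, rfl⟩ := Finset.mem_image.1 ha
    obtain ⟨j, -, h⟩ := Finset.mem_image.1 hb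
    exact hd i j h.symm
  have h1 := (iIndepFun_eval (n := n) q).indepFun_finset _ _ hdis fun i => measurable_pi_apply i
  have hF : Measurable fun v : {a // a ∈ Finset.univ.image e} → Y =>
      F fun i => v ⟨e i, Finset.mem_image_of_mem e (Finset.mem_univ i)⟩ := measurable_of_finite _
  have hG : Measurable fun v : {a // a ∈ Finset.univ.image e'} → Y =>
      G fun i => v ⟨e' i, Finset.mem_image_of_mem e' (Finset.mem_univ i)⟩ := measurable_of_finite _
  have h2 : IndepFun (fun y : Fin n → Y => F fun i => y (e i)) (fun y => G fun i => y (e' i))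
      (Measure.pi fun _ : Fin n => q) :=
    h1.comp hF hG
  exact h2.integral_fun_mul_eq_mul_integral (Integrable.of_finite).aestronglyMeasurable
    (Integrable.of_finite).aestronglyMeasurable

open Classical in
/-- The deviation of the indicator of the outcome `z` from its reference probability. -/
noncomputable def outcomeDev (p : Measure Y) (z y : Y) : ℝ := (if y = z then 1 else 0) - p.real {z}

theorem integral_outcomeDev (p q : Measure Y) [IsProbabilityMeasure q] (z : Y) :
    ∫ y, outcomeDev p z y ∂q = q.real {z} - p.real {z} := by
  classical
  have h1 : ∑ y, q.real {y} = 1 := by simp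
  rw [integral_fintype Integrable.of_finite]
  simp only [outcomeDev, smul_eq_mul, mul_sub, Finset.sum_sub_distrib, ← Finset.sum_mul, h1]
  simp

open Classical in
theorem covariance_outcomeDev (p q : Measure Y) [IsProbabilityMeasure q] (z z' : Y) :
    ∫ y, outcomeDev p z y * outcomeDev p z' y ∂q -
        (∫ y, outcomeDev p z y ∂q) * ∫ y, outcomeDev p z' y ∂q =
      (if z = z' then q.real {z} else 0) - q.real {z} * q.real {z'} := by
  have h1 : ∑ y, q.real {y} = 1 := by simp
  have h2 : ∀ y, q.real {y} • (outcomeDev p z y * outcomeDev p z' y) =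
      (if y = z then (if z = z' then q.real {z} else 0) else 0) -
        (if y = z then q.real {z} * p.real {z'} else 0) -
        (if y = z' then q.real {z'} * p.real {z} else 0) +
        q.real {y} * (p.real {z} * p.real {z'}) := fun y => by
    simp only [outcomeDev, smul_eq_mul]
    by_cases h : y = z
    · subst h
      by_cases h' : y = z'
      · subst h'; simp; ring
      · simp [h']; ring
    · by_cases h' : y = z'
      · subst h'; simp [h]; ring
      · simp [h, h']
  rw [integral_outcomeDev, integral_outcomeDev, integral_fintype Integrable.of_finite]
  simp only [h2, Finset.sum_add_distrib, Finset.sum_sub_distrib, ← Finset.sum_mul, h1]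
  simp
  ring

/-- The inner product of the deviations of the counts from their reference values in two families
of observations. -/
noncomputable def devProduct (p : Measure Y) (e e' : Fin m → Fin n) (y : Fin n → Y) : ℝ :=
  ∑ z, (∑ i, outcomeDev p z (y (e i))) * ∑ i, outcomeDev p z (y (e' i))

section Moments

variable (p q : Measure Y) [IsProbabilityMeasure q] {e e' : Fin m → Fin n}
  (he : Function.Injective e) (he' : Function.Injective e') (hd : ∀ i j, e i ≠ e' j)

include hd

theorem integral_devProduct : ∫ y, devProduct p e e' y ∂(Measure.pi fun _ : Fin n => q) =
    m ^ 2 * ∑ z, (q.real {z} - p.real {z}) ^ 2 := by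
  have h1 : ∀ (e : Fin m → Fin n) z, ∫ y, ∑ i, outcomeDev p z (y (e i))
      ∂(Measure.pi fun _ : Fin n => q) = m * (q.real {z} - p.real {z}) := fun e z => by
    rw [integral_finsetSum _ fun i _ => Integrable.of_finite]
    simp only [integral_pi_eval q (outcomeDev p z), integral_outcomeDev]
    simp [mul_sub]
  simp only [devProduct]
  rw [integral_finsetSum _ fun i _ => Integrable.of_finite, Finset.mul_sum]
  refine Finset.sum_congr rfl fun z _ => ?_
  rw [integral_mul_of_disjoint q hd (fun v => ∑ i, outcomeDev p z (v i))
    (fun v => ∑ i, outcomeDev p z (v i)), h1, h1]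
  ring

include he he'

/-- The variance of the statistic, by the Cauchy–Schwarz inequality for the covariance matrix of a
single observation, whose diagonal part dominates. -/
theorem variance_devProduct_le :
    Var[devProduct p e e'; Measure.pi fun _ : Fin n => q] ≤
      2 * m ^ 3 * (√(∑ z, q.real {z} ^ 2) * ∑ z, (q.real {z} - p.real {z}) ^ 2) +
        4 * m ^ 2 * ∑ z, q.real {z} ^ 2 := by
  classical
  set D : Y → ℝ := fun z => q.real {z} - p.real {z} with hD
  set c : Y → Y → ℝ := fun z z' => (if z = z' then q.real {z} else 0) - q.real {z} * q.real {z'}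
    with hc
  set N := ∑ z, q.real {z} ^ 2 with hN
  have hq0 : ∀ z, 0 ≤ q.real {z} := fun z => measureReal_nonneg
  have hq1 : ∀ z, q.real {z} ≤ 1 := fun z => measureReal_le_one
  have hN0 : 0 ≤ N := Finset.sum_nonneg fun z _ => sq_nonneg _
  have hsum1 : ∑ y, q.real {y} = 1 := by simp
  have hmom : ∀ (e : Fin m → Fin n), Function.Injective e → ∀ z z',
      ∫ y, (∑ i, outcomeDev p z (y (e i))) * (∑ i, outcomeDev p z' (y (e i)))
        ∂(Measure.pi fun _ : Fin n => q) = m ^ 2 * (D z * D z') + m * c z z' := fun e he z z' => by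
    rw [integral_sum_mul_sum q he, covariance_outcomeDev, integral_outcomeDev, integral_outcomeDev]
  have hsq : ∫ y, devProduct p e e' y ^ 2 ∂(Measure.pi fun _ : Fin n => q) =
      ∑ z, ∑ z', (m ^ 2 * (D z * D z') + m * c z z') ^ 2 := by
    have h1 : ∀ y : Fin n → Y, devProduct p e e' y ^ 2 = ∑ z, ∑ z',
        ((∑ i, outcomeDev p z (y (e i))) * (∑ i, outcomeDev p z' (y (e i)))) *
        ((∑ i, outcomeDev p z (y (e' i))) * (∑ i, outcomeDev p z' (y (e' i)))) := fun y => by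
      rw [sq, devProduct, Finset.sum_mul_sum]
      exact Finset.sum_congr rfl fun z _ => Finset.sum_congr rfl fun z' _ => by ring
    simp only [h1]
    rw [integral_finsetSum _ fun i _ => Integrable.of_finite]
    refine Finset.sum_congr rfl fun z _ => ?_
    rw [integral_finsetSum _ fun i _ => Integrable.of_finite]
    refine Finset.sum_congr rfl fun z' _ => ?_
    rw [integral_mul_of_disjoint q hd
      (fun v => (∑ i, outcomeDev p z (v i)) * ∑ i, outcomeDev p z' (v i))
      (fun v => (∑ i, outcomeDev p z (v i)) * ∑ i, outcomeDev p z' (v i)), hmom e he, hmom e' he']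
    ring
  have hcross : ∑ z, ∑ z', D z * D z' * c z z' ≤ √N * ∑ z, D z ^ 2 := by
    have h1 : ∑ z, ∑ z', D z * D z' * c z z' =
        ∑ z, q.real {z} * D z ^ 2 - (∑ z, q.real {z} * D z) ^ 2 := by
      rw [sq (∑ z, q.real {z} * D z), Finset.sum_mul_sum, ← Finset.sum_sub_distrib]
      refine Finset.sum_congr rfl fun z _ => ?_
      simp only [hc, mul_sub, Finset.sum_sub_distrib, mul_ite, mul_zero, Finset.sum_ite_eq,
        Finset.mem_univ, if_true]
      congr 1
      · ring
      · exact Finset.sum_congr rfl fun z' _ => by ring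
    rw [h1, Finset.mul_sum]
    refine (sub_le_self _ (sq_nonneg _)).trans (Finset.sum_le_sum fun z _ => ?_)
    refine mul_le_mul_of_nonneg_right ?_ (sq_nonneg _)
    exact le_sqrt_of_sq_le (Finset.single_le_sum (f := fun z => q.real {z} ^ 2)
      (fun z _ => sq_nonneg _) (Finset.mem_univ z))
  have hcc : ∑ z, ∑ z', c z z' ^ 2 ≤ 4 * N := by
    have h1 : ∀ z z', c z z' ^ 2 ≤ 2 * (if z = z' then q.real {z} ^ 2 else 0) +
        2 * (q.real {z} ^ 2 * q.real {z'}) := fun z z' => by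
      have h2 : (q.real {z} * q.real {z'}) ^ 2 ≤ q.real {z} ^ 2 * q.real {z'} := by
        rw [mul_pow]
        gcongr
        nlinarith [hq0 z', hq1 z']
      simp only [hc]
      split_ifs
      · nlinarith [sq_nonneg (q.real {z} + q.real {z} * q.real {z'})]
      · nlinarith
    calc ∑ z, ∑ z', c z z' ^ 2 ≤ ∑ z, ∑ z', (2 * (if z = z' then q.real {z} ^ 2 else 0) +
          2 * (q.real {z} ^ 2 * q.real {z'})) :=
          Finset.sum_le_sum fun z _ => Finset.sum_le_sum fun z' _ => h1 z z'
      _ = 4 * N := by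
          simp only [Finset.sum_add_distrib, ← Finset.mul_sum, hsum1]
          simp
          ring
  rw [variance_eq_sub MemLp.of_discrete, integral_devProduct p q hd]
  have h2 : ∫ y, (devProduct p e e' ^ 2) y ∂(Measure.pi fun _ : Fin n => q) =
      ∑ z, ∑ z', (m ^ 2 * (D z * D z') + m * c z z') ^ 2 := hsq
  rw [h2]
  have h3 : ∑ z, ∑ z', (m ^ 2 * (D z * D z') + m * c z z') ^ 2 =
      (m ^ 2 * ∑ z, D z ^ 2) ^ 2 + 2 * m ^ 3 * (∑ z, ∑ z', D z * D z' * c z z') +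
        m ^ 2 * ∑ z, ∑ z', c z z' ^ 2 := by
    rw [mul_pow, sq (∑ z, D z ^ 2), Finset.sum_mul_sum]
    simp only [Finset.mul_sum, ← Finset.sum_add_distrib]
    exact Finset.sum_congr rfl fun z _ => Finset.sum_congr rfl fun z' _ => by ring
  rw [h3]
  have h4 : 2 * (m : ℝ) ^ 3 * (∑ z, ∑ z', D z * D z' * c z z') ≤
      2 * m ^ 3 * (√N * ∑ z, D z ^ 2) := by gcongr
  have h5 : (m : ℝ) ^ 2 * ∑ z, ∑ z', c z z' ^ 2 ≤ m ^ 2 * (4 * N) := by gcongr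
  linarith

end Moments

/-- Chebyshev's inequality in terms of the real-valued measure. -/
theorem measureReal_le_variance_div_sq {Ω : Type*} [MeasurableSpace Ω] (P : Measure Ω)
    [IsFiniteMeasure P] {T : Ω → ℝ} (hT : MemLp T 2 P) {t : ℝ} (ht : 0 < t) {S : Set Ω}
    (hS : ∀ ω ∈ S, t ≤ |T ω - ∫ ω, T ω ∂P|) : P.real S ≤ Var[T; P] / t ^ 2 := by
  have h1 := meas_ge_le_variance_div_sq hT ht
  refine ENNReal.toReal_le_of_le_ofReal (div_nonneg (variance_nonneg _ _) (sq_nonneg t)) ?_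
  exact (measure_mono hS).trans h1

/-- An `ℓ₂` identity tester exists as soon as the number of samples exceeds a constant times
`‖p‖₂ / γ² + 1 / γ`. -/
theorem exists_isL2IdentityTester (p : Measure Y) [IsProbabilityMeasure p] {γ : ℝ} (hγ : 0 < γ)
    (hn : 2 * m ≤ n) (h1 : 60 ≤ m * γ) (h2 : 60 * √(∑ z, p.real {z} ^ 2) ≤ m * γ ^ 2) :
    ∃ A : RandomisedTest n Y, A.IsL2IdentityTester p γ := by
  set e : Fin m → Fin n := fun i => ⟨i, by omega⟩ with he
  set e' : Fin m → Fin n := fun i => ⟨m + i, by omega⟩ with he'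
  have hei : Function.Injective e := fun i j h => by
    simp only [he, Fin.mk.injEq] at h; exact Fin.ext h
  have hei' : Function.Injective e' := fun i j h => by
    simp only [he', Fin.mk.injEq] at h; exact Fin.ext (by omega)
  have hd : ∀ i j, e i ≠ e' j := fun i j h => by
    simp only [he, he', Fin.mk.injEq] at h; omega
  have hm : (0 : ℝ) < m := by
    rcases Nat.eq_zero_or_pos m with h | h
    · subst h; norm_num at h1
    · exact_mod_cast h
  set N := ∑ z, p.real {z} ^ 2 with hN
  have hN0 : 0 ≤ N := Finset.sum_nonneg fun z _ => sq_nonneg _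
  have hN2 : 3600 * N ≤ (m * γ ^ 2) ^ 2 := by
    have := pow_le_pow_left₀ (by positivity) h2 2
    rw [mul_pow, sq_sqrt hN0] at this
    linarith
  set S : Set (Fin n → Y) := {y | devProduct p e e' y ≤ m ^ 2 * γ ^ 2 / 2} with hS
  have hSm : MeasurableSet S := S.toFinite.measurableSet
  refine ⟨RandomisedTest.ofSet S hSm, ?_, fun q hq hfar => ?_⟩
  · have h0 : ∫ y, devProduct p e e' y ∂(Measure.pi fun _ : Fin n => p) = 0 := by
      rw [integral_devProduct p p hd]; simp
    have hvar := variance_devProduct_le p p hei hei' hd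
    simp only [sub_self, ne_eq, OfNat.ofNat_ne_zero, not_false_eq_true, zero_pow,
      Finset.sum_const_zero, mul_zero, zero_add] at hvar
    have hcheb := measureReal_le_variance_div_sq (Measure.pi fun _ : Fin n => p)
      (T := devProduct p e e') MemLp.of_discrete (t := m ^ 2 * γ ^ 2 / 2) (by positivity) (S := Sᶜ)
      fun y hy => by
        rw [h0, sub_zero]
        rw [hS, Set.mem_compl_iff, Set.mem_ofPred_eq, not_le] at hy
        exact hy.le.trans (le_abs_self _)
    have h3 : Var[devProduct p e e'; Measure.pi fun _ : Fin n => p] / (m ^ 2 * γ ^ 2 / 2) ^ 2 ≤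
        1 / 3 := by
      rw [div_le_iff₀ (by positivity)]
      have h4 : (m : ℝ) ^ 2 * (3600 * N) ≤ m ^ 2 * (m * γ ^ 2) ^ 2 := by gcongr
      have h5 : 1 / 3 * (m ^ 2 * γ ^ 2 / 2) ^ 2 = 1 / 12 * ((m : ℝ) ^ 2 * (m * γ ^ 2) ^ 2) := by
        ring
      rw [h5]
      have h6 : (0 : ℝ) ≤ m ^ 2 * (m * γ ^ 2) ^ 2 := by positivity
      linarith
    rw [probReal_compl_eq_one_sub hSm] at hcheb
    rw [RandomisedTest.ofSet_outputIID]
    linarith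
  · rw [real_false_eq, RandomisedTest.ofSet_outputIID]
    have hmean := integral_devProduct p q hd
    have hvar := variance_devProduct_le p q hei hei' hd
    set D := ∑ z, (q.real {z} - p.real {z}) ^ 2 with hD
    have hD0 : 0 ≤ D := Finset.sum_nonneg fun z _ => sq_nonneg _
    have hγD : γ ^ 2 < D := by
      rw [l2Dist] at hfar
      exact (lt_sqrt hγ.le).1 hfar
    have hDpos : 0 < D := (by positivity : 0 < γ ^ 2).trans hγD
    -- the norm of `q` is controlled by that of `p` and the distance
    have hNq : ∑ z, q.real {z} ^ 2 ≤ (m * D / 30) ^ 2 := by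
      have h3 : ∑ z, q.real {z} ^ 2 ≤ 2 * N + 2 * D := by
        rw [hN, hD, Finset.mul_sum, Finset.mul_sum, ← Finset.sum_add_distrib]
        refine Finset.sum_le_sum fun z _ => ?_
        nlinarith [sq_nonneg (2 * p.real {z} - q.real {z})]
      have h4 : (m * γ ^ 2) ^ 2 ≤ (m * D) ^ 2 := by gcongr
      have h5 : 3600 * D ≤ (m * D) ^ 2 := by
        have h6 : (60 : ℝ) ^ 2 ≤ (m * γ) ^ 2 := pow_le_pow_left₀ (by norm_num) h1 2
        have h7 : (m : ℝ) ^ 2 * γ ^ 2 ≤ m ^ 2 * D := by gcongr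
        have h8 : 3600 ≤ (m : ℝ) ^ 2 * D := by rw [mul_pow] at h6; linarith
        calc 3600 * D ≤ (m : ℝ) ^ 2 * D * D := by gcongr
          _ = (m * D) ^ 2 := by ring
      rw [div_pow]
      linarith
    have hNq' : √(∑ z, q.real {z} ^ 2) ≤ m * D / 30 := sqrt_le_iff.2 ⟨by positivity, hNq⟩
    have hcheb := measureReal_le_variance_div_sq (Measure.pi fun _ : Fin n => q)
      (T := devProduct p e e') MemLp.of_discrete (t := m ^ 2 * D / 2) (by positivity) (S := S)
      fun y hy => by
        rw [hmean, abs_sub_comm]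
        refine le_trans ?_ (le_abs_self _)
        have h3 : devProduct p e e' y ≤ m ^ 2 * γ ^ 2 / 2 := hy
        have h4 : (m : ℝ) ^ 2 * γ ^ 2 ≤ m ^ 2 * D := by gcongr
        linarith
    have h3 : Var[devProduct p e e'; Measure.pi fun _ : Fin n => q] / (m ^ 2 * D / 2) ^ 2 ≤
        1 / 3 := by
      rw [div_le_iff₀ (by positivity)]
      refine hvar.trans ?_
      calc 2 * (m : ℝ) ^ 3 * (√(∑ z, q.real {z} ^ 2) * D) + 4 * m ^ 2 * ∑ z, q.real {z} ^ 2
          ≤ 2 * (m : ℝ) ^ 3 * (m * D / 30 * D) + 4 * m ^ 2 * (m * D / 30) ^ 2 := by gcongr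
        _ = (16 / 225) * ((m : ℝ) ^ 2 * D) ^ 2 := by ring
        _ ≤ 1 / 3 * (m ^ 2 * D / 2) ^ 2 := by
            have : (0 : ℝ) ≤ ((m : ℝ) ^ 2 * D) ^ 2 := by positivity
            rw [div_pow]; linarith
    linarith

end Tester

/-! ### Sylvester's matrices -/

/-- The splitting of the index set of the matrix of order `2 ^ (m + 1)` into two halves. -/
def halves (m : ℕ) : Fin (2 ^ m) ⊕ Fin (2 ^ m) ≃ Fin (2 ^ (m + 1)) :=
  finSumFinEquiv.trans (finCongr (by rw [pow_succ, mul_two]))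

theorem sylvester_halves (m : ℕ) (p q : Fin (2 ^ m) ⊕ Fin (2 ^ m)) :
    sylvester (m + 1) (halves m p) (halves m q) =
      Matrix.fromBlocks (sylvester m) (sylvester m) (sylvester m) (-sylvester m) p q := by
  simp [sylvester, halves, Matrix.reindex_apply]

theorem sylvester_eq_or (m : ℕ) (i j : Fin (2 ^ m)) :
    sylvester m i j = 1 ∨ sylvester m i j = -1 := by
  induction m with
  | zero => left; rfl
  | succ m ih =>
    obtain ⟨p, rfl⟩ := (halves m).surjective i
    obtain ⟨q, rfl⟩ := (halves m).surjective j
    rw [sylvester_halves]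
    rcases p with p | p <;> rcases q with q | q <;> rcases ih p q with h | h <;> simp [h]

theorem exists_sylvester_row_eq_one (m : ℕ) : ∃ i, ∀ j, sylvester m i j = 1 := by
  induction m with
  | zero => exact ⟨0, fun _ => rfl⟩
  | succ m ih =>
    obtain ⟨i, hi⟩ := ih
    refine ⟨halves m (Sum.inl i), fun j => ?_⟩
    obtain ⟨q, rfl⟩ := (halves m).surjective j
    rw [sylvester_halves]
    rcases q with q | q <;> simp [hi]

theorem sum_sylvester_mul_sylvester (m : ℕ) (i j : Fin (2 ^ m)) :
    ∑ c, sylvester m i c * sylvester m j c = if i = j then 2 ^ m else 0 := by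
  induction m with
  | zero =>
    have h : i = j := Fin.ext (by have := i.2; have := j.2; simp only [pow_zero] at *; omega)
    simp [sylvester, h]
  | succ m ih =>
    obtain ⟨p, rfl⟩ := (halves m).surjective i
    obtain ⟨q, rfl⟩ := (halves m).surjective j
    rw [← (halves m).sum_comp]
    simp only [sylvester_halves, Fintype.sum_sum_type, (halves m).injective.eq_iff]
    rcases p with p | p <;> rcases q with q | q <;> by_cases h : p = q <;>
      simp [ih, pow_succ, mul_two, h]

/-- The entries of Sylvester's matrix as real numbers. -/
noncomputable def sylvesterSign (m : ℕ) (i j : Fin (2 ^ m)) : ℝ := ((sylvester m i j : ℤ) : ℝ)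

theorem sum_sylvesterSign_mul_sylvesterSign (m : ℕ) (i j : Fin (2 ^ m)) :
    ∑ c, sylvesterSign m i c * sylvesterSign m j c = if i = j then 2 ^ m else 0 := by
  have := congrArg (fun z : ℤ => (z : ℝ)) (sum_sylvester_mul_sylvester m i j)
  push_cast at this
  exact this

/-! ### The subsets attached to the rows -/

theorem mem_plusSet {a m : ℕ} (r c : Fin a × Fin (2 ^ m)) :
    c ∈ plusSet a m r ↔ r.1 = c.1 ∧ sylvester m r.2 c.2 = 1 := by
  unfold plusSet
  rw [Finset.mem_filter, reducedHadamard]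
  by_cases h : r.1 = c.1
  · rw [if_pos h]
    exact ⟨fun h' => ⟨h, h'.2⟩, fun h' => ⟨Finset.mem_univ _, h'.2⟩⟩
  · rw [if_neg h]
    exact ⟨fun h' => by simp at h', fun h' => absurd h'.1 h⟩

theorem indicator_plusSet {a m : ℕ} (r c : Fin a × Fin (2 ^ m)) :
    (if c ∈ plusSet a m r then 1 else 0 : ℝ) =
      if r.1 = c.1 then (1 + sylvesterSign m r.2 c.2) / 2 else 0 := by
  simp only [mem_plusSet]
  by_cases h : r.1 = c.1
  · rcases sylvester_eq_or m r.2 c.2 with h' | h' <;> simp [h, h', sylvesterSign]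
  · simp [h]

theorem card_plusSet_eq {a m : ℕ} (r : Fin a × Fin (2 ^ m)) :
    ((plusSet a m r).card : ℝ) = (2 ^ m + ∑ c, sylvesterSign m r.2 c) / 2 := by
  have h1 : ((plusSet a m r).card : ℝ) = ∑ c, if c ∈ plusSet a m r then 1 else 0 := by simp
  rw [h1]
  simp only [indicator_plusSet, Fintype.sum_prod_type]
  rw [Finset.sum_eq_single r.1]
  · simp only [if_true, ← Finset.sum_div, Finset.sum_add_distrib]
    simp
  · intro i _ hi
    simp [Ne.symm hi]
  · simp

section Assignment

variable {k : ℕ} {ε : ℝ}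

theorem blockSize_eq (hB : logB k ε ≠ 0) : (2 : ℝ) ^ logB k ε = 2 * subsetSize k ε := by
  rw [subsetSize, blockSize, Nat.cast_div (dvd_pow_self 2 hB) (by norm_num)]
  push_cast; ring

theorem RowAssignment.sum_sylvesterSign_eq_zero (r : RowAssignment k ε) (hB : logB k ε ≠ 0)
    (x : Fin k) : ∑ c, sylvesterSign (logB k ε) (r.row x).2 c = 0 := by
  have h1 := card_plusSet_eq (r.row x)
  rw [r.card_plusSet x, blockSize_eq hB] at h1
  linarith

/-- The incidence matrix of the subsets is bounded below in `ℓ₂`. In each block, the indicator of a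
subset is half the sum of the constant vector and a row of Sylvester's matrix; these rows are
mutually orthogonal, and orthogonal to the constant vector. -/
theorem RowAssignment.le_sum_sq_indicator (r : RowAssignment k ε) (hB : logB k ε ≠ 0)
    (w : Fin k → ℝ) :
    subsetSize k ε / 2 * ∑ x, w x ^ 2 ≤ ∑ y, (∑ x, w x *
      if y ∈ plusSet (blockCount k ε) (logB k ε) (r.row x) then 1 else 0) ^ 2 := by
  set S := sylvesterSign (logB k ε) with hS
  rw [Fintype.sum_prod_type]
  have hblock : ∀ i : Fin (blockCount k ε),
      subsetSize k ε / 2 * ∑ x, (if (r.row x).1 = i then w x else 0) ^ 2 ≤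
        ∑ c, (∑ x, w x * if (i, c) ∈ plusSet (blockCount k ε) (logB k ε) (r.row x)
          then 1 else 0) ^ 2 := fun i => by
    set v : Fin k → ℝ := fun x => if (r.row x).1 = i then w x else 0 with hv
    have h1 : ∀ c, ∑ x, w x * (if (i, c) ∈ plusSet (blockCount k ε) (logB k ε) (r.row x)
        then 1 else 0) = (∑ x, v x + ∑ x, v x * S (r.row x).2 c) / 2 := fun c => by
      rw [← Finset.sum_add_distrib, Finset.sum_div]
      refine Finset.sum_congr rfl fun x _ => ?_
      rw [indicator_plusSet]
      simp only [hv]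
      split_ifs <;> ring
    have h2 : ∑ c, ∑ x, v x * S (r.row x).2 c = 0 := by
      rw [Finset.sum_comm]
      refine Finset.sum_eq_zero fun x _ => ?_
      rw [← Finset.mul_sum, r.sum_sylvesterSign_eq_zero hB x, mul_zero]
    have h3 : ∑ c, (∑ x, v x * S (r.row x).2 c) ^ 2 = 2 * subsetSize k ε * ∑ x, v x ^ 2 := by
      have h4 : ∀ c, (∑ x, v x * S (r.row x).2 c) ^ 2 =
          ∑ x, ∑ x', v x * v x' * (S (r.row x).2 c * S (r.row x').2 c) := fun c => by
        rw [sq, Finset.sum_mul_sum]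
        exact Finset.sum_congr rfl fun x _ => Finset.sum_congr rfl fun x' _ => by ring
      simp only [h4]
      rw [Finset.sum_comm, Finset.mul_sum]
      refine Finset.sum_congr rfl fun x _ => ?_
      rw [Finset.sum_comm]
      simp only [← Finset.mul_sum, hS, sum_sylvesterSign_mul_sylvesterSign]
      rw [Finset.sum_eq_single x]
      · rw [if_pos rfl, blockSize_eq hB]; ring
      · intro x' _ hx'
        -- distinct inputs in one block have distinct rows of Sylvester's matrix
        by_cases h5 : (r.row x).1 = i ∧ (r.row x').1 = i
        · have h6 : (r.row x).2 ≠ (r.row x').2 := fun h =>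
            hx' (r.injective (Prod.ext (h5.1.trans h5.2.symm) h)).symm
          rw [if_neg h6, mul_zero]
        · have h6 : v x * v x' = 0 := by
            simp only [hv]
            rcases not_and_or.1 h5 with h | h <;> simp [h]
          rw [h6, zero_mul]
      · simp
    simp only [h1]
    have h5 : ∀ c, ((∑ x, v x + ∑ x, v x * S (r.row x).2 c) / 2) ^ 2 =
        (∑ x, v x) ^ 2 / 4 + (∑ x, v x) / 2 * (∑ x, v x * S (r.row x).2 c) +
          (∑ x, v x * S (r.row x).2 c) ^ 2 / 4 := fun c => by ring
    simp only [h5, Finset.sum_add_distrib, ← Finset.mul_sum, ← Finset.sum_div]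
    rw [h2, h3]
    have h6 : 0 ≤ ∑ _c : Fin (2 ^ logB k ε), (∑ x, v x) ^ 2 :=
      Finset.sum_nonneg fun _ _ => sq_nonneg _
    linarith
  refine le_trans (le_of_eq ?_) (Finset.sum_le_sum fun i _ => hblock i)
  rw [← Finset.mul_sum, Finset.sum_comm]
  congr 1
  refine Finset.sum_congr rfl fun x _ => ?_
  simp

/-! ### The law of the response -/

theorem ghrRandomiser_real (r : RowAssignment k ε) (x : Fin k) (y : Message k ε) :
    ((ghrRandomiser r).kernel x).real {y} =
      responseProb ε (plusSet (blockCount k ε) (logB k ε) (r.row x)) y := by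
  change ((responsePMF ε (plusSet (blockCount k ε) (logB k ε) (r.row x))).toMeasure).real {y} = _
  rw [Measure.real, PMF.toMeasure_apply_singleton _ _ (measurableSet_singleton y), responsePMF,
    PMF.ofFintype_apply, ENNReal.toReal_ofReal (responseProb_nonneg _ _ _)]

theorem inducedLaw_real (r : RowAssignment k ε) (p : Measure (Fin k)) [IsProbabilityMeasure p]
    (y : Message k ε) : (inducedLaw r p).real {y} =
      ∑ x, p.real {x} * responseProb ε (plusSet (blockCount k ε) (logB k ε) (r.row x)) y := by
  rw [Measure.real, inducedLaw, Measure.bind_fin_apply _ _ (measurableSet_singleton y),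
    ENNReal.toReal_sum fun x _ => ENNReal.mul_ne_top (measure_ne_top _ _) (measure_ne_top _ _)]
  refine Finset.sum_congr rfl fun x _ => ?_
  rw [ENNReal.toReal_mul, mul_comm]
  congr 1
  exact ghrRandomiser_real r x y

theorem responseProb_row (r : RowAssignment k ε) (hB : logB k ε ≠ 0) (x : Fin k) (y : Message k ε) :
    responseProb ε (plusSet (blockCount k ε) (logB k ε) (r.row x)) y =
      ((exp ε - 1) * (if y ∈ plusSet (blockCount k ε) (logB k ε) (r.row x) then 1 else 0) + 1) /
        (subsetSize k ε * (exp ε + 2 * blockCount k ε - 1)) := by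
  rw [responseProb, r.card_plusSet x]
  congr 1
  rw [Fintype.card_prod, Fintype.card_fin, Fintype.card_fin]
  push_cast
  rw [blockSize_eq hB]
  ring

/-- The randomiser is private: all its probabilities lie between `1 / D` and `e^ε / D`. -/
theorem ghrRandomiser_isPrivate (r : RowAssignment k ε) (hB : logB k ε ≠ 0) (hε : 0 < ε) :
    (ghrRandomiser r).IsPrivate ε := by
  intro x x' S hS
  have hE : 1 < exp ε := one_lt_exp_iff.2 hε
  have hsingle : ∀ y : Message k ε, (ghrRandomiser r).kernel x {y} ≤
      ENNReal.ofReal (exp ε) * (ghrRandomiser r).kernel x' {y} := fun y => by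
    have h1 := ghrRandomiser_real r x y
    have h2 := ghrRandomiser_real r x' y
    rw [← ENNReal.ofReal_toReal (measure_ne_top ((ghrRandomiser r).kernel x) {y}),
      ← ENNReal.ofReal_toReal (measure_ne_top ((ghrRandomiser r).kernel x') {y}),
      ← ENNReal.ofReal_mul (exp_pos ε).le]
    refine ENNReal.ofReal_le_ofReal ?_
    change ((ghrRandomiser r).kernel x).real {y} ≤ exp ε * ((ghrRandomiser r).kernel x').real {y}
    rw [h1, h2, responseProb_row r hB, responseProb_row r hB, ← mul_div_assoc]
    have h3 : (0 : ℝ) ≤ subsetSize k ε * (exp ε + 2 * blockCount k ε - 1) :=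
      mul_nonneg (Nat.cast_nonneg _)
        (by linarith [(Nat.cast_nonneg (blockCount k ε) : (0 : ℝ) ≤ blockCount k ε)])
    refine div_le_div_of_nonneg_right ?_ h3
    split_ifs <;> nlinarith
  have hsum : ∀ x, (ghrRandomiser r).kernel x S =
      ∑ y ∈ S.toFinite.toFinset, (ghrRandomiser r).kernel x {y} := fun x => by
    rw [sum_measure_singleton, Set.Finite.coe_toFinset]
  rw [hsum, hsum, Finset.mul_sum]
  exact Finset.sum_le_sum fun y _ => hsingle y

theorem ghrProtocol_outputIID {n : ℕ} (r : RowAssignment k ε)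
    (A : RandomisedTest n (Message k ε)) (p : Measure (Fin k)) [IsProbabilityMeasure p] :
    (ghrProtocol r A).outputIID p = A.outputIID (inducedLaw r p) := by
  rw [Protocol.outputIID_eq]; rfl

/-- Laws far from uniform in total variation induce laws of the message that are far in `ℓ₂`:
the response is bounded below by `RowAssignment.le_sum_sq_indicator`, and `‖·‖₁ ≤ √k ‖·‖₂`. -/
theorem l2Radius_lt_l2Dist [NeZero k] (r : RowAssignment k ε) (hB : logB k ε ≠ 0) (hε : 0 < ε)
    {α : ℝ} (hα : 0 < α) (p : Measure (Fin k)) [IsProbabilityMeasure p] (hp : α < tv p (unif k)) :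
    l2Radius k ε α < l2Dist (inducedLaw r p) (inducedLaw r (unif k)) := by
  have hk : (0 : ℝ) < k := by exact_mod_cast NeZero.pos k
  have hE : 1 < exp ε := one_lt_exp_iff.2 hε
  have hs : (0 : ℝ) < subsetSize k ε := by
    have h1 := blockSize_eq hB
    have h2 : (0 : ℝ) < 2 ^ logB k ε := by positivity
    linarith
  have ha : (0 : ℝ) ≤ blockCount k ε := Nat.cast_nonneg _
  set a : ℝ := (blockCount k ε : ℝ) with ha'
  set s : ℝ := (subsetSize k ε : ℝ) with hs'
  set w : Fin k → ℝ := fun x => p.real {x} - (unif k).real {x} with hw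
  have hD : 0 < exp ε + 2 * a - 1 := by linarith
  have hw0 : ∑ x, w x = 0 := by
    simp only [hw, Finset.sum_sub_distrib]
    simp
  have hdiff : ∀ y, (inducedLaw r p).real {y} - (inducedLaw r (unif k)).real {y} =
      (exp ε - 1) / (s * (exp ε + 2 * a - 1)) * ∑ x, w x *
        if y ∈ plusSet (blockCount k ε) (logB k ε) (r.row x) then 1 else 0 := fun y => by
    rw [inducedLaw_real, inducedLaw_real, ← Finset.sum_sub_distrib, Finset.mul_sum]
    have h1 : ∀ x, p.real {x} * responseProb ε (plusSet (blockCount k ε) (logB k ε) (r.row x)) y -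
        (unif k).real {x} * responseProb ε (plusSet (blockCount k ε) (logB k ε) (r.row x)) y =
        (exp ε - 1) / (s * (exp ε + 2 * a - 1)) * (w x *
          if y ∈ plusSet (blockCount k ε) (logB k ε) (r.row x) then 1 else 0) +
          w x * (1 / (s * (exp ε + 2 * a - 1))) := fun x => by
      rw [responseProb_row r hB]; simp only [hw]; ring
    simp only [h1, Finset.sum_add_distrib, ← Finset.sum_mul, hw0, zero_mul, add_zero]
  have hgram := r.le_sum_sq_indicator hB w
  have hnorm : 4 * α ^ 2 < k * ∑ x, w x ^ 2 := by
    have h1 : (2 * α) ^ 2 < (∑ x, |w x|) ^ 2 := by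
      apply pow_lt_pow_left₀ _ (by positivity) two_ne_zero
      rw [tv] at hp; linarith
    have h2 := sq_sum_le_card_mul_sum_sq (s := Finset.univ) (f := fun x => |w x|)
    simp only [sq_abs, Finset.card_univ, Fintype.card_fin] at h2
    linarith
  rw [l2Radius, l2Dist]
  refine sqrt_lt_sqrt (by positivity) ?_
  simp only [hdiff, mul_pow, ← Finset.mul_sum]
  have hb : (blockCount k ε * blockSize k ε : ℝ) / subsetSize k ε = 2 * a := by
    rw [blockSize]; push_cast; rw [blockSize_eq hB, ← ha', ← hs']; field_simp
  rw [hb]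
  calc 2 * α ^ 2 / (s * k) * ((exp ε - 1) / (exp ε + 2 * a - 1)) ^ 2
      = ((exp ε - 1) / (s * (exp ε + 2 * a - 1))) ^ 2 * (s / 2 * (4 * α ^ 2 / k)) := by
        field_simp; ring
    _ < ((exp ε - 1) / (s * (exp ε + 2 * a - 1))) ^ 2 * (s / 2 * ∑ x, w x ^ 2) := by
        have h0 : 0 < exp ε - 1 := by linarith
        have h1 : 4 * α ^ 2 / k < ∑ x, w x ^ 2 := by
          rw [div_lt_iff₀ hk]; linarith
        gcongr
    _ ≤ _ := by gcongr

end Assignment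

/-! ### The parameters of the response -/

section Parameters

variable {k : ℕ} {ε : ℝ}

theorem two_pow_floor_logb_le {x : ℝ} (hx : 1 ≤ x) : (2 : ℝ) ^ ⌊logb 2 x⌋₊ ≤ x := by
  rw [← rpow_natCast, ← le_logb_iff_rpow_le one_lt_two (by linarith)]
  exact Nat.floor_le (logb_nonneg one_lt_two hx)

theorem lt_two_pow_floor_logb {x : ℝ} (hx : 1 ≤ x) : x < 2 * 2 ^ ⌊logb 2 x⌋₊ := by
  rw [← pow_succ', ← rpow_natCast, ← logb_lt_iff_lt_rpow one_lt_two (by linarith)]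
  push_cast
  exact Nat.lt_floor_add_one _

theorem le_two_pow_ceil_logb {x : ℝ} (hx : 1 ≤ x) : x ≤ 2 ^ ⌈logb 2 x⌉₊ := by
  rw [← rpow_natCast, ← logb_le_iff_le_rpow one_lt_two (by linarith)]
  exact Nat.le_ceil _

theorem two_pow_ceil_logb_lt {x : ℝ} (hx : 1 ≤ x) : (2 : ℝ) ^ ⌈logb 2 x⌉₊ < 2 * x := by
  rw [← rpow_natCast, ← lt_logb_iff_rpow_lt one_lt_two (by linarith),
    logb_mul two_ne_zero (by linarith), logb_self_eq_one one_lt_two, add_comm]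
  exact Nat.ceil_lt_add_one (logb_nonneg one_lt_two hx)

theorem one_le_min_exp (hk : 2 ≤ k) (hε : 0 < ε) : 1 ≤ min (exp ε) (2 * k) := by
  have : (2 : ℝ) ≤ k := by exact_mod_cast hk
  exact le_min (one_le_exp hε.le) (by linarith)

theorem blockCount_pos : (0 : ℝ) < blockCount k ε := by
  rw [blockCount]; positivity

theorem blockCount_le (hk : 2 ≤ k) (hε : 0 < ε) : (blockCount k ε : ℝ) ≤ min (exp ε) (2 * k) := by
  rw [blockCount, logA]
  push_cast
  exact two_pow_floor_logb_le (one_le_min_exp hk hε)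

theorem lt_two_mul_blockCount (hk : 2 ≤ k) (hε : 0 < ε) :
    min (exp ε) (2 * k) < 2 * (blockCount k ε : ℝ) := by
  rw [blockCount, logA]
  push_cast
  exact lt_two_pow_floor_logb (one_le_min_exp hk hε)

theorem one_lt_div_blockCount_add_one (hk : 2 ≤ k) : 1 < (k : ℝ) / blockCount k ε + 1 := by
  have : (2 : ℝ) ≤ k := by exact_mod_cast hk
  have := div_pos (by linarith : (0 : ℝ) < k) (blockCount_pos (k := k) (ε := ε))
  linarith

theorem logB_ne_zero (hk : 2 ≤ k) : logB k ε ≠ 0 := by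
  rw [logB]
  exact (Nat.ceil_pos.2 (logb_pos one_lt_two (one_lt_div_blockCount_add_one hk))).ne'

theorem le_two_pow_logB (hk : 2 ≤ k) : (k : ℝ) / blockCount k ε + 1 ≤ 2 ^ logB k ε := by
  rw [logB]
  exact le_two_pow_ceil_logb (one_lt_div_blockCount_add_one hk).le

theorem two_pow_logB_lt (hk : 2 ≤ k) : (2 : ℝ) ^ logB k ε < 2 * (k / blockCount k ε + 1) := by
  rw [logB]
  exact two_pow_ceil_logb_lt (one_lt_div_blockCount_add_one hk).le

theorem le_blockCount_mul (hk : 2 ≤ k) : k ≤ blockCount k ε * (2 ^ logB k ε - 1) := by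
  have h1 := le_two_pow_logB (ε := ε) hk
  have h2 := blockCount_pos (k := k) (ε := ε)
  have h3 : (k : ℝ) ≤ blockCount k ε * (2 ^ logB k ε - 1) := by
    rw [mul_comm, ← div_le_iff₀ h2]; linarith
  have h4 : ((2 ^ logB k ε - 1 : ℕ) : ℝ) = 2 ^ logB k ε - 1 := by
    rw [Nat.cast_sub Nat.one_le_two_pow]; push_cast; ring
  rw [← h4] at h3
  exact_mod_cast h3

/-- Each of the rows that avoid the constant row of Sylvester's matrix is balanced within its
block, since it is orthogonal to the constant row. -/
theorem nonempty_rowAssignment (hk : 2 ≤ k) : Nonempty (RowAssignment k ε) := by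
  obtain ⟨i₀, hi₀⟩ := exists_sylvester_row_eq_one (logB k ε)
  have hcard : Fintype.card (Fin k) ≤
      Fintype.card (Fin (blockCount k ε) × {j : Fin (2 ^ logB k ε) // j ≠ i₀}) := by
    rw [Fintype.card_prod, Fintype.card_fin, Fintype.card_fin, Fintype.card_subtype_compl,
      Fintype.card_fin, Fintype.card_subtype_eq]
    exact le_blockCount_mul hk
  obtain ⟨e⟩ := Function.Embedding.nonempty_of_card_le hcard
  refine ⟨⟨fun x => ((e x).1, (e x).2.1), fun x x' h => ?_, fun x => ?_⟩⟩
  · obtain ⟨h1, h2⟩ := Prod.mk.inj h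
    exact e.injective (Prod.ext h1 (Subtype.ext h2))
  · have h1 := sum_sylvesterSign_mul_sylvesterSign (logB k ε) (e x).2.1 i₀
    rw [if_neg (e x).2.2] at h1
    have h2 : ∀ c, sylvesterSign (logB k ε) i₀ c = 1 := fun c => by
      rw [sylvesterSign, hi₀ c, Int.cast_one]
    simp only [h2, mul_one] at h1
    have h3 := card_plusSet_eq (a := blockCount k ε) ((e x).1, (e x).2.1)
    rw [h1, add_zero, blockSize_eq (logB_ne_zero hk), mul_div_cancel_left₀ _ two_ne_zero] at h3
    exact_mod_cast h3

theorem clog_card_message_le (hk : 2 ≤ k) (hε : 0 < ε) :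
    ((Nat.clog 2 (Fintype.card (Message k ε)) : ℕ) : ℝ) ≤ logb 2 k + 4 := by
  have hk' : (2 : ℝ) ≤ k := by exact_mod_cast hk
  have ha := blockCount_pos (k := k) (ε := ε)
  have hcard : Fintype.card (Message k ε) = 2 ^ (logA k ε + logB k ε) := by
    rw [Fintype.card_prod, Fintype.card_fin, Fintype.card_fin, blockCount, pow_add]
  have h1 : (2 : ℝ) ^ (logA k ε + logB k ε) ≤ 2 ^ (4 : ℝ) * k := by
    have h2 := (two_pow_logB_lt (ε := ε) hk).le
    have h3 := (blockCount_le hk hε).trans (min_le_right _ _)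
    have h4 : (2 : ℝ) ^ logA k ε = blockCount k ε := by rw [blockCount]; push_cast; rfl
    rw [pow_add, h4]
    calc (blockCount k ε : ℝ) * 2 ^ logB k ε
        ≤ blockCount k ε * (2 * (k / blockCount k ε + 1)) := by gcongr
      _ = 2 * (k + blockCount k ε) := by field_simp
      _ ≤ 2 ^ (4 : ℝ) * k := by norm_num; linarith
  rw [hcard, Nat.clog_pow 2 _ one_lt_two]
  have h5 : logb 2 ((2 : ℝ) ^ (4 : ℝ) * k) = logb 2 k + 4 := by
    rw [logb_mul (by positivity) (by positivity), logb_rpow two_pos (by norm_num), add_comm]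
  rw [← h5, le_logb_iff_rpow_le one_lt_two (by positivity), rpow_natCast]
  exact h1

/-- No message is much more likely than the average one on uniform inputs, since at most
`2 ^ logB k ε` inputs have a subset that meets a given block. -/
theorem inducedLaw_unif_real_le [NeZero k] (hk : 2 ≤ k) (hε : 0 < ε) (r : RowAssignment k ε)
    (y : Message k ε) : (inducedLaw r (unif k)).real {y} ≤ 3 / k := by
  have hk' : (2 : ℝ) ≤ k := by exact_mod_cast hk
  have hB := logB_ne_zero (ε := ε) hk
  have ha := blockCount_pos (k := k) (ε := ε)
  have hE : 1 < exp ε := one_lt_exp_iff.2 hε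
  have hs : (k : ℝ) ≤ 2 * blockCount k ε * subsetSize k ε := by
    have h1 := le_two_pow_logB (ε := ε) hk
    rw [blockSize_eq hB] at h1
    have h2 : (k : ℝ) / blockCount k ε ≤ 2 * subsetSize k ε := by linarith
    rw [div_le_iff₀ ha] at h2
    linarith
  have hs0 : (0 : ℝ) < subsetSize k ε := by
    rcases (Nat.cast_nonneg (α := ℝ) (subsetSize k ε)).eq_or_lt with h | h
    · rw [← h] at hs; linarith
    · exact h
  have hcount : ∑ x, (if y ∈ plusSet (blockCount k ε) (logB k ε) (r.row x) then 1 else 0 : ℝ) ≤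
      2 * subsetSize k ε := by
    rw [← blockSize_eq hB, Finset.sum_boole]
    have h1 : (Finset.univ.filter fun x =>
        y ∈ plusSet (blockCount k ε) (logB k ε) (r.row x)).card ≤
        (Finset.univ : Finset (Fin (2 ^ logB k ε))).card := by
      refine Finset.card_le_card_of_injOn (fun x => (r.row x).2) (fun _ _ => Finset.mem_univ _) ?_
      intro x hx x' hx' h
      have h2 := ((mem_plusSet _ _).1 (Finset.mem_filter.1 hx).2).1
      have h3 := ((mem_plusSet _ _).1 (Finset.mem_filter.1 hx').2).1
      exact r.injective (Prod.ext (h2.trans h3.symm) h)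
    rw [Finset.card_univ, Fintype.card_fin] at h1
    exact_mod_cast h1
  have hD : 0 < (subsetSize k ε : ℝ) * (exp ε + 2 * blockCount k ε - 1) :=
    mul_pos hs0 (by linarith)
  rw [inducedLaw_real]
  have hunif : ∀ x, (unif k).real {x} = (k : ℝ)⁻¹ := fun x => by
    rw [Measure.real, unif_singleton, ENNReal.toReal_inv, ENNReal.toReal_natCast]
  simp only [responseProb_row r hB, hunif]
  rw [← Finset.mul_sum, ← Finset.sum_div, Finset.sum_add_distrib, ← Finset.mul_sum,
    Finset.sum_const, Finset.card_univ, Fintype.card_fin, nsmul_eq_mul, mul_one, inv_mul_eq_div]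
  refine div_le_div_of_nonneg_right ?_ (by linarith)
  rw [div_le_iff₀ hD]
  have h1 := mul_le_mul_of_nonneg_left hcount (by linarith : 0 ≤ exp ε - 1)
  have h2 : 0 ≤ (exp ε - 1) * subsetSize k ε := mul_nonneg (by linarith) hs0.le
  have h3 : 0 < (blockCount k ε : ℝ) * subsetSize k ε := mul_pos ha hs0
  linarith

theorem sqrt_sum_sq_le_of_le {Y : Type*} [Fintype Y] [MeasurableSpace Y]
    [MeasurableSingletonClass Y] (p : Measure Y) [IsProbabilityMeasure p] {c : ℝ}
    (hc : ∀ y, p.real {y} ≤ c) : √(∑ y, p.real {y} ^ 2) ≤ √c := by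
  refine sqrt_le_sqrt ?_
  have h1 : ∑ y, p.real {y} = 1 := by simp
  calc ∑ y, p.real {y} ^ 2 ≤ ∑ y, c * p.real {y} := by
        refine Finset.sum_le_sum fun y _ => ?_
        rw [sq]
        exact mul_le_mul_of_nonneg_right (hc y) measureReal_nonneg
    _ = c := by rw [← Finset.mul_sum, h1, mul_one]

theorem subsetSize_pos (hk : 2 ≤ k) : (0 : ℝ) < subsetSize k ε := by
  have h1 := blockSize_eq (logB_ne_zero (ε := ε) hk)
  have h2 : (0 : ℝ) < 2 ^ logB k ε := by positivity
  linarith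

theorem subsetSize_le (hk : 2 ≤ k) (hε : 0 < ε) :
    (subsetSize k ε : ℝ) ≤ 2 * k / exp ε + 2 := by
  have hk' : (2 : ℝ) ≤ k := by exact_mod_cast hk
  have h1 := two_pow_logB_lt (ε := ε) hk
  rw [blockSize_eq (logB_ne_zero hk)] at h1
  have ha := blockCount_pos (k := k) (ε := ε)
  have h2 : (k : ℝ) / blockCount k ε ≤ 2 * k / exp ε + 1 := by
    have h3 := lt_two_mul_blockCount hk hε
    rcases min_lt_iff.1 h3 with h | h
    · have : (k : ℝ) / blockCount k ε ≤ 2 * k / exp ε := by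
        rw [div_le_div_iff₀ ha (exp_pos ε)]
        nlinarith
      linarith
    · have h4 : (k : ℝ) / blockCount k ε ≤ 1 := by rw [div_le_one ha]; linarith
      have h5 : 0 ≤ 2 * k / exp ε := by positivity
      linarith
  linarith

theorem l2Radius_sq (hk : 2 ≤ k) (α : ℝ) : l2Radius k ε α ^ 2 =
    2 * α ^ 2 / (subsetSize k ε * k) *
      ((exp ε - 1) / (exp ε + 2 * blockCount k ε - 1)) ^ 2 := by
  have hb : (blockCount k ε * blockSize k ε : ℝ) / subsetSize k ε = 2 * blockCount k ε := by
    have := subsetSize_pos (ε := ε) hk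
    rw [blockSize]; push_cast; rw [blockSize_eq (logB_ne_zero hk)]; field_simp
  rw [l2Radius, sq_sqrt (by positivity), hb]

theorem rpow_three_halves (k : ℕ) : (k : ℝ) ^ (3 / 2 : ℝ) = k * √k := by
  rcases Nat.eq_zero_or_pos k with rfl | hk
  · norm_num
  · rw [sqrt_eq_rpow, ← rpow_one_add' (Nat.cast_nonneg k) (by norm_num)]
    norm_num

/-- The three terms of the rate come from `s ≤ 2k / e^ε + 2` and
`e^{2ε} ≤ 2 + 2 (e^ε - 1)²`. -/
theorem subsetSize_mul_le_rate (hk : 2 ≤ k) (hε : 0 < ε) {α : ℝ} (hα : 0 < α) :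
    subsetSize k ε * √k * exp ε ^ 2 ≤ 8 * rate k ε α * (α ^ 2 * (exp ε - 1) ^ 2) := by
  have hk' : (2 : ℝ) ≤ k := by exact_mod_cast hk
  have hd : 0 < exp ε - 1 := by linarith [one_lt_exp_iff.2 hε]
  have hrate : rate k ε α * (α ^ 2 * (exp ε - 1) ^ 2) =
      k * √k + k * √k / exp ε * (exp ε - 1) ^ 2 + √k * (exp ε - 1) ^ 2 := by
    rw [rate, rpow_three_halves]
    field_simp
  rw [mul_assoc 8, hrate]
  have hq : 0 < √(k : ℝ) := sqrt_pos.2 (by linarith)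
  have h1 : exp ε ^ 2 ≤ 2 + 2 * (exp ε - 1) ^ 2 := by nlinarith [sq_nonneg (exp ε - 2)]
  have h2 : k * √k / exp ε ≤ k * √k := div_le_self (by positivity) (by linarith)
  have h3 : √k ≤ k * √k := le_mul_of_one_le_left hq.le (by linarith)
  have h4 : 0 ≤ k * √k / exp ε * (exp ε - 1) ^ 2 := by positivity
  have h5 : 0 ≤ √k * (exp ε - 1) ^ 2 := by positivity
  calc subsetSize k ε * √k * exp ε ^ 2
      ≤ (2 * k / exp ε + 2) * √k * (2 + 2 * (exp ε - 1) ^ 2) := by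
        gcongr
        exact subsetSize_le hk hε
    _ = 4 * (k * √k / exp ε) + 4 * √k + 4 * (k * √k / exp ε * (exp ε - 1) ^ 2)
        + 4 * (√k * (exp ε - 1) ^ 2) := by ring
    _ ≤ _ := by linarith

theorem one_le_rate (hk : 2 ≤ k) {α : ℝ} (hα : 0 < α) (hα1 : α ≤ 1) :
    1 ≤ rate k ε α := by
  have hk' : (2 : ℝ) ≤ k := by exact_mod_cast hk
  have h1 : 1 ≤ √(k : ℝ) / α ^ 2 := by
    rw [one_le_div (by positivity)]
    have h2 : 1 ≤ √(k : ℝ) := one_le_sqrt.2 (by linarith)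
    nlinarith
  rw [rate]
  have h3 : 0 ≤ (k : ℝ) ^ (3 / 2 : ℝ) / (α ^ 2 * (exp ε - 1) ^ 2) := by positivity
  have h4 : 0 ≤ (k : ℝ) ^ (3 / 2 : ℝ) / (α ^ 2 * exp ε) := by positivity
  linarith

/-- With `m` of the order of the rate, `m γ²` exceeds the `ℓ₂` norm of the reference law, since
`e^ε + 2a - 1 ≤ 3 e^ε`. -/
theorem le_mul_l2Radius_sq (hk : 2 ≤ k) (hε : 0 < ε) {α : ℝ} (hα : 0 < α) {m : ℝ}
    (hm : 4320 * rate k ε α ≤ m) : 120 / √k ≤ m * l2Radius k ε α ^ 2 := by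
  have hk' : (2 : ℝ) ≤ k := by exact_mod_cast hk
  have hE := one_lt_exp_iff.2 hε
  have hd : 0 < exp ε - 1 := by linarith
  have ha := blockCount_pos (k := k) (ε := ε)
  have haE : (blockCount k ε : ℝ) ≤ exp ε := (blockCount_le hk hε).trans (min_le_left _ _)
  have hs := subsetSize_pos (ε := ε) hk
  have hq : 0 < √(k : ℝ) := sqrt_pos.2 (by linarith)
  have hrate := subsetSize_mul_le_rate hk hε hα
  have hγ : 2 * α ^ 2 / (subsetSize k ε * k) * ((exp ε - 1) / (3 * exp ε)) ^ 2 ≤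
      l2Radius k ε α ^ 2 := by
    rw [l2Radius_sq hk]
    gcongr
    · linarith
    · linarith
  have hq2 : √(k : ℝ) * √k = k := mul_self_sqrt (by linarith)
  calc 120 / √k = 120 * (subsetSize k ε * √k * exp ε ^ 2) /
        (subsetSize k ε * (√k * √k) * exp ε ^ 2) := by field_simp
    _ ≤ 120 * (8 * rate k ε α * (α ^ 2 * (exp ε - 1) ^ 2)) /
        (subsetSize k ε * (√k * √k) * exp ε ^ 2) := by gcongr
    _ = 4320 * rate k ε α * (2 * α ^ 2 / (subsetSize k ε * k) *
        ((exp ε - 1) / (3 * exp ε)) ^ 2) := by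
        rw [hq2]; field_simp; ring
    _ ≤ m * l2Radius k ε α ^ 2 := by
        have h0 : 0 ≤ m := le_trans (mul_nonneg (by norm_num) (rate_nonneg k ε α)) hm
        gcongr

theorem l2Radius_le (hk : 2 ≤ k) (hε : 0 < ε) {α : ℝ} (hα : 0 < α) (hα1 : α ≤ 1) :
    l2Radius k ε α ≤ 2 / √k := by
  have hk' : (2 : ℝ) ≤ k := by exact_mod_cast hk
  have hE := one_lt_exp_iff.2 hε
  have ha := blockCount_pos (k := k) (ε := ε)
  have hs : (1 : ℝ) ≤ subsetSize k ε := by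
    exact_mod_cast Nat.cast_pos.1 (subsetSize_pos (ε := ε) hk)
  refine (pow_le_pow_iff_left₀ (sqrt_nonneg _) (by positivity) two_ne_zero).1 ?_
  rw [← l2Radius, l2Radius_sq hk, div_pow 2, sq_sqrt (by linarith)]
  calc 2 * α ^ 2 / (subsetSize k ε * k) * ((exp ε - 1) / (exp ε + 2 * blockCount k ε - 1)) ^ 2
      ≤ 2 * 1 ^ 2 / (1 * k) * 1 ^ 2 := by
        have h1 : 0 ≤ (exp ε - 1) / (exp ε + 2 * blockCount k ε - 1) :=
          div_nonneg (by linarith) (by linarith)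
        have h2 : (exp ε - 1) / (exp ε + 2 * blockCount k ε - 1) ≤ 1 := by
          rw [div_le_one (by linarith)]; linarith
        gcongr
    _ ≤ 2 ^ 2 / (k : ℝ) := by
        rw [one_pow, mul_one, mul_one, one_mul]
        gcongr; norm_num

end Parameters

/-! ### The upper bound -/

instance {k : ℕ} {ε : ℝ} (r : RowAssignment k ε) (p : Measure (Fin k)) [IsProbabilityMeasure p] :
    IsProbabilityMeasure (inducedLaw r p) := by
  unfold inducedLaw; infer_instance

theorem exists_upper_bound : ∃ C : ℝ, 0 < C ∧ ∀ (k : ℕ) (ε : ℝ), 2 ≤ k → 0 < ε →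
    ∀ (r : RowAssignment k ε) (α : ℝ) (n : ℕ), 0 < α → α ≤ 1 → C * rate k ε α ≤ n →
      ∃ A : RandomisedTest n (Message k ε),
        A.IsL2IdentityTester (inducedLaw r (unif k)) (l2Radius k ε α) := by
  -- half of the samples must number at least `4320 * rate k ε α`, and the rate is at least `1`
  refine ⟨10000, by norm_num, fun k ε hk hε r α n hα hα1 hn => ?_⟩
  have : NeZero k := ⟨by omega⟩
  have hk' : (2 : ℝ) ≤ k := by exact_mod_cast hk
  have hq : 0 < √(k : ℝ) := sqrt_pos.2 (by linarith)
  have hm : 4320 * rate k ε α ≤ (n / 2 : ℕ) := by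
    have h1 : (n : ℝ) ≤ 2 * (n / 2 : ℕ) + 1 := by
      have : n ≤ 2 * (n / 2) + 1 := by omega
      exact_mod_cast this
    linarith [one_le_rate (ε := ε) hk hα hα1]
  have hmγ := le_mul_l2Radius_sq hk hε hα hm
  have hγ0 : 0 < l2Radius k ε α := by
    refine lt_of_le_of_ne (sqrt_nonneg _) fun h => ?_
    rw [← h] at hmγ
    have : 0 < 120 / √(k : ℝ) := by positivity
    simp at hmγ
    linarith
  refine exists_isL2IdentityTester (m := n / 2) _ hγ0 (by omega) ?_ ?_
  · have h1 : 120 / √(k : ℝ) ≤ (n / 2 : ℕ) * l2Radius k ε α * (2 / √k) := by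
      refine hmγ.trans ?_
      rw [sq, ← mul_assoc]
      exact mul_le_mul_of_nonneg_left (l2Radius_le hk hε hα hα1) (by positivity)
    rw [← mul_div_assoc, div_le_div_iff_of_pos_right hq] at h1
    linarith
  · refine le_trans ?_ hmγ
    have h1 := sqrt_sum_sq_le_of_le (inducedLaw r (unif k))
      (inducedLaw_unif_real_le hk hε r)
    have h2 : √(3 / (k : ℝ)) ≤ 2 / √k := by
      rw [sqrt_div (by norm_num)]
      gcongr
      rw [sqrt_le_left (by norm_num)]; norm_num
    calc 60 * √(∑ z, (inducedLaw r (unif k)).real {z} ^ 2) ≤ 60 * (2 / √k) := by linarith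
      _ = 120 / √k := by ring

theorem ghrProtocol_solvesUniformityTesting {n k : ℕ} {ε α : ℝ} (hk : 2 ≤ k) (hε : 0 < ε)
    (hα : 0 < α) (r : RowAssignment k ε) (A : RandomisedTest n (Message k ε))
    (hA : A.IsL2IdentityTester (inducedLaw r (unif k)) (l2Radius k ε α)) :
    (ghrProtocol r A).SolvesUniformityTesting α := by
  have : NeZero k := ⟨by omega⟩
  refine ⟨?_, fun p hp hpα => ?_⟩
  · rw [ghrProtocol_outputIID]
    exact hA.1
  · rw [ghrProtocol_outputIID]
    exact hA.2 _ inferInstance (l2Radius_lt_l2Dist r (logB_ne_zero hk) hε hα p hpα)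

end LDPTesting

theorem mainTheorem3 :
    -- upper bound: Generalised Hadamard Response followed by an `ℓ₂` identity tester
    (∃ C : ℝ, 0 < C ∧ ∀ (k : ℕ) (ε : ℝ), 2 ≤ k → 0 < ε →
      Nonempty (LDPTesting.RowAssignment k ε) ∧
      ((Nat.clog 2 (Fintype.card (LDPTesting.Message k ε)) : ℕ) : ℝ) ≤ Real.logb 2 k + 4 ∧
      ∀ (r : LDPTesting.RowAssignment k ε) (α : ℝ) (n : ℕ), 0 < α → α ≤ 1 →
        C * LDPTesting.rate k ε α ≤ n →
        (∃ A : LDPTesting.RandomisedTest n (LDPTesting.Message k ε),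
          A.IsL2IdentityTester (LDPTesting.inducedLaw r (LDPTesting.unif k))
            (LDPTesting.l2Radius k ε α)) ∧
        ∀ A : LDPTesting.RandomisedTest n (LDPTesting.Message k ε),
          A.IsL2IdentityTester (LDPTesting.inducedLaw r (LDPTesting.unif k))
            (LDPTesting.l2Radius k ε α) →
          (LDPTesting.ghrProtocol r A).IsLDP ε ∧
          (LDPTesting.ghrProtocol r A).SolvesUniformityTesting α) ∧
    -- optimality among all private-coin locally private protocols
    (∀ α₀ : ℝ, α₀ < 1 / 2 → ∃ c : ℝ, 0 < c ∧
      ∀ (k : ℕ) (ε α : ℝ) (n : ℕ) (Y : Type u) [MeasurableSpace Y]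
        (P : LDPTesting.Protocol n k Y), 2 ≤ k → 0 < ε → 0 < α → α ≤ α₀ →
        P.IsLDP ε → P.SolvesUniformityTesting α → c * LDPTesting.rate k ε α ≤ n) ∧
    -- the trace bound
    (∀ (k : ℕ) (ε : ℝ) (Y : Type u) [MeasurableSpace Y] [Countable Y]
      [MeasurableSingletonClass Y] (R : LDPTesting.Randomiser k Y), 2 ≤ k → 0 < ε →
      R.IsPrivate ε → (LDPTesting.infoMatrix R).trace ≤ 2 * Real.exp ε) := by
  refine ⟨?_, fun α₀ hα₀ => LDPTesting.exists_lower_bound α₀ hα₀,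
    fun k ε Y _ _ _ R hk _ hR => ?_⟩
  · obtain ⟨C, hC, h⟩ := LDPTesting.exists_upper_bound
    exact ⟨C, hC, fun k ε hk hε => ⟨LDPTesting.nonempty_rowAssignment hk,
      LDPTesting.clog_card_message_le hk hε, fun r α n hα hα1 hn =>
        ⟨h k ε hk hε r α n hα hα1 hn, fun A hA =>
          ⟨fun _ => LDPTesting.ghrRandomiser_isPrivate r (LDPTesting.logB_ne_zero hk) hε,
            LDPTesting.ghrProtocol_solvesUniformityTesting hk hε hα r A hA⟩⟩⟩⟩
  · exact (LDPTesting.trace_infoMatrix_le hk hR).trans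
      (by linarith [Real.exp_pos ε])
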